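/- Let $d\ge 2$ and let $\mathbb{T}_d$ be the full infinite $d$-ary tree, in which the root has degree $d$ and every other vertex has degree $d+1$. Consider the frog model on $\mathbb{T}_d$ with i.i.d. $\mathrm{Poi}(\mu)$ sleeping frogs per vertex: at time $0$ there is one awake frog at the root, and at the non-root vertices there are independent $\mathrm{Poi}(\mu)$-distributed numbers of sleeping frogs. Awake frogs perform independent simple random walks on $\mathbb{T}_d$ in discrete time, independent of the initial numbers of frogs; when a vertex with sleeping frogs is first visited by an awake frog, all frogs sleeping there wake up and start their own walks from that vertex. If $$\mu > 2(d+1)\log d,$$ then the frog model is recurrent almost surely, that is, with probability $1$ the root is visited infinitely often by awake frogs. -/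

import Mathlib

open MeasureTheory ProbabilityTheory Filter
open scoped ENNReal NNReal

/-- Vertices of the full infinite `d`-ary tree: finite words over `Fin d`. The empty word is the
root, and the children of the word `x` are the words `a :: x` with `a : Fin d`. -/
def DaryVertex (d : ℕ) : Type := List (Fin d)

namespace DaryVertex

/-- The discrete σ-algebra on the vertex set. -/
instance (d : ℕ) : MeasurableSpace (DaryVertex d) := ⊤

instance (d : ℕ) : DiscreteMeasurableSpace (DaryVertex d) := ⟨fun _ => trivial⟩

/-- The root of the tree. -/
def root (d : ℕ) : DaryVertex d := ([] : List (Fin d))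

/-- The child of `x` with label `a`. -/
def child {d : ℕ} (x : DaryVertex d) (a : Fin d) : DaryVertex d := List.cons a x

/-- The parent of a vertex (the root is sent to itself). -/
def parent {d : ℕ} (x : DaryVertex d) : DaryVertex d := List.tail x

end DaryVertex

/-- The full infinite `d`-ary tree: each vertex is joined to its `d` children, so that the root
has degree `d` and every other vertex has degree `d + 1`. -/
def daryTree (d : ℕ) : SimpleGraph (DaryVertex d) where
  Adj x y := (∃ a, y = x.child a) ∨ (∃ a, x = y.child a)
  symm := ⟨fun _ _ h => h.symm⟩
  loopless := ⟨fun x h => by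
    rcases h with ⟨a, h⟩ | ⟨a, h⟩ <;> exact List.cons_ne_self a x h.symm⟩

theorem daryTree_neighborSet_finite (d : ℕ) (x : DaryVertex d) :
    ((daryTree d).neighborSet x).Finite := by
  refine ((Set.finite_range x.child).union (Set.finite_singleton x.parent)).subset ?_
  rintro y (⟨a, h⟩ | ⟨a, h⟩)
  · exact Or.inl ⟨a, h.symm⟩
  · refine Or.inr ?_
    rw [h]
    rfl

noncomputable instance (d : ℕ) : (daryTree d).LocallyFinite :=
  fun x => (daryTree_neighborSet_finite d x).fintype

section FrogModel

variable {V : Type*}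

open Classical in
/-- One-step transition probability of simple random walk on a locally finite graph. -/
noncomputable def srwStep (G : SimpleGraph V) [G.LocallyFinite] (u v : V) : ℝ≥0∞ :=
  if G.Adj u v then (G.degree u : ℝ≥0∞)⁻¹ else 0

open Classical in
/-- The random path `X` is a simple random walk on `G` started at `x₀`: the probability that it
follows a given finite path is the product of the transition probabilities. -/
structure IsSimpleRandomWalk (G : SimpleGraph V) [G.LocallyFinite] [MeasurableSpace V]
    {Ω : Type*} [MeasurableSpace Ω] (P : Measure Ω) (x₀ : V) (X : Ω → ℕ → V) : Prop where
  measurable : Measurable X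
  law : ∀ (n : ℕ) (x : ℕ → V), P {ω | ∀ k ≤ n, X ω k = x k} =
    if x 0 = x₀ then ∏ k ∈ Finset.range n, srwStep G (x k) (x (k + 1)) else 0

open Classical in
/-- The deterministic evolution of the frog model, given the number `η v` of frogs initially at
each vertex `v` and the path `S v i` followed, once awake, by the `i`-th frog (`i < η v`) of `v`.
`wakeState o η S t v = some s` means that the frogs of `v` woke up at time `s ≤ t`, and
`wakeState o η S t v = none` that they are still asleep at time `t`. At time `0` exactly the frogs
at `o` are awake; the frogs of another vertex wake up when an awake frog first visits it. A frog of
`u` awake since time `s` is at `S u i (t - s)` at time `t`. -/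
noncomputable def wakeState (o : V) (η : V → ℕ) (S : V → ℕ → ℕ → V) : ℕ → V → Option ℕ
  | 0, v => if v = o then some 0 else none
  | t + 1, v =>
    match wakeState o η S t v with
    | some s => some s
    | none =>
      if ∃ u s i, wakeState o η S t u = some s ∧ i < η u ∧ S u i (t + 1 - s) = v
      then some (t + 1) else none

/-- Some awake frog is at the vertex `v` at time `t`. -/
def IsOccupied (o : V) (η : V → ℕ) (S : V → ℕ → ℕ → V) (t : ℕ) (v : V) : Prop :=
  ∃ u s i, wakeState o η S t u = some s ∧ i < η u ∧ S u i (t - s) = v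

/-- A realization is recurrent if `o` is visited by awake frogs at infinitely many times. -/
def IsRecurrent (o : V) (η : V → ℕ) (S : V → ℕ → ℕ → V) : Prop :=
  ∃ᶠ t in atTop, IsOccupied o η S t o

/-- The random data of the frog model on `G` with root `o` and i.i.d. `Poi(μ)` sleeping frogs at
the vertices other than `o`: one frog at `o` (awake at time `0`), independent `Poi(μ)` numbers of
frogs at the other vertices, and an independent family, independent of these numbers, of simple
random walks, one for each potential frog. -/
structure IsPoissonFrogModel (G : SimpleGraph V) [G.LocallyFinite] [MeasurableSpace V] (o : V)
    (μ : ℝ≥0) {Ω : Type*} [MeasurableSpace Ω] (P : Measure Ω)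
    (η : Ω → V → ℕ) (S : Ω → V → ℕ → ℕ → V) : Prop where
  count_measurable : ∀ v, Measurable fun ω => η ω v
  count_root : ∀ᵐ ω ∂P, η ω o = 1
  count_law : ∀ v, v ≠ o → P.map (fun ω => η ω v) = poissonMeasure μ
  count_indep : iIndepFun (fun v ω => η ω v) P
  walk_law : ∀ v i, IsSimpleRandomWalk G P v (fun ω => S ω v i)
  walk_indep : iIndepFun (fun (f : V × ℕ) ω => S ω f.1 f.2) P
  count_walk_indep : IndepFun η S P

end FrogModel

/-! The core is an exponential bound, proved by induction on the number `n` of levels between a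
non-root vertex `p` and a fixed level `N`. Suppose the vertices from `p` to some vertex of level `N`
have been visited, and use only frogs of the subtree of `p`. Then the probability that no woken frog
visits the parent of `p` and follows a path of `C` from there is at most `exp (-(n * g) * min (Q C)
s)`. Here `Q` is the walk law at the parent, `b = branchWeight d`, `s = d * b`, and `g = levelGain d
μ > 0` (`avoid_le`). Allowing an arbitrary event `C`, and not just a return, is what lets the
induction close: a frog coming back to `p` from a child subtree continues as a fresh walk from `p`,
so "its continuation reaches level `N` in a given set of vertices, or goes to the parent and then
follows `C`" is itself an event to which the bound for the child applies.

For one step (`avoid_step`), the nodes are `p` with its Poisson frogs and the vertices of level `N`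
below `p`; a reached node launches paths from `p`, which lead to further nodes or to the mark
"parent, then `C`". Nodes below the same child form a block. Different blocks are independent, but
outputs inside a block are dependent. A replacement argument (`sum_markUnreached_update_le`) shows
that missing the mark only becomes likelier when a block is given one common output with larger
avoidance probabilities, so a single-node estimate suffices and all outputs may be taken to consist
of independent inclusions. Jensen's inequality then reduces to the case `σ = s` of the mark
strength, and a union bound over the set of reached blocks finishes.

With `u` unreached branches, the frogs of `p` contribute `μ * b * (1 + u)` to the exponent, and the
`d - u ≥ 1` reached branches contribute `(d - u) * (1 + u) ≥ d` times `l * b`, where `l` is the rate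
already proved for the children. Hence the old exponent `l * s` survives in full, and the frogs of
`p` yield a factor `x * (1 + x) ^ (d - 1)` with `x = exp (-(μ * b))`. The hypothesis on `μ` makes
this factor less than `1`, which gives `g > 0`.

The initial frog almost surely reaches level `n + 1`, so letting `n → ∞` shows that every `C` of
positive probability is almost surely followed by some woken frog after a visit to the root
(`measure_no_return_eq_zero`). Applying this to countably many events `leavesRay a r`, only finitely
many of which can be accounted for by finitely many visits, gives infinitely many visits. -/

set_option linter.unusedSectionVars false

open DaryVertex

/-! ### Cylinders, the Markov property and one-step estimates for simple random walk -/

section WalkLaw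

variable {V : Type*}

/-- The set of paths that agree with `x` up to time `n`. -/
def pathCylinder (n : ℕ) (x : ℕ → V) : Set (ℕ → V) := {z | ∀ k ≤ n, z k = x k}

/-- The path seen from time `t` on. -/
def pathShift (t : ℕ) (z : ℕ → V) : ℕ → V := fun j => z (t + j)

/-- The set `A` of paths is determined by the positions up to time `n`. -/
def DeterminedBy (n : ℕ) (A : Set (ℕ → V)) : Prop :=
  ∀ ⦃z z' : ℕ → V⦄, (∀ k ≤ n, z k = z' k) → z ∈ A → z' ∈ A

/-- Extension of a finite path to an infinite one. -/
def extendPrefix {n : ℕ} (p : Fin (n + 1) → V) : ℕ → V :=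
  fun k => if h : k < n + 1 then p ⟨k, h⟩ else p 0

theorem extendPrefix_of_le {n k : ℕ} (p : Fin (n + 1) → V) (h : k ≤ n) :
    extendPrefix p k = p ⟨k, Nat.lt_succ_of_le h⟩ := by
  simp [extendPrefix, Nat.lt_succ_of_le h]

/-- For countable `V` this union is countable, and it is disjoint. Measurability and the Markov
property thus reduce to cylinders. -/
theorem DeterminedBy.eq_iUnion {n : ℕ} {A : Set (ℕ → V)} (hA : DeterminedBy n A) :
    A = ⋃ p : {p : Fin (n + 1) → V // extendPrefix p ∈ A}, pathCylinder n (extendPrefix p.1) := by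
  ext z
  simp only [Set.mem_iUnion]
  constructor
  · intro hz
    refine ⟨⟨fun k => z k, hA (fun k hk => ?_) hz⟩, fun k hk => ?_⟩ <;>
      simp [extendPrefix_of_le _ hk]
  · rintro ⟨p, hp⟩
    exact hA (fun k hk => (hp k hk).symm) p.2

theorem pairwise_disjoint_pathCylinder (n : ℕ) :
    Pairwise (Function.onFun Disjoint
      fun p : Fin (n + 1) → V => pathCylinder n (extendPrefix p)) := by
  intro p q hpq
  refine Set.disjoint_left.2 fun z hz hz' => hpq ?_
  funext k
  have h1 := hz k (Nat.le_of_lt_succ k.2)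
  have h2 := hz' k (Nat.le_of_lt_succ k.2)
  rw [extendPrefix_of_le _ (Nat.le_of_lt_succ k.2)] at h1 h2
  exact h1.symm.trans h2

variable [MeasurableSpace V] [DiscreteMeasurableSpace V]

theorem measurableSet_pathCylinder (n : ℕ) (x : ℕ → V) : MeasurableSet (pathCylinder n x) := by
  have : pathCylinder n x = ⋂ k, ⋂ (_ : k ≤ n), (fun z : ℕ → V => z k) ⁻¹' {x k} := by
    ext z; simp [pathCylinder]
  rw [this]
  exact MeasurableSet.iInter fun k => MeasurableSet.iInter fun _ =>
    measurable_pi_apply k (MeasurableSet.of_discrete)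

theorem DeterminedBy.measurableSet [Countable V] {n : ℕ} {A : Set (ℕ → V)}
    (hA : DeterminedBy n A) : MeasurableSet A := by
  rw [hA.eq_iUnion]
  exact MeasurableSet.iUnion fun p => measurableSet_pathCylinder _ _

theorem measurable_pathShift (t : ℕ) : Measurable (pathShift t : (ℕ → V) → ℕ → V) :=
  measurable_pi_lambda _ fun j => measurable_pi_apply (t + j)

theorem isPiSystem_pathCylinder :
    IsPiSystem {A : Set (ℕ → V) | ∃ n x, A = pathCylinder n x} := by
  have key : ∀ (m n : ℕ) (x y : ℕ → V), m ≤ n → (pathCylinder m x ∩ pathCylinder n y).Nonempty →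
      pathCylinder m x ∩ pathCylinder n y = pathCylinder n y := by
    rintro m n x y hmn ⟨z, hz, hz'⟩
    refine Set.inter_eq_right.2 fun w hw k hk => ?_
    rw [hw k (hk.trans hmn), ← hz' k (hk.trans hmn), hz k hk]
  rintro _ ⟨m, x, rfl⟩ _ ⟨n, y, rfl⟩ hne
  rcases le_total m n with h | h
  · exact ⟨n, y, key m n x y h hne⟩
  · rw [Set.inter_comm] at hne ⊢
    exact ⟨m, x, key n m y x h hne⟩

theorem generateFrom_pathCylinder [Countable V] :
    (inferInstance : MeasurableSpace (ℕ → V)) =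
      MeasurableSpace.generateFrom {A : Set (ℕ → V) | ∃ n x, A = pathCylinder n x} := by
  refine le_antisymm ?_ (MeasurableSpace.generateFrom_le ?_)
  · refine iSup_le fun k => ?_
    rintro _ ⟨s, _, rfl⟩
    have hd : DeterminedBy k ((fun z : ℕ → V => z k) ⁻¹' s) := by
      intro z z' h hz
      rw [Set.mem_preimage, ← h k le_rfl]
      exact hz
    rw [hd.eq_iUnion]
    exact MeasurableSet.iUnion fun p => MeasurableSpace.measurableSet_generateFrom ⟨k, _, rfl⟩
  · rintro _ ⟨n, x, rfl⟩
    exact measurableSet_pathCylinder n x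

theorem path_measure_ext [Countable V] {μ ν : Measure (ℕ → V)} [IsFiniteMeasure μ]
    (h : ∀ n x, μ (pathCylinder n x) = ν (pathCylinder n x)) (huniv : μ Set.univ = ν Set.univ) :
    μ = ν := by
  refine ext_of_generate_finite _ generateFrom_pathCylinder isPiSystem_pathCylinder ?_ huniv
  rintro _ ⟨n, x, rfl⟩
  exact h n x

open Classical in
/-- `Q v` is the law of simple random walk on `G` started at `v`. -/
structure IsWalkLaw (G : SimpleGraph V) [G.LocallyFinite] (Q : V → Measure (ℕ → V)) : Prop where
  prob : ∀ v, IsProbabilityMeasure (Q v)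
  cyl : ∀ v n x, Q v (pathCylinder n x) =
    if x 0 = v then ∏ k ∈ Finset.range n, srwStep G (x k) (x (k + 1)) else 0

namespace IsWalkLaw

variable {G : SimpleGraph V} [G.LocallyFinite] {Q : V → Measure (ℕ → V)} [Countable V]

/-- As functions of `C` both sides are finite measures on paths. They agree on cylinders, because
the product of transition probabilities along a concatenated path splits at time `t`; cylinders form
a generating π-system. -/
theorem markov_cylinder (hQ : IsWalkLaw G Q) (v : V) (t : ℕ) (x : ℕ → V) {C : Set (ℕ → V)}
    (hC : MeasurableSet C) :
    Q v (pathCylinder t x ∩ pathShift t ⁻¹' C) = Q v (pathCylinder t x) * Q (x t) C := by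
  have := hQ.prob v
  have := hQ.prob (x t)
  have h : ((Q v).restrict (pathCylinder t x)).map (pathShift t) =
      Q v (pathCylinder t x) • Q (x t) := by
    refine path_measure_ext (fun n y => ?_) ?_
    · rw [Measure.map_apply (measurable_pathShift t) (measurableSet_pathCylinder n y),
        Measure.restrict_apply (measurable_pathShift t (measurableSet_pathCylinder n y)),
        Measure.smul_apply, smul_eq_mul, Set.inter_comm]
      by_cases hy : y 0 = x t
      · have hset : pathCylinder t x ∩ pathShift t ⁻¹' pathCylinder n y =
            pathCylinder (t + n) (fun k => if k ≤ t then x k else y (k - t)) := by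
          ext z
          constructor
          · rintro ⟨h1, h2⟩ k hk
            by_cases hkt : k ≤ t
            · simpa [hkt] using h1 k hkt
            · have := h2 (k - t) (by omega)
              simp only [pathShift] at this
              rw [Nat.add_sub_cancel' (by omega)] at this
              simpa [hkt] using this
          · intro h
            refine ⟨fun k hk => by simpa [hk] using h k (by omega), fun k hk => ?_⟩
            have := h (t + k) (by omega)
            rcases Nat.eq_zero_or_pos k with rfl | hpos
            · simpa [pathShift, hy] using this
            · simpa [pathShift, show ¬ (t + k ≤ t) by omega] using this
        rw [hset, hQ.cyl, hQ.cyl, hQ.cyl]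
        by_cases hv : x 0 = v
        · simp only [Nat.zero_le, if_true, hv, hy]
          rw [Finset.prod_range_add]
          congr 1
          · refine Finset.prod_congr rfl fun k hk => ?_
            have := Finset.mem_range.1 hk
            simp [show k ≤ t by omega, show k + 1 ≤ t by omega]
          · refine Finset.prod_congr rfl fun k hk => ?_
            rcases Nat.eq_zero_or_pos k with rfl | hpos
            · simp [hy]
            · simp [show ¬ (t + k ≤ t) by omega, show ¬ (t + k + 1 ≤ t) by omega,
                show t + k + 1 - t = k + 1 by omega]
        · simp [hv]
      · have hset : pathCylinder t x ∩ pathShift t ⁻¹' pathCylinder n y = ∅ := by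
          ext z
          simp only [Set.mem_inter_iff, Set.mem_empty_iff_false, iff_false, not_and]
          intro h1 h2
          exact hy ((h2 0 (Nat.zero_le _)).symm.trans (h1 t le_rfl))
        rw [hset, measure_empty, hQ.cyl (x t), if_neg hy, mul_zero]
    · rw [Measure.map_apply (measurable_pathShift t) MeasurableSet.univ]
      simp
  have h' := congrArg (fun m => m C) h
  rw [Measure.map_apply (measurable_pathShift t) hC,
    Measure.restrict_apply (measurable_pathShift t hC), Measure.smul_apply, smul_eq_mul] at h'
  rw [Set.inter_comm, h']

theorem markov (hQ : IsWalkLaw G Q) (v q : V) (t : ℕ) {A C : Set (ℕ → V)}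
    (hA : DeterminedBy t A) (hAq : ∀ z ∈ A, z t = q) (hC : MeasurableSet C) :
    Q v (A ∩ pathShift t ⁻¹' C) = Q v A * Q q C := by
  have hdisj : Pairwise (Function.onFun Disjoint
      fun p : {p : Fin (t + 1) → V // extendPrefix p ∈ A} =>
        pathCylinder t (extendPrefix p.1)) := fun p p' hp =>
    pairwise_disjoint_pathCylinder t (fun h => hp (Subtype.ext h))
  have hA' := hA.eq_iUnion
  have e1 : Q v A = ∑' p : {p : Fin (t + 1) → V // extendPrefix p ∈ A},
      Q v (pathCylinder t (extendPrefix p.1)) := by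
    conv_lhs => rw [hA']
    exact measure_iUnion hdisj fun p => measurableSet_pathCylinder _ _
  have e2 : Q v (A ∩ pathShift t ⁻¹' C) = ∑' p : {p : Fin (t + 1) → V // extendPrefix p ∈ A},
      Q v (pathCylinder t (extendPrefix p.1) ∩ pathShift t ⁻¹' C) := by
    conv_lhs => rw [hA', Set.iUnion_inter]
    exact measure_iUnion (fun p p' hp => (hdisj hp).mono Set.inter_subset_left
      Set.inter_subset_left) fun p => (measurableSet_pathCylinder _ _).inter
        (measurable_pathShift t hC)
  rw [e1, e2, ← ENNReal.tsum_mul_right]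
  refine tsum_congr fun p => ?_
  rw [hQ.markov_cylinder v t _ hC, hAq _ p.2]

/-- The Markov property at a random time `t` described by disjoint events `A t`. -/
theorem markov_iUnion (hQ : IsWalkLaw G Q) (v q : V) {A : ℕ → Set (ℕ → V)} {C : Set (ℕ → V)}
    (hA : ∀ t, DeterminedBy t (A t)) (hAq : ∀ t, ∀ z ∈ A t, z t = q)
    (hdisj : Pairwise (Function.onFun Disjoint A)) (hC : MeasurableSet C) :
    Q v (⋃ t, A t ∩ pathShift t ⁻¹' C) = Q v (⋃ t, A t) * Q q C := by
  rw [measure_iUnion hdisj fun t => (hA t).measurableSet, measure_iUnion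
    (fun s t h => (hdisj h).mono Set.inter_subset_left Set.inter_subset_left)
    fun t => (hA t).measurableSet.inter (measurable_pathShift t hC), ← ENNReal.tsum_mul_right]
  exact tsum_congr fun t => hQ.markov v q t (hA t) (hAq t) hC

theorem ae_start (hQ : IsWalkLaw G Q) (v : V) : ∀ᵐ z ∂(Q v), z 0 = v := by
  have := hQ.prob v
  have hm : MeasurableSet (pathCylinder 0 (fun _ => v)) := measurableSet_pathCylinder _ _
  have h := hQ.cyl v 0 (fun _ => v)
  simp only [if_true, Finset.range_zero, Finset.prod_empty] at h
  filter_upwards [(prob_compl_eq_zero_iff hm).2 h] with z hz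
  exact hz 0 le_rfl

/-- One-step lower bound. -/
theorem step_le (hQ : IsWalkLaw G Q) (v : V) (s : Finset V) {E : Set (ℕ → V)}
    {F : V → Set (ℕ → V)} (hF : ∀ u ∈ s, MeasurableSet (F u))
    (hEF : ∀ u ∈ s, ∀ z : ℕ → V, z 0 = v → z 1 = u → pathShift 1 z ∈ F u → z ∈ E) :
    ∑ u ∈ s, srwStep G v u * Q u (F u) ≤ Q v E := by
  have hstep : ∀ u, Q v {z | z 0 = v ∧ z 1 = u} = srwStep G v u := by
    intro u
    have h := hQ.cyl v 1 (fun k => if k = 0 then v else u)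
    simp only [if_true, Finset.range_one, Finset.prod_singleton] at h
    rw [show {z : ℕ → V | z 0 = v ∧ z 1 = u} =
      pathCylinder 1 (fun k => if k = 0 then v else u) from ?_, h]
    · simp
    · ext z
      refine ⟨fun hz k hk => ?_, fun hz => ⟨by simpa using hz 0 (by simp), by simpa using hz 1⟩⟩
      interval_cases k
      · simpa using hz.1
      · simpa using hz.2
  have hdet : ∀ u, DeterminedBy 1 {z : ℕ → V | z 0 = v ∧ z 1 = u} := by
    intro u z z' h hz
    exact ⟨(h 0 (by simp)).symm.trans hz.1, (h 1 le_rfl).symm.trans hz.2⟩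
  calc ∑ u ∈ s, srwStep G v u * Q u (F u)
      = ∑ u ∈ s, Q v ({z | z 0 = v ∧ z 1 = u} ∩ pathShift 1 ⁻¹' F u) := by
        refine Finset.sum_congr rfl fun u hu => ?_
        rw [hQ.markov v u 1 (hdet u) (fun z hz => hz.2) (hF u hu), hstep]
    _ = Q v (⋃ u ∈ s, {z | z 0 = v ∧ z 1 = u} ∩ pathShift 1 ⁻¹' F u) := by
        rw [measure_biUnion_finset]
        · intro a _ b _ hab
          exact Set.disjoint_left.2 fun z hz hz' => hab (hz.1.2.symm.trans hz'.1.2)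
        · exact fun u hu => (hdet u).measurableSet.inter (measurable_pathShift 1 (hF u hu))
    _ ≤ Q v E := by
        refine measure_mono ?_
        simp only [Set.iUnion_subset_iff]
        rintro u hu z ⟨⟨h0, h1⟩, h2⟩
        exact hEF u hu z h0 h1 h2

/-- The walk moves along edges. -/
theorem ae_adj (hQ : IsWalkLaw G Q) (v : V) : ∀ᵐ z ∂(Q v), ∀ k, G.Adj (z k) (z (k + 1)) := by
  have := hQ.prob v
  refine ae_all_iff.2 fun k => ?_
  have hdet : DeterminedBy (k + 1) {z : ℕ → V | ¬ G.Adj (z k) (z (k + 1))} := by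
    intro z z' h hz
    simpa only [Set.mem_ofPred_eq, ← h k (by omega), ← h (k + 1) le_rfl] using hz
  rw [ae_iff, hdet.eq_iUnion, measure_iUnion_null_iff]
  intro p
  rw [hQ.cyl]
  split_ifs
  · refine Finset.prod_eq_zero (Finset.mem_range.2 (Nat.lt_succ_self k)) ?_
    exact if_neg p.2
  · rfl

end IsWalkLaw

end WalkLaw

/-! ### Exits, visits and first visits -/

section PathEvents

variable {V : Type*}

/-- The paths that leave the region `R` at the vertex `z` (for `z ∉ R`). -/
def exitAt (R : Set V) (z : V) : Set (ℕ → V) := {x | ∃ k, x k = z ∧ ∀ j < k, x j ∈ R}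

/-- The paths that visit `q`, and after some visit to `q` follow a path of `C`. -/
def visitThen (q : V) (C : Set (ℕ → V)) : Set (ℕ → V) := {x | ∃ k, x k = q ∧ pathShift k x ∈ C}

/-- The paths that are at `q` for the first time at time `t`. -/
def firstVisit (q : V) (t : ℕ) : Set (ℕ → V) := {x | x t = q ∧ ∀ j < t, x j ≠ q}

theorem determinedBy_firstVisit (q : V) (t : ℕ) : DeterminedBy t (firstVisit q t) := by
  rintro z z' h ⟨h1, h2⟩
  refine ⟨(h t le_rfl).symm.trans h1, fun j hj => ?_⟩
  rw [← h j hj.le]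
  exact h2 j hj

theorem pairwise_disjoint_firstVisit (q : V) :
    Pairwise (Function.onFun Disjoint (firstVisit q)) := by
  intro s t hst
  refine Set.disjoint_left.2 fun x hx hx' => ?_
  rcases lt_or_gt_of_ne hst with h | h
  · exact hx'.2 s h hx.1
  · exact hx.2 t h hx'.1

theorem iUnion_firstVisit (q : V) : ⋃ t, firstVisit q t = {x : ℕ → V | ∃ k, x k = q} := by
  classical
  ext x
  simp only [Set.mem_iUnion]
  constructor
  · rintro ⟨t, h, _⟩
    exact ⟨t, h⟩
  · intro h
    exact ⟨Nat.find h, Nat.find_spec h, fun j hj => Nat.find_min h hj⟩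

theorem disjoint_exitAt {R : Set V} {z z' : V} (hz : z ∉ R) (hz' : z' ∉ R) (h : z ≠ z') :
    Disjoint (exitAt R z) (exitAt R z') := by
  refine Set.disjoint_left.2 ?_
  rintro x ⟨k, hk, hk'⟩ ⟨l, hl, hl'⟩
  rcases lt_trichotomy k l with hkl | hkl | hkl
  · exact hz (hk ▸ hl' k hkl)
  · subst hkl
    exact h (hk.symm.trans hl)
  · exact hz' (hl ▸ hk' l hkl)

variable [MeasurableSpace V] [DiscreteMeasurableSpace V] [Countable V]

theorem measurableSet_exitAt (R : Set V) (z : V) : MeasurableSet (exitAt R z) := by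
  have : exitAt R z = ⋃ k, {x : ℕ → V | x k = z ∧ ∀ j < k, x j ∈ R} := by
    ext x; simp [exitAt]
  rw [this]
  refine MeasurableSet.iUnion fun k => DeterminedBy.measurableSet (n := k) ?_
  rintro x x' h ⟨h1, h2⟩
  refine ⟨(h k le_rfl).symm.trans h1, fun j hj => ?_⟩
  rw [← h j hj.le]
  exact h2 j hj

theorem measurableSet_visit (q : V) : MeasurableSet {x : ℕ → V | ∃ k, x k = q} := by
  rw [← iUnion_firstVisit]
  exact MeasurableSet.iUnion fun t => (determinedBy_firstVisit q t).measurableSet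

theorem measurableSet_visitThen (q : V) {C : Set (ℕ → V)} (hC : MeasurableSet C) :
    MeasurableSet (visitThen q C) := by
  have : visitThen q C = ⋃ k, ((fun x : ℕ → V => x k) ⁻¹' {q} ∩ pathShift k ⁻¹' C) := by
    ext x; simp [visitThen]
  rw [this]
  exact MeasurableSet.iUnion fun k =>
    (measurable_pi_apply k (MeasurableSet.of_discrete)).inter (measurable_pathShift k hC)

/-- Markov property at the first visit to `q`. Only an inequality, since `visitThen` allows any
later visit as well. -/
theorem IsWalkLaw.visit_mul_le {G : SimpleGraph V} [G.LocallyFinite] {Q : V → Measure (ℕ → V)}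
    (hQ : IsWalkLaw G Q) (v q : V) {C : Set (ℕ → V)} (hC : MeasurableSet C) :
    (Q v).real {x | ∃ k, x k = q} * (Q q).real C ≤ (Q v).real (visitThen q C) := by
  have := hQ.prob v
  rw [← iUnion_firstVisit, measureReal_def, measureReal_def, ← ENNReal.toReal_mul,
    ← hQ.markov_iUnion v q (determinedBy_firstVisit q) (fun t z hz => hz.1)
      (pairwise_disjoint_firstVisit q) hC]
  refine measureReal_mono ?_
  simp only [Set.iUnion_subset_iff]
  rintro t x ⟨h1, h2⟩
  exact ⟨t, h1.1, h2⟩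

end PathEvents

/-! ### Ancestors and levels in the tree -/

namespace DaryVertex

variable {d : ℕ}

instance : Countable (DaryVertex d) := inferInstanceAs (Countable (List (Fin d)))

instance : DecidableEq (DaryVertex d) := inferInstanceAs (DecidableEq (List (Fin d)))

/-- The distance to the root. -/
def level (x : DaryVertex d) : ℕ := List.length x

/-- `u` lies on the path from the root to `v`. -/
def IsAncestor (u v : DaryVertex d) : Prop := List.IsSuffix (α := Fin d) u v

theorem IsAncestor.refl (u : DaryVertex d) : IsAncestor u u := List.suffix_rfl

theorem IsAncestor.trans {u v w : DaryVertex d} (h : IsAncestor u v) (h' : IsAncestor v w) :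
    IsAncestor u w := List.IsSuffix.trans h h'

theorem isAncestor_child (u : DaryVertex d) (a : Fin d) : IsAncestor u (u.child a) :=
  List.suffix_cons a u

theorem isAncestor_child_iff {u v : DaryVertex d} {a : Fin d} :
    IsAncestor u (v.child a) ↔ u = v.child a ∨ IsAncestor u v := List.suffix_cons_iff

theorem isAncestor_parent (u : DaryVertex d) : IsAncestor u.parent u := List.tail_suffix u

theorem IsAncestor.level_le {u v : DaryVertex d} (h : IsAncestor u v) : u.level ≤ v.level :=
  List.IsSuffix.length_le h

theorem IsAncestor.eq_of_level {u v : DaryVertex d} (h : IsAncestor u v)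
    (h' : u.level = v.level) : u = v := List.IsSuffix.eq_of_length h h'

theorem level_child (u : DaryVertex d) (a : Fin d) : (u.child a).level = u.level + 1 :=
  List.length_cons

theorem parent_child (u : DaryVertex d) (a : Fin d) : (u.child a).parent = u := rfl

theorem child_ne_root (u : DaryVertex d) (a : Fin d) : u.child a ≠ root d := List.cons_ne_nil a u

theorem exists_eq_child {u : DaryVertex d} (h : u ≠ root d) : ∃ a, u = u.parent.child a := by
  match u, h with
  | [], h => exact absurd rfl h
  | a :: l, _ => exact ⟨a, rfl⟩

theorem level_parent {u : DaryVertex d} (h : u ≠ root d) : u.parent.level + 1 = u.level := by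
  obtain ⟨a, ha⟩ := exists_eq_child h
  conv_rhs => rw [ha, level_child]

theorem child_injective (u : DaryVertex d) : Function.Injective u.child :=
  fun _ _ h => (List.cons.inj h).1

theorem IsAncestor.parent_of_ne {u v : DaryVertex d} (h : IsAncestor u v) (hne : u ≠ v) :
    IsAncestor u v.parent := by
  by_cases hv : v = root d
  · subst hv
    exact absurd (List.suffix_nil.1 h) hne
  · obtain ⟨a, ha⟩ := exists_eq_child hv
    rw [ha] at h
    rcases isAncestor_child_iff.1 h with h' | h'
    · exact absurd (h'.trans ha.symm) hne
    · exact h'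

theorem IsAncestor.total {u v w : DaryVertex d} (h : IsAncestor u w) (h' : IsAncestor v w) :
    IsAncestor u v ∨ IsAncestor v u := List.suffix_or_suffix_of_suffix h h'

theorem IsAncestor.exists_child {u v : DaryVertex d} (h : IsAncestor u v)
    (hl : u.level < v.level) : ∃ a, IsAncestor (u.child a) v := by
  obtain ⟨t, ht⟩ := h
  rcases List.eq_nil_or_concat t with rfl | ⟨t', a, rfl⟩
  · subst ht
    exact absurd hl (lt_irrefl _)
  · refine ⟨a, t', ?_⟩
    rw [← ht, List.concat_eq_append]
    exact (List.append_assoc t' [a] u).symm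

theorem child_eq_of_isAncestor {u v : DaryVertex d} {a b : Fin d}
    (ha : IsAncestor (u.child a) v) (hb : IsAncestor (u.child b) v) : a = b := by
  have hl : (u.child a).level = (u.child b).level := by rw [level_child, level_child]
  rcases ha.total hb with h | h
  · exact u.child_injective (h.eq_of_level hl)
  · exact (u.child_injective (h.eq_of_level hl.symm)).symm

theorem finite_level (N : ℕ) : {v : DaryVertex d | v.level = N}.Finite :=
  List.finite_length_eq (Fin d) N

end DaryVertex

/-! ### Hitting and exit probabilities on the tree -/

section TreeWalk

variable {d : ℕ}

theorem daryTree_neighborSet (x : DaryVertex d) (hx : x ≠ root d) :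
    (daryTree d).neighborSet x = insert x.parent (Set.range x.child) := by
  ext y
  simp only [SimpleGraph.mem_neighborSet, Set.mem_insert_iff, Set.mem_range]
  constructor
  · rintro (⟨a, h⟩ | ⟨a, h⟩)
    · exact Or.inr ⟨a, h.symm⟩
    · left
      rw [h, parent_child]
  · rintro (h | ⟨a, h⟩)
    · obtain ⟨a, ha⟩ := exists_eq_child hx
      exact Or.inr ⟨a, by rw [h]; exact ha⟩
    · exact Or.inl ⟨a, h.symm⟩

theorem daryTree_neighborSet_root :
    (daryTree d).neighborSet (root d) = Set.range (root d).child := by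
  ext y
  simp only [SimpleGraph.mem_neighborSet, Set.mem_range]
  constructor
  · rintro (⟨a, h⟩ | ⟨a, h⟩)
    · exact ⟨a, h.symm⟩
    · exact absurd h.symm (child_ne_root y a)
  · rintro ⟨a, h⟩
    exact Or.inl ⟨a, h.symm⟩

theorem parent_ne_child (x : DaryVertex d) (a : Fin d) : x.parent ≠ x.child a := by
  intro h
  have h1 := (isAncestor_parent x).level_le
  rw [h, level_child] at h1
  omega

theorem daryTree_degree (x : DaryVertex d) (hx : x ≠ root d) : (daryTree d).degree x = d + 1 := by
  rw [← SimpleGraph.card_neighborSet_eq_degree, ← Nat.card_eq_fintype_card, Nat.card_coe_set_eq,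
    daryTree_neighborSet x hx, Set.ncard_insert_of_notMem, Set.ncard_range_of_injective x.child_injective]
  · simp
  · rintro ⟨a, ha⟩
    exact parent_ne_child x a ha.symm

theorem daryTree_degree_root : (daryTree d).degree (root d) = d := by
  rw [← SimpleGraph.card_neighborSet_eq_degree, ← Nat.card_eq_fintype_card, Nat.card_coe_set_eq,
    daryTree_neighborSet_root, Set.ncard_range_of_injective (root d).child_injective]
  simp

variable {Q : DaryVertex d → Measure (ℕ → DaryVertex d)}

theorem tree_step_le (hQ : IsWalkLaw (daryTree d) Q) {x : DaryVertex d} (hx : x ≠ root d)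
    {E : Set (ℕ → DaryVertex d)} {F : DaryVertex d → Set (ℕ → DaryVertex d)}
    (hF : ∀ u, MeasurableSet (F u))
    (hEF : ∀ u, ∀ z : ℕ → DaryVertex d, z 0 = x → z 1 = u → pathShift 1 z ∈ F u → z ∈ E) :
    (1 / ((d : ℝ) + 1)) * ((Q x.parent).real (F x.parent) +
      ∑ a, (Q (x.child a)).real (F (x.child a))) ≤ (Q x).real E := by
  have hp := hQ.prob
  have h := hQ.step_le x (insert x.parent (Finset.univ.image x.child)) (F := F) (E := E)
    (fun u _ => hF u) (fun u _ => hEF u)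
  have hst : ∀ u ∈ (daryTree d).neighborSet x, srwStep (daryTree d) x u = ((d : ℝ≥0∞) + 1)⁻¹ := by
    intro u hu
    have : (daryTree d).Adj x u := hu
    simp [srwStep, this, daryTree_degree x hx]
  rw [Finset.sum_insert, Finset.sum_image (fun a _ b _ h => x.child_injective h),
    hst _ (by rw [daryTree_neighborSet x hx]; simp)] at h
  · rw [Finset.sum_congr rfl fun a _ => by
      rw [hst (x.child a) (by rw [daryTree_neighborSet x hx]; simp)], ← Finset.mul_sum,
      ← mul_add] at h
    have h' := ENNReal.toReal_mono (measure_ne_top _ _) h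
    rw [ENNReal.toReal_mul, ENNReal.toReal_add (measure_ne_top _ _)
      (ENNReal.sum_ne_top.2 fun a _ => measure_ne_top _ _),
      ENNReal.toReal_sum fun a _ => measure_ne_top _ _] at h'
    have e : (((d : ℝ≥0∞) + 1)⁻¹).toReal = 1 / ((d : ℝ) + 1) := by
      rw [ENNReal.toReal_inv, ENNReal.toReal_add (by simp) (by simp)]
      simp
    rw [e] at h'
    exact h'
  · simp only [Finset.mem_image, Finset.mem_univ, true_and, not_exists]
    exact fun a ha => parent_ne_child x a ha.symm

theorem tree_step_root_le (hQ : IsWalkLaw (daryTree d) Q)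
    {E : Set (ℕ → DaryVertex d)} {F : DaryVertex d → Set (ℕ → DaryVertex d)}
    (hF : ∀ u, MeasurableSet (F u))
    (hEF : ∀ u, ∀ z : ℕ → DaryVertex d, z 0 = root d → z 1 = u → pathShift 1 z ∈ F u → z ∈ E) :
    (1 / (d : ℝ)) * ∑ a, (Q ((root d).child a)).real (F ((root d).child a)) ≤
      (Q (root d)).real E := by
  have hp := hQ.prob
  have h := hQ.step_le (root d) (Finset.univ.image (root d).child) (F := F) (E := E)
    (fun u _ => hF u) (fun u _ => hEF u)
  have hst : ∀ u ∈ (daryTree d).neighborSet (root d),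
      srwStep (daryTree d) (root d) u = (d : ℝ≥0∞)⁻¹ := by
    intro u hu
    have : (daryTree d).Adj (root d) u := hu
    simp [srwStep, this, daryTree_degree_root]
  rw [Finset.sum_image (fun a _ b _ h => (root d).child_injective h),
    Finset.sum_congr rfl fun a _ => by
      rw [hst ((root d).child a) (by rw [daryTree_neighborSet_root]; simp)], ← Finset.mul_sum] at h
  have h' := ENNReal.toReal_mono (measure_ne_top _ _) h
  rw [ENNReal.toReal_mul, ENNReal.toReal_sum fun a _ => measure_ne_top _ _] at h'
  rw [ENNReal.toReal_inv, ENNReal.toReal_natCast, inv_eq_one_div] at h'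
  exact h'

/-- Let `h` be the infimum of these probabilities over all non-root vertices. After a step to a
child the walk must climb two edges, so `(1 + d * h ^ 2) / (d + 1) ≤ h`, that is `(d * h - 1) * (h -
1) ≤ 0`. With `h ≤ 1` this forces `h ≥ 1 / d`. -/
theorem one_div_le_visit_parent (hd : 2 ≤ d) (hQ : IsWalkLaw (daryTree d) Q) (p : DaryVertex d)
    (hp : p ≠ root d) : 1 / (d : ℝ) ≤ (Q p).real {x | ∃ k, x k = p.parent} := by
  have hprob := hQ.prob
  let u : {p : DaryVertex d // p ≠ root d} → ℝ := fun p => (Q p.1).real {x | ∃ k, x k = p.1.parent}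
  have hbdd : BddBelow (Set.range u) := ⟨0, by rintro _ ⟨p, rfl⟩; exact measureReal_nonneg⟩
  set h : ℝ := ⨅ p, u p with hh
  have hle : ∀ p hp, h ≤ (Q p).real {x | ∃ k, x k = p.parent} := fun p hp => ciInf_le hbdd ⟨p, hp⟩
  have : Nonempty {p : DaryVertex d // p ≠ root d} := ⟨⟨p, hp⟩⟩
  have h0 : 0 ≤ h := le_ciInf fun p => measureReal_nonneg
  have h1 : h ≤ 1 := (hle p hp).trans measureReal_le_one
  have key : (1 + d * (h * h)) / (d + 1) ≤ h := by
    refine le_ciInf ?_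
    rintro ⟨p, hp⟩
    have hs := tree_step_le hQ hp (E := {x | ∃ k, x k = p.parent})
      (F := fun u => if u = p.parent then Set.univ else {x | ∃ k, x k = p.parent})
      (fun u => by split_ifs; exacts [MeasurableSet.univ, measurableSet_visit _])
      (fun u z _ h1 hz => by
        by_cases hu : u = p.parent
        · exact ⟨1, h1.trans hu⟩
        · simp only [hu, if_false] at hz
          obtain ⟨k, hk⟩ := hz
          exact ⟨1 + k, hk⟩)
    refine le_trans ?_ hs
    rw [if_pos rfl, probReal_univ, div_eq_mul_one_div, mul_comm]
    gcongr
    calc (d : ℝ) * (h * h) = ∑ a : Fin d, h * h := by simp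
      _ ≤ _ := Finset.sum_le_sum fun a _ => by
        rw [if_neg (fun h => parent_ne_child p a h.symm)]
        calc h * h ≤ (Q (p.child a)).real {x | ∃ k, x k = p} *
              (Q p).real {x | ∃ k, x k = p.parent} :=
              mul_le_mul (hle (p.child a) (child_ne_root p a)) (hle p hp) h0 measureReal_nonneg
          _ ≤ (Q (p.child a)).real (visitThen p {x | ∃ k, x k = p.parent}) :=
              hQ.visit_mul_le _ _ (measurableSet_visit _)
          _ ≤ _ := by
            refine measureReal_mono ?_
            rintro x ⟨k, _, j, hj⟩
            exact ⟨k + j, hj⟩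
  have hd' : (2 : ℝ) ≤ d := by exact_mod_cast hd
  refine le_trans ?_ (hle p hp)
  rw [div_le_iff₀ (by positivity)] at key ⊢
  by_contra hcon
  push Not at hcon
  nlinarith

/-- The vertices of the subtree of `p` above level `N`. -/
def subtreeBelow (p : DaryVertex d) (N : ℕ) : Set (DaryVertex d) :=
  {v | IsAncestor p v ∧ v.level < N}

/-- The vertices of level `N` in the subtree of `p`. -/
def leaves (p : DaryVertex d) (N : ℕ) : Set (DaryVertex d) := {v | IsAncestor p v ∧ v.level = N}

/-- The paths that exit from the subtree of `p`, cut at level `N`, at a vertex of level `N`. -/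
def exitLeaves (p : DaryVertex d) (N : ℕ) : Set (ℕ → DaryVertex d) :=
  ⋃ z ∈ leaves p N, exitAt (subtreeBelow p N) z

theorem measurableSet_exitLeaves (p : DaryVertex d) (N : ℕ) : MeasurableSet (exitLeaves p N) :=
  MeasurableSet.biUnion (Set.to_countable _) fun _ _ => measurableSet_exitAt _ _

theorem mem_exitAt_of_pathShift {V : Type*} {R : Set V} {z : V} {x : ℕ → V} (h0 : x 0 ∈ R)
    (h : pathShift 1 x ∈ exitAt R z) : x ∈ exitAt R z := by
  obtain ⟨k, hk, hk'⟩ := h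
  refine ⟨1 + k, hk, fun j hj => ?_⟩
  rcases j with _ | j
  · exact h0
  · have := hk' j (by omega)
    rwa [pathShift, add_comm] at this

/-- Gambler's ruin: `a` is superharmonic for the level of the walk, killed when it steps above level
`0`. The increments satisfy `a (k + 1) - a k ≤ a 0 / d ^ (k + 1)`, and summing this geometric series
bounds `a M`. -/
theorem superharmonic_killed {d M : ℕ} (hd : 2 ≤ d) {a : ℕ → ℝ} (h0 : 0 ≤ a 0)
    (hint : ∀ k, k + 1 < M → a k + d * a (k + 2) ≤ (d + 1) * a (k + 1))
    (hbot : 0 < M → d * a 1 ≤ (d + 1) * a 0) : ((d : ℝ) - 1) * a M ≤ d * a 0 := by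
  have hd' : (2 : ℝ) ≤ d := by exact_mod_cast hd
  have hb : ∀ k, k < M → (d : ℝ) ^ (k + 1) * (a (k + 1) - a k) ≤ a 0 := by
    intro k
    induction k with
    | zero => intro hk; have := hbot hk; simp; linarith
    | succ k ih =>
      intro hk
      have h1 := ih (by omega)
      have h2 := hint k (by omega)
      have h3 : (d : ℝ) * (a (k + 2) - a (k + 1)) ≤ a (k + 1) - a k := by linarith
      calc (d : ℝ) ^ (k + 1 + 1) * (a (k + 1 + 1) - a (k + 1))
          = (d : ℝ) ^ (k + 1) * (d * (a (k + 2) - a (k + 1))) := by ring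
        _ ≤ (d : ℝ) ^ (k + 1) * (a (k + 1) - a k) := by gcongr
        _ ≤ a 0 := h1
  -- The partial sum `a k ≤ a 0 * (1 + d⁻¹ + ⋯ + d⁻ᵏ)`, with denominators cleared.
  have hs : ∀ k, k ≤ M → (d : ℝ) ^ k * (((d : ℝ) - 1) * a k) ≤ ((d : ℝ) ^ (k + 1) - 1) * a 0 := by
    intro k
    induction k with
    | zero => intro _; simp
    | succ k ih =>
      intro hk
      have h1 := ih (by omega)
      have h2 := hb k (by omega)
      have h3 : (d : ℝ) ^ (k + 1) * (((d : ℝ) - 1) * a (k + 1)) =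
          ((d : ℝ) - 1) * ((d : ℝ) ^ (k + 1) * (a (k + 1) - a k)) +
            d * ((d : ℝ) ^ k * (((d : ℝ) - 1) * a k)) := by ring
      rw [h3]
      have h4 := mul_le_mul_of_nonneg_left h2 (show (0 : ℝ) ≤ d - 1 by linarith)
      have h5 := mul_le_mul_of_nonneg_left h1 (show (0 : ℝ) ≤ d by linarith)
      calc _ ≤ ((d : ℝ) - 1) * a 0 + d * (((d : ℝ) ^ (k + 1) - 1) * a 0) := add_le_add h4 h5
        _ = _ := by ring
  have h := hs M le_rfl
  have hpos : (0 : ℝ) < (d : ℝ) ^ M := by positivity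
  refine le_of_mul_le_mul_left (h.trans ?_) hpos
  rw [pow_succ]
  nlinarith

/-- At the root the walk is reflected instead of killed: the first increment is nonpositive, hence
so are all the others. -/
theorem superharmonic_reflected {d M : ℕ} (hd : 2 ≤ d) {a : ℕ → ℝ}
    (hint : ∀ k, k + 1 < M → a k + d * a (k + 2) ≤ (d + 1) * a (k + 1))
    (hbot : 0 < M → a 1 ≤ a 0) : a M ≤ a 0 := by
  have hd' : (2 : ℝ) ≤ d := by exact_mod_cast hd
  have hb : ∀ k, k < M → a (k + 1) ≤ a k := by
    intro k
    induction k with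
    | zero => exact hbot
    | succ k ih =>
      intro hk
      have h1 := ih (by omega)
      have h2 := hint k (by omega)
      nlinarith
  have : ∀ k, k ≤ M → a k ≤ a 0 := by
    intro k
    induction k with
    | zero => intro _; exact le_rfl
    | succ k ih => intro hk; exact (hb k (by omega)).trans (ih (by omega))
  exact this M le_rfl

/-- The least probability, over the vertices `k` levels below `p`, of `exitLeaves p N`. -/
noncomputable def minExit (Q : DaryVertex d → Measure (ℕ → DaryVertex d)) (p : DaryVertex d)
    (N k : ℕ) : ℝ :=
  ⨅ x : {x : DaryVertex d // IsAncestor p x ∧ x.level = p.level + k}, (Q x.1).real (exitLeaves p N)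

theorem minExit_le (p : DaryVertex d) (N : ℕ) {k : ℕ} {x : DaryVertex d} (hx : IsAncestor p x)
    (hk : x.level = p.level + k) : minExit Q p N k ≤ (Q x).real (exitLeaves p N) :=
  ciInf_le (f := fun x : {x : DaryVertex d // IsAncestor p x ∧ x.level = p.level + k} =>
    (Q x.1).real (exitLeaves p N))
    ⟨0, by rintro _ ⟨p, rfl⟩; exact measureReal_nonneg⟩ ⟨x, hx, hk⟩

theorem exists_descendant (hd : 2 ≤ d) (p : DaryVertex d) (k : ℕ) :
    ∃ x : DaryVertex d, IsAncestor p x ∧ x.level = p.level + k := by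
  induction k with
  | zero => exact ⟨p, .refl p, rfl⟩
  | succ k ih =>
    obtain ⟨x, h1, h2⟩ := ih
    exact ⟨x.child ⟨0, by omega⟩, h1.trans (isAncestor_child _ _), by rw [level_child, h2]; ring⟩

theorem le_minExit (hd : 2 ≤ d) (p : DaryVertex d) (N k : ℕ) {c : ℝ}
    (h : ∀ x : DaryVertex d, IsAncestor p x → x.level = p.level + k →
      c ≤ (Q x).real (exitLeaves p N)) : c ≤ minExit Q p N k := by
  obtain ⟨x, hx⟩ := exists_descendant hd p k
  have : Nonempty {x : DaryVertex d // IsAncestor p x ∧ x.level = p.level + k} := ⟨⟨x, hx⟩⟩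
  exact le_ciInf fun x => h x.1 x.2.1 x.2.2

theorem exitLeaves_of_pathShift {p x : DaryVertex d} {N : ℕ} (hx : x ∈ subtreeBelow p N)
    {z : ℕ → DaryVertex d} (h0 : z 0 = x) (h : pathShift 1 z ∈ exitLeaves p N) :
    z ∈ exitLeaves p N := by
  simp only [exitLeaves, Set.mem_iUnion] at h ⊢
  obtain ⟨y, hy, h⟩ := h
  exact ⟨y, hy, mem_exitAt_of_pathShift (h0 ▸ hx) h⟩

theorem minExit_interior (hd : 2 ≤ d) (hQ : IsWalkLaw (daryTree d) Q) (p : DaryVertex d)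
    (N k : ℕ) (hk : p.level + (k + 1) < N) :
    minExit Q p N k + d * minExit Q p N (k + 2) ≤ (d + 1) * minExit Q p N (k + 1) := by
  suffices h : (1 / ((d : ℝ) + 1)) * (minExit Q p N k + d * minExit Q p N (k + 2)) ≤
      minExit Q p N (k + 1) by
    rw [one_div, inv_mul_le_iff₀ (by positivity)] at h
    exact h
  refine le_minExit hd p N _ fun x hx hl => ?_
  have hxr : x ≠ root d := by
    rintro rfl
    change 0 = _ at hl
    omega
  have hne : p ≠ x := by
    rintro rfl
    omega
  refine le_trans ?_ (tree_step_le hQ hxr (F := fun _ => exitLeaves p N)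
    (fun _ => measurableSet_exitLeaves p N)
    (fun u z h0 _ h => exitLeaves_of_pathShift ⟨hx, by omega⟩ h0 h))
  have hlp := level_parent hxr
  gcongr
  · exact minExit_le p N (hx.parent_of_ne hne) (by omega)
  · calc (d : ℝ) * minExit Q p N (k + 2) = ∑ a : Fin d, minExit Q p N (k + 2) := by simp
      _ ≤ _ := Finset.sum_le_sum fun a _ =>
        minExit_le p N (hx.trans (isAncestor_child x a)) (by rw [level_child]; omega)

theorem minExit_leaf (hd : 2 ≤ d) (hQ : IsWalkLaw (daryTree d) Q) (p : DaryVertex d)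
    (N k : ℕ) (hk : p.level + k = N) : 1 ≤ minExit Q p N k := by
  have hprob := hQ.prob
  refine le_minExit hd p N _ fun x hx hl => ?_
  have : (Q x).real (exitLeaves p N) = 1 := by
    rw [measureReal_def, (prob_compl_eq_zero_iff (measurableSet_exitLeaves p N)).1,
      ENNReal.toReal_one]
    filter_upwards [hQ.ae_start x] with z hz
    simp only [exitLeaves, Set.mem_iUnion]
    exact ⟨x, ⟨hx, by omega⟩, 0, hz, fun j hj => absurd hj (Nat.not_lt_zero j)⟩
  exact this.ge

/-- The minimum over each level satisfies the killed inequalities, a step to the parent of `p` being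
estimated by `0`, and it is at least `1` at level `N`. -/
theorem le_exitLeaves (hd : 2 ≤ d) (hQ : IsWalkLaw (daryTree d) Q) (p : DaryVertex d)
    (hp : p ≠ root d) (N : ℕ) (hN : p.level ≤ N) :
    1 - 1 / (d : ℝ) ≤ (Q p).real (exitLeaves p N) := by
  have hd' : (2 : ℝ) ≤ d := by exact_mod_cast hd
  have h := superharmonic_killed (M := N - p.level) (a := minExit Q p N) hd
    (le_minExit hd p N _ fun x _ _ => measureReal_nonneg)
    (fun k hk => minExit_interior hd hQ p N k (by omega)) (fun hM => by
      suffices h : (1 / ((d : ℝ) + 1)) * (d * minExit Q p N 1) ≤ minExit Q p N 0 by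
        rw [one_div, inv_mul_le_iff₀ (by positivity)] at h
        exact h
      refine le_minExit hd p N _ fun x hx hl => ?_
      obtain rfl : p = x := hx.eq_of_level hl.symm
      refine le_trans ?_ (tree_step_le hQ hp (F := fun _ => exitLeaves p N)
        (fun _ => measurableSet_exitLeaves p N)
        (fun u z h0 _ h => exitLeaves_of_pathShift ⟨hx, by omega⟩ h0 h))
      gcongr
      refine le_trans ?_ (le_add_of_nonneg_left measureReal_nonneg)
      calc (d : ℝ) * minExit Q p N 1 = ∑ a : Fin d, minExit Q p N 1 := by simp
        _ ≤ _ := Finset.sum_le_sum fun a _ =>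
          minExit_le p N (isAncestor_child p a) (by rw [level_child]))
  have h1 := minExit_leaf hd hQ p N (N - p.level) (by omega)
  have h2 := minExit_le (Q := Q) p N (.refl p) (k := 0) (by omega)
  refine le_trans ?_ h2
  rw [one_sub_div (by positivity), div_le_iff₀ (by positivity)]
  nlinarith

theorem exitLeaves_root (hd : 2 ≤ d) (hQ : IsWalkLaw (daryTree d) Q) (N : ℕ) :
    (Q (root d)).real (exitLeaves (root d) N) = 1 := by
  have hprob := hQ.prob
  have hd' : (2 : ℝ) ≤ d := by exact_mod_cast hd
  have hl0 : (root d).level = 0 := rfl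
  refine le_antisymm measureReal_le_one ?_
  have h := superharmonic_reflected (M := N) (a := minExit Q (root d) N) hd
    (fun k hk => minExit_interior hd hQ _ N k (by omega)) (fun hM => by
      refine le_minExit hd _ N _ fun x hx hl => ?_
      obtain rfl : root d = x := hx.eq_of_level hl.symm
      refine le_trans ?_ (tree_step_root_le hQ (F := fun _ => exitLeaves (root d) N)
        (fun _ => measurableSet_exitLeaves _ N)
        (fun u z h0 _ h => exitLeaves_of_pathShift ⟨hx, by omega⟩ h0 h))
      rw [one_div, le_inv_mul_iff₀ (by positivity)]
      calc (d : ℝ) * minExit Q (root d) N 1 = ∑ a : Fin d, minExit Q (root d) N 1 := by simp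
        _ ≤ _ := Finset.sum_le_sum fun a _ =>
          minExit_le _ N (isAncestor_child _ a) (by rw [level_child]))
  have h1 := minExit_leaf hd hQ (root d) N N (by omega)
  exact h1.trans (h.trans (minExit_le _ N (.refl _) (by omega)))

theorem notMem_subtreeBelow {p z : DaryVertex d} {N : ℕ} (hz : z ∈ leaves p N) :
    z ∉ subtreeBelow p N := fun h => by
  have h1 := h.2
  have h2 := hz.2
  omega

/-- The probability to exit through the leaves below a given child. -/
theorem le_exit_branch (hd : 2 ≤ d) (hQ : IsWalkLaw (daryTree d) Q) (p : DaryVertex d)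
    (hp : p ≠ root d) (N : ℕ) (hN : p.level < N) (a : Fin d) :
    ((d : ℝ) - 1) / (d * (d + 1)) ≤
      (Q p).real (⋃ z ∈ leaves (p.child a) N, exitAt (subtreeBelow p N) z) := by
  have hprob := hQ.prob
  have hd' : (2 : ℝ) ≤ d := by exact_mod_cast hd
  have hs := tree_step_le hQ hp (F := fun u => if u = p.child a then exitLeaves u N else ∅)
    (E := ⋃ z ∈ leaves (p.child a) N, exitAt (subtreeBelow p N) z)
    (fun u => by split_ifs; exacts [measurableSet_exitLeaves _ _, MeasurableSet.empty])
    (fun u z h0 h1 hz => by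
      by_cases hu : u = p.child a
      · simp only [hu, if_true, exitLeaves, Set.mem_iUnion] at hz ⊢
        obtain ⟨y, hy, k, hk, hk'⟩ := hz
        refine ⟨y, hy, mem_exitAt_of_pathShift
          (by rw [h0]; exact ⟨.refl p, hN⟩) ⟨k, hk, fun j hj => ?_⟩⟩
        exact ⟨(isAncestor_child p a).trans (hk' j hj).1, (hk' j hj).2⟩
      · simp [hu] at hz)
  refine le_trans ?_ hs
  have h1 := le_exitLeaves hd hQ (p.child a) (child_ne_root p a) N (by rw [level_child]; omega)
  calc ((d : ℝ) - 1) / (d * (d + 1)) = 1 / ((d : ℝ) + 1) * (1 - 1 / d) := by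
        field_simp
    _ ≤ _ := by
      gcongr
      refine h1.trans (le_trans ?_ (le_add_of_nonneg_left measureReal_nonneg))
      refine le_trans ?_ (Finset.single_le_sum (fun _ _ => measureReal_nonneg) (Finset.mem_univ a))
      simp

/-- A walk from `p` exits through a set of leaves, or visits the parent of `p` and then follows a
path of `C`. -/
theorem le_exit_or_visitThen (hd : 2 ≤ d) (hQ : IsWalkLaw (daryTree d) Q) (p : DaryVertex d)
    (hp : p ≠ root d) (N : ℕ) (B : Set (DaryVertex d))
    {C : Set (ℕ → DaryVertex d)} (hC : MeasurableSet C) {σ : ℝ} (hσ : 0 ≤ σ)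
    (hσ' : σ ≤ (Q p.parent).real C) :
    (1 - σ) * (Q p).real (⋃ z ∈ B, exitAt (subtreeBelow p N) z) + σ / d ≤
      (Q p).real ((⋃ z ∈ B, exitAt (subtreeBelow p N) z) ∪ visitThen p.parent C) := by
  have hprob := hQ.prob
  set E := ⋃ z ∈ B, exitAt (subtreeBelow p N) z with hE
  have hEm : MeasurableSet E :=
    MeasurableSet.biUnion (Set.to_countable _) fun _ _ => measurableSet_exitAt _ _
  set f := (Q p).real E with hf
  have hparent : p.parent ∉ subtreeBelow p N := by
    intro h
    have h1 := h.1.level_le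
    have h2 := level_parent hp
    omega
  -- The parent lies outside the region, so an exit through `B` that has not happened by the first
  -- visit to the parent can no longer happen.
  have hdet : ∀ t, DeterminedBy t (firstVisit p.parent t \ E) := by
    rintro t x x' h ⟨h1, h2⟩
    refine ⟨determinedBy_firstVisit _ t h h1, fun h3 => h2 ?_⟩
    simp only [hE, Set.mem_iUnion] at h3 ⊢
    obtain ⟨z, hz, k, hk, hk'⟩ := h3
    have hkt : k ≤ t := by
      by_contra hlt
      have := hk' t (by omega)
      rw [← h t le_rfl, h1.1] at this
      exact hparent this
    refine ⟨z, hz, k, (h k hkt).trans hk, fun j hj => ?_⟩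
    rw [h j (by omega)]
    exact hk' j hj
  have hm := hQ.markov_iUnion p p.parent hdet (fun t z hz => hz.1.1)
    (fun s t hst => (pairwise_disjoint_firstVisit p.parent hst).mono Set.sdiff_subset
      Set.sdiff_subset) hC
  have hU : ⋃ t, firstVisit p.parent t \ E = {x | ∃ k, x k = p.parent} \ E := by
    rw [← iUnion_firstVisit, Set.iUnion_sdiff]
  rw [hU] at hm
  have hm' : (Q p).real (⋃ t, firstVisit p.parent t \ E ∩ pathShift t ⁻¹' C) =
      (Q p).real ({x | ∃ k, x k = p.parent} \ E) * (Q p.parent).real C := by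
    rw [measureReal_def, hm, ENNReal.toReal_mul]
    rfl
  have hdisj : Disjoint E (⋃ t, firstVisit p.parent t \ E ∩ pathShift t ⁻¹' C) := by
    refine Set.disjoint_left.2 fun x hx hx' => ?_
    simp only [Set.mem_iUnion] at hx'
    obtain ⟨t, ht, _⟩ := hx'
    exact ht.2 hx
  have hle : f + (Q p).real ({x | ∃ k, x k = p.parent} \ E) * (Q p.parent).real C ≤
      (Q p).real (E ∪ visitThen p.parent C) := by
    rw [← hm', hf, ← measureReal_union hdisj _ (measure_ne_top _ _) (measure_ne_top _ _)]
    · refine measureReal_mono (Set.union_subset_union_right _ ?_)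
      simp only [Set.iUnion_subset_iff]
      rintro t x ⟨h1, h2⟩
      exact ⟨t, h1.1.1, h2⟩
    · exact MeasurableSet.iUnion fun t => (hdet t).measurableSet.inter (measurable_pathShift t hC)
  have hv : 1 / (d : ℝ) - f ≤ (Q p).real ({x | ∃ k, x k = p.parent} \ E) := by
    have h1 := one_div_le_visit_parent hd hQ p hp
    have h2 := le_measureReal_sdiff (μ := Q p) (s₁ := {x | ∃ k, x k = p.parent}) (s₂ := E)
      (h := measure_ne_top _ _)
    linarith
  refine le_trans ?_ hle
  have hw : 0 ≤ (Q p).real ({x | ∃ k, x k = p.parent} \ E) := measureReal_nonneg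
  have : σ / d = σ * (1 / d) := by ring
  rw [this]
  -- The bound is `f + σ * (1 / d - f)`: at worst, every path counted in `f` also visits the parent
  -- and is lost from the second term.
  nlinarith [mul_le_mul_of_nonneg_left hv hσ, mul_le_mul_of_nonneg_left hσ' hw]

end TreeWalk

/-! ### Replacing dependent blocks by independent inclusions -/

section Replacement

open Classical

/-- Replacing the factors of a product weight one at a time. -/
theorem sum_prod_mul_le_of_update {ι Y : Type*} [Fintype ι] [Fintype Y] {w w' : ι → Y → ℝ}
    (hw : ∀ i y, 0 ≤ w i y) (hw' : ∀ i y, 0 ≤ w' i y) (F : (ι → Y) → ℝ)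
    (h : ∀ i Φ, ∑ y, w i y * F (Function.update Φ i y) ≤ ∑ y, w' i y * F (Function.update Φ i y)) :
    ∑ Φ, (∏ i, w i (Φ i)) * F Φ ≤ ∑ Φ, (∏ i, w' i (Φ i)) * F Φ := by
  -- Fubini: the coordinate `i` is summed last, with the other coordinates `g` frozen.
  have split : ∀ (W : ι → Y → ℝ) (i : ι), ∑ Φ, (∏ j, W j (Φ j)) * F Φ =
      ∑ g : {j // j ≠ i} → Y, (∏ j : {j // j ≠ i}, W j (g j)) *
        ∑ y, W i y * F ((Equiv.funSplitAt i Y).symm (y, g)) := by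
    intro W i
    rw [← (Equiv.funSplitAt i Y).symm.sum_comp, Fintype.sum_prod_type, Finset.sum_comm]
    refine Finset.sum_congr rfl fun g _ => ?_
    rw [Finset.mul_sum]
    refine Finset.sum_congr rfl fun y _ => ?_
    have h1 : ∏ j, W j ((Equiv.funSplitAt i Y).symm (y, g) j) =
        W i y * ∏ j : {j // j ≠ i}, W j (g j) := by
      rw [← Fintype.prod_subtype_mul_prod_subtype (fun j => j = i)]
      congr 1
      · refine (Finset.prod_eq_single ⟨i, rfl⟩ (fun x _ hx => absurd (Subtype.ext ?_) hx)
          (fun h => absurd (@Finset.mem_univ _ (_) _) h)).trans ?_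
        · exact x.2
        simp [Equiv.funSplitAt, Equiv.piSplitAt]
      · refine Finset.prod_congr rfl fun j _ => ?_
        simp [Equiv.funSplitAt, Equiv.piSplitAt, j.2]
    rw [h1]
    ring
  -- Hybrid weights: the factors in `s` have already been replaced.
  have key : ∀ s : Finset ι, ∑ Φ, (∏ i, w i (Φ i)) * F Φ ≤
      ∑ Φ, (∏ i, (if i ∈ s then w' i else w i) (Φ i)) * F Φ := by
    intro s
    induction s using Finset.induction_on with
    | empty => simp
    | insert i s his ih =>
      refine ih.trans ?_
      rw [split _ i, split (fun j => if j ∈ insert i s then w' j else w j) i]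
      refine Finset.sum_le_sum fun g _ => ?_
      have e : ∀ j : {j // j ≠ i}, (if (j : ι) ∈ insert i s then w' j else w j) =
          if (j : ι) ∈ s then w' j else w j := fun j => by
        simp only [Finset.mem_insert, or_iff_right j.2]
      simp only [e]
      refine mul_le_mul_of_nonneg_left ?_ (Finset.prod_nonneg fun j _ => ?_)
      · simp only [his, if_false, Finset.mem_insert_self, if_true]
        rcases isEmpty_or_nonempty Y with hY | ⟨⟨y0⟩⟩
        · simp
        · have e2 : ∀ y, (Equiv.funSplitAt i Y).symm (y, g) =
              Function.update ((Equiv.funSplitAt i Y).symm (y0, g)) i y := by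
            intro y
            funext j
            by_cases hj : j = i
            · subst hj; simp [Equiv.funSplitAt, Equiv.piSplitAt]
            · simp [Equiv.funSplitAt, Equiv.piSplitAt, hj]
          have e3 : ∀ W : Y → ℝ, ∑ y, W y * F ((Equiv.funSplitAt i Y).symm (y, g)) =
              ∑ y, W y * F (Function.update ((Equiv.funSplitAt i Y).symm (y0, g)) i y) :=
            fun W => Finset.sum_congr rfl fun y _ => by rw [e2 y]
          rw [e3 (w i), e3 (w' i)]
          exact h i _
      · split_ifs
        exacts [hw' _ _, hw _ _]
  have := key Finset.univ
  simpa using this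

variable {ι X : Type*} [Fintype ι] [Fintype X]

/-- `A` contains the starting nodes and all the nodes to which its nodes lead. -/
def IsClosedUnder (S0 : Finset X) (D : X → Finset X) (A : Finset X) : Prop :=
  S0 ⊆ A ∧ ∀ x ∈ A, D x ⊆ A

/-- The mark is not reached: each node `x` leads to the nodes of `(D x).1`, and to the mark if
`(D x).2 = true`. -/
def MarkUnreached (S0 : Finset X) (D : X → Finset X × Bool) : Prop :=
  ∃ A : Finset X, S0 ⊆ A ∧ ∀ x ∈ A, (D x).1 ⊆ A ∧ (D x).2 = false

/-- The set of nodes that are reached. -/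
noncomputable def reached (S0 : Finset X) (D : X → Finset X) : Finset X :=
  Finset.univ.filter fun x => ∀ A, IsClosedUnder S0 D A → x ∈ A

theorem isClosedUnder_reached (S0 : Finset X) (D : X → Finset X) :
    IsClosedUnder S0 D (reached S0 D) := by
  refine ⟨fun x hx => ?_, fun x hx y hy => ?_⟩
  · simp only [reached, Finset.mem_filter, Finset.mem_univ, true_and]
    exact fun A hA => hA.1 hx
  · simp only [reached, Finset.mem_filter, Finset.mem_univ, true_and] at hx ⊢
    exact fun A hA => hA.2 x (hx A hA) hy

theorem reached_subset {S0 : Finset X} {D : X → Finset X} {A : Finset X}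
    (h : IsClosedUnder S0 D A) : reached S0 D ⊆ A := fun x hx => by
  simp only [reached, Finset.mem_filter, Finset.mem_univ, true_and] at hx
  exact hx A h

theorem markUnreached_iff (S0 : Finset X) (D : X → Finset X × Bool) :
    MarkUnreached S0 D ↔ ∀ x ∈ reached S0 (fun x => (D x).1), (D x).2 = false := by
  constructor
  · rintro ⟨A, h1, h2⟩ x hx
    exact (h2 x (reached_subset ⟨h1, fun x hx => (h2 x hx).1⟩ hx)).2
  · intro h
    have hc := isClosedUnder_reached S0 fun x => (D x).1
    exact ⟨_, hc.1, fun x hx => ⟨hc.2 x hx, h x hx⟩⟩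

/-- The effect on `MarkUnreached` of replacing the outputs of one block of nodes by a common
output with larger avoidance probabilities. -/
theorem sum_markUnreached_update_le (S0 : Finset X) (π : X → ι) (i : ι)
    {w : (X → Finset X × Bool) → ℝ} {v : Finset X × Bool → ℝ}
    (hw : ∀ y, 0 ≤ w y) (hv : ∀ e, 0 ≤ v e) (hw1 : ∑ y, w y ≤ 1) (hv1 : ∑ e, v e = 1)
    (h : ∀ x, π x = i → ∀ K : Finset X,
      ∑ y with Disjoint (y x).1 K ∧ (y x).2 = false, w y ≤
        ∑ e with Disjoint e.1 K ∧ e.2 = false, v e)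
    (Φ : ι → X → Finset X × Bool) :
    ∑ y, w y * (if MarkUnreached S0 (fun x => Function.update Φ i y (π x) x) then 1 else 0) ≤
      ∑ e, v e * (if MarkUnreached S0
        (fun x => Function.update Φ i (fun _ => e) (π x) x) then 1 else 0) := by
  -- sets closed under the outputs of the other blocks
  let good : Finset X → Prop := fun A =>
    ∀ x ∈ A, π x ≠ i → (Φ (π x) x).1 ⊆ A ∧ (Φ (π x) x).2 = false
  have hgood : ∀ (y : X → Finset X × Bool) (A : Finset X),
      (∀ x ∈ A, (Function.update Φ i y (π x) x).1 ⊆ A ∧ (Function.update Φ i y (π x) x).2 = false) →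
      good A := fun y A hA x hx hxi => by
    have := hA x hx
    rwa [Function.update_of_ne hxi] at this
  let G : Finset X := Finset.univ.filter fun x => ∃ A, good A ∧ x ∈ A
  have hG : good G := by
    intro x hx hxi
    simp only [G, Finset.mem_filter, Finset.mem_univ, true_and] at hx
    obtain ⟨A, hA, hxA⟩ := hx
    refine ⟨fun z hz => ?_, (hA x hxA hxi).2⟩
    simp only [G, Finset.mem_filter, Finset.mem_univ, true_and]
    exact ⟨A, hA, (hA x hxA hxi).1 hz⟩
  have hGmax : ∀ A, good A → A ⊆ G := fun A hA x hx => by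
    simp only [G, Finset.mem_filter, Finset.mem_univ, true_and]
    exact ⟨A, hA, hx⟩
  -- The other blocks already confine the process to a set that never meets block `i`, so the output
  -- of this block is irrelevant.
  by_cases h1 : ∃ A, good A ∧ S0 ⊆ A ∧ ∀ x ∈ A, π x ≠ i
  · obtain ⟨A, hA, hS, hAi⟩ := h1
    have : ∀ y, MarkUnreached S0 (fun x => Function.update Φ i y (π x) x) := fun y =>
      ⟨A, hS, fun x hx => by
        beta_reduce
        rw [Function.update_of_ne (hAi x hx)]
        exact hA x hx (hAi x hx)⟩
    simp only [this, if_true, mul_one, hv1]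
    exact hw1
  by_cases h2 : S0 ⊆ G
  · -- a node of the block that is reached without the help of the block
    let A0 : Finset X := Finset.univ.filter fun x => ∀ A, good A → S0 ⊆ A → x ∈ A
    have hA0 : good A0 := by
      intro x hx hxi
      simp only [A0, Finset.mem_filter, Finset.mem_univ, true_and] at hx
      refine ⟨fun z hz => ?_, (hG x (hx G hG h2) hxi).2⟩
      simp only [A0, Finset.mem_filter, Finset.mem_univ, true_and]
      exact fun A hA hS => (hA x (hx A hA hS) hxi).1 hz
    have hS0 : S0 ⊆ A0 := fun x hx => by
      simp only [A0, Finset.mem_filter, Finset.mem_univ, true_and]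
      exact fun A _ hS => hS hx
    have : ∃ x ∈ A0, π x = i := by
      by_contra hcon
      push Not at hcon
      exact h1 ⟨A0, hA0, hS0, hcon⟩
    obtain ⟨x0, hx0, hx0i⟩ := this
    -- Every set witnessing that the mark is not reached contains `A0`, hence `x0`, and is contained
    -- in `G`. So the output of the single node `x0` must stay inside `G`; this is why no
    -- information on the joint law inside the block is needed.
    calc _ ≤ ∑ y, if Disjoint (y x0).1 Gᶜ ∧ (y x0).2 = false then w y else 0 := by
          refine Finset.sum_le_sum fun y _ => ?_
          by_cases hy : MarkUnreached S0 (fun x => Function.update Φ i y (π x) x)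
          · rw [if_pos hy, mul_one, if_pos]
            obtain ⟨A, hS, hA⟩ := hy
            have hAg := hgood y A hA
            have hx0A : x0 ∈ A := by
              simp only [A0, Finset.mem_filter, Finset.mem_univ, true_and] at hx0
              exact hx0 A hAg hS
            have h3 := hA x0 hx0A
            beta_reduce at h3
            rw [hx0i, Function.update_self] at h3
            exact ⟨disjoint_compl_right_iff.2 (h3.1.trans (hGmax A hAg)), h3.2⟩
          · rw [if_neg hy, mul_zero]
            split_ifs
            exacts [hw y, le_rfl]
      _ ≤ ∑ e, if Disjoint e.1 Gᶜ ∧ e.2 = false then v e else 0 := by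
          rw [← Finset.sum_filter, ← Finset.sum_filter]
          exact h x0 hx0i _
      -- For a common output the necessary condition is also sufficient: if it stays in `G` without
      -- the mark, then `G` itself is a witness.
      _ ≤ _ := by
          refine Finset.sum_le_sum fun e _ => ?_
          split_ifs with h3 h4
          · simp
          · refine absurd ⟨G, h2, fun x hx => ?_⟩ h4
            beta_reduce
            by_cases hxi : π x = i
            · rw [hxi, Function.update_self]
              exact ⟨disjoint_compl_right_iff.1 h3.1, h3.2⟩
            · rw [Function.update_of_ne hxi]
              exact hG x hx hxi
          · simpa using hv e
          · simp
  -- Here no good set contains `S0`: whatever block `i` does, the mark is reached.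
  · have : ∀ y, ¬ MarkUnreached S0 (fun x => Function.update Φ i y (π x) x) := fun y => by
      rintro ⟨A, hS, hA⟩
      exact h2 (hS.trans (hGmax A (hgood y A hA)))
    simp only [this, if_false, mul_zero, Finset.sum_const_zero, le_refl]

theorem sum_markUnreached_le (S0 : Finset X) (π : X → ι)
    {w : ι → (X → Finset X × Bool) → ℝ} {v : ι → Finset X × Bool → ℝ}
    (hw : ∀ i y, 0 ≤ w i y) (hv : ∀ i e, 0 ≤ v i e) (hw1 : ∀ i, ∑ y, w i y ≤ 1)
    (hv1 : ∀ i, ∑ e, v i e = 1)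
    (h : ∀ x, ∀ K : Finset X,
      ∑ y with Disjoint (y x).1 K ∧ (y x).2 = false, w (π x) y ≤
        ∑ e with Disjoint e.1 K ∧ e.2 = false, v (π x) e) :
    ∑ Φ : ι → X → Finset X × Bool, (∏ i, w i (Φ i)) *
        (if MarkUnreached S0 (fun x => Φ (π x) x) then 1 else 0) ≤
      ∑ E : ι → Finset X × Bool, (∏ i, v i (E i)) *
        (if MarkUnreached S0 (fun x => E (π x)) then 1 else 0) := by
  -- The law `v i` transported to constant families, so that old and new weights live on the same
  -- space and can be exchanged block by block.
  let w' : ι → (X → Finset X × Bool) → ℝ := fun i y => ∑ e, if y = (fun _ => e) then v i e else 0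
  have hw' : ∀ i (F : (X → Finset X × Bool) → ℝ), ∑ y, w' i y * F y = ∑ e, v i e * F fun _ => e := by
    intro i F
    simp only [w', Finset.sum_mul]
    rw [Finset.sum_comm]
    refine Finset.sum_congr rfl fun e _ => ?_
    simp [ite_mul]
  refine (sum_prod_mul_le_of_update (w' := w') hw (fun i y => Finset.sum_nonneg fun e _ => by
    split_ifs; exacts [hv i e, le_rfl]) _ fun i Φ => ?_).trans (le_of_eq ?_)
  · rw [hw' i fun y => if MarkUnreached S0 (fun x => Function.update Φ i y (π x) x) then 1 else 0]
    exact sum_markUnreached_update_le S0 π i (hw i) (hv i) (hw1 i) (hv1 i)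
      (fun x hx K => by rw [← hx]; exact h x K) Φ
  · calc _ = ∑ Φ : ι → X → Finset X × Bool, ∑ E : ι → Finset X × Bool,
          (∏ i, if Φ i = (fun _ => E i) then v i (E i) else 0) *
            (if MarkUnreached S0 (fun x => Φ (π x) x) then 1 else 0) := by
          refine Finset.sum_congr rfl fun Φ _ => ?_
          simp only [w']
          rw [Finset.prod_univ_sum, Fintype.piFinset_univ, Finset.sum_mul]
      _ = _ := by
          rw [Finset.sum_comm]
          refine Finset.sum_congr rfl fun E _ => ?_
          rw [Finset.sum_eq_single (fun i _ => E i)]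
          · simp
          · intro Φ _ hΦ
            have : ∃ i, Φ i ≠ fun _ => E i := by
              by_contra hcon
              push Not at hcon
              exact hΦ (funext hcon)
            obtain ⟨i, hi⟩ := this
            rw [Finset.prod_eq_zero (Finset.mem_univ i) (if_neg hi), zero_mul]
          · simp

/-- The weight of `e` for independent inclusions of the `x` with probability `1 - exp (-c x)`. -/
noncomputable def bernWeight (c : X → ℝ) (e : Finset X) : ℝ :=
  (∏ x ∈ e, (1 - Real.exp (-c x))) * ∏ x ∈ Finset.univ \ e, Real.exp (-c x)

theorem bernWeight_nonneg {c : X → ℝ} (hc : ∀ x, 0 ≤ c x) (e : Finset X) : 0 ≤ bernWeight c e :=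
  mul_nonneg (Finset.prod_nonneg fun x _ => by
    have := Real.exp_le_one_iff.2 (neg_nonpos.2 (hc x)); linarith)
    (Finset.prod_nonneg fun _ _ => (Real.exp_pos _).le)

theorem sum_bernWeight_disjoint (c : X → ℝ) (K : Finset X) :
    ∑ e with Disjoint e K, bernWeight c e = Real.exp (-∑ x ∈ K, c x) := by
  have h := Finset.prod_add (fun x => if x ∈ K then 0 else 1 - Real.exp (-c x))
    (fun x => Real.exp (-c x)) (Finset.univ : Finset X)
  have h1 : ∏ x : X, ((if x ∈ K then 0 else 1 - Real.exp (-c x)) + Real.exp (-c x)) =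
      Real.exp (-∑ x ∈ K, c x) := by
    rw [← Finset.sum_neg_distrib, Real.exp_sum, ← Finset.prod_subset (Finset.subset_univ K)]
    · exact Finset.prod_congr rfl fun x hx => by simp [hx]
    · intro x _ hx
      simp [hx]
  rw [← h1, h, Finset.sum_filter, Finset.powerset_univ]
  refine Finset.sum_congr rfl fun e _ => ?_
  by_cases he : Disjoint e K
  · rw [if_pos he, bernWeight]
    congr 1
    exact Finset.prod_congr rfl fun x hx => by simp [Finset.disjoint_left.1 he hx]
  · rw [if_neg he]
    obtain ⟨x, hx, hxK⟩ := Finset.not_disjoint_iff.1 he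
    rw [Finset.prod_eq_zero hx (by simp [hxK]), zero_mul]

theorem sum_bernWeight (c : X → ℝ) : ∑ e, bernWeight c e = 1 := by
  have := sum_bernWeight_disjoint c ∅
  simpa using this

/-- The weight of a random output: independent inclusions, and an independent mark. -/
noncomputable def markedWeight (c : X → ℝ) (m : ℝ) (e : Finset X × Bool) : ℝ :=
  bernWeight c e.1 * if e.2 then 1 - Real.exp (-m) else Real.exp (-m)

theorem markedWeight_nonneg {c : X → ℝ} (hc : ∀ x, 0 ≤ c x) {m : ℝ} (hm : 0 ≤ m)
    (e : Finset X × Bool) : 0 ≤ markedWeight c m e := by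
  refine mul_nonneg (bernWeight_nonneg hc _) ?_
  split_ifs
  · have := Real.exp_le_one_iff.2 (neg_nonpos.2 hm); linarith
  · exact (Real.exp_pos _).le

theorem sum_markedWeight (c : X → ℝ) (m : ℝ) : ∑ e, markedWeight c m e = 1 := by
  simp only [markedWeight, Fintype.sum_prod_type, ← Finset.mul_sum]
  simp [sum_bernWeight]

theorem sum_markedWeight_avoid (c : X → ℝ) (m : ℝ) (K : Finset X) :
    ∑ e with Disjoint e.1 K ∧ e.2 = false, markedWeight c m e =
      Real.exp (-(m + ∑ x ∈ K, c x)) := by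
  rw [Finset.sum_filter, Fintype.sum_prod_type, neg_add, Real.exp_add,
    ← sum_bernWeight_disjoint, Finset.sum_filter, Finset.mul_sum]
  refine Finset.sum_congr rfl fun e _ => ?_
  by_cases he : Disjoint e K <;> simp [he, markedWeight, mul_comm]

/-- Averaging out the marks. -/
theorem sum_markedWeight_markUnreached (S0 : Finset X) (π : X → ι) (c : ι → X → ℝ) (m : ι → ℝ) :
    ∑ E : ι → Finset X × Bool, (∏ i, markedWeight (c i) (m i) (E i)) *
        (if MarkUnreached S0 (fun x => E (π x)) then 1 else 0) =
      ∑ E : ι → Finset X, (∏ i, bernWeight (c i) (E i)) *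
        Real.exp (-∑ i ∈ (reached S0 fun x => E (π x)).image π, m i) := by
  rw [← (Equiv.arrowProdEquivProdArrow ι (fun _ => Finset X) (fun _ => Bool)).symm.sum_comp,
    Fintype.sum_prod_type]
  refine Finset.sum_congr rfl fun E _ => ?_
  set R := (reached S0 fun x => E (π x)).image π with hR
  have h1 : ∀ b : ι → Bool, (if MarkUnreached S0 (fun x =>
      (Equiv.arrowProdEquivProdArrow ι (fun _ => Finset X) (fun _ => Bool)).symm (E, b) (π x))
      then (1 : ℝ) else 0) = ∏ i, if i ∈ R → b i = false then 1 else 0 := by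
    intro b
    rw [Finset.prod_ite_zero]
    simp only [Finset.prod_const_one, Finset.mem_univ, true_implies]
    congr 1
    rw [markUnreached_iff]
    simp [hR, Equiv.arrowProdEquivProdArrow]
  simp only [h1]
  have h2 : ∀ b : ι → Bool, (∏ i, markedWeight (c i) (m i)
      ((Equiv.arrowProdEquivProdArrow ι (fun _ => Finset X) (fun _ => Bool)).symm (E, b) i)) *
        (∏ i, if i ∈ R → b i = false then (1 : ℝ) else 0) =
      (∏ i, bernWeight (c i) (E i)) * ∏ i, (if b i then 1 - Real.exp (-m i) else
        Real.exp (-m i)) * (if i ∈ R → b i = false then 1 else 0) := by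
    intro b
    rw [← Finset.prod_mul_distrib, ← Finset.prod_mul_distrib]
    refine Finset.prod_congr rfl fun i _ => ?_
    simp only [markedWeight, Equiv.arrowProdEquivProdArrow, Equiv.coe_fn_symm_mk]
    by_cases hb : b i = true <;> by_cases hr : i ∈ R → b i = false <;>
      simp only [hb, if_pos] <;> ring
  simp only [h2]
  rw [← Finset.mul_sum]
  congr 1
  have h3 := Finset.prod_univ_sum (fun _ : ι => (Finset.univ : Finset Bool))
    (fun i b => (if b then 1 - Real.exp (-m i) else Real.exp (-m i)) *
      (if i ∈ R → b = false then (1 : ℝ) else 0))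
  rw [Fintype.piFinset_univ] at h3
  rw [← h3, ← Finset.sum_neg_distrib, Real.exp_sum, ← Finset.prod_subset (Finset.subset_univ R)]
  · exact Finset.prod_congr rfl fun i hi => by simp [hi]
  · intro i _ hi
    simp [hi]

theorem sum_bernWeight_pi (c : ι → X → ℝ) :
    ∑ E : ι → Finset X, ∏ i, bernWeight (c i) (E i) = 1 := by
  have h3 := Finset.prod_univ_sum (fun _ : ι => (Finset.univ : Finset (Finset X)))
    (fun i e => bernWeight (c i) e)
  rw [Fintype.piFinset_univ] at h3
  rw [← h3]
  simp [sum_bernWeight]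

/-- The union bound over the set `R` of blocks that are reached. -/
theorem sum_bernWeight_reached_le (S0 : Finset X) (π : X → ι) {c : ι → X → ℝ}
    (hc : ∀ i x, 0 ≤ c i x) (m : ι → ℝ) :
    ∑ E : ι → Finset X, (∏ i, bernWeight (c i) (E i)) *
        Real.exp (-∑ i ∈ (reached S0 fun x => E (π x)).image π, m i) ≤
      ∑ R : Finset ι with S0.image π ⊆ R,
        Real.exp (-∑ i ∈ R, (m i + ∑ x with π x ∉ R, c i x)) := by
  have hnn : ∀ E : ι → Finset X, 0 ≤ ∏ i, bernWeight (c i) (E i) := fun E =>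
    Finset.prod_nonneg fun i _ => bernWeight_nonneg (hc i) _
  calc _ ≤ ∑ E : ι → Finset X, ∑ R : Finset ι with S0.image π ⊆ R,
        (∏ i, bernWeight (c i) (E i)) * (if ∀ i ∈ R, Disjoint (E i) (Finset.univ.filter
          fun x => π x ∉ R) then Real.exp (-∑ i ∈ R, m i) else 0) := by
        refine Finset.sum_le_sum fun E _ => ?_
        have hcl := isClosedUnder_reached S0 fun x => E (π x)
        set A := reached S0 fun x => E (π x)
        have hmem : A.image π ∈ Finset.univ.filter fun R : Finset ι => S0.image π ⊆ R := by
          simp only [Finset.mem_filter, Finset.mem_univ, true_and]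
          exact Finset.image_subset_image hcl.1
        -- The term for the actual set of reached blocks: no reached block can lead outside it.
        refine le_trans (le_of_eq ?_) (Finset.single_le_sum (fun R _ => mul_nonneg (hnn E) ?_) hmem)
        · rw [if_pos]
          intro i hi
          obtain ⟨x, hx, rfl⟩ := Finset.mem_image.1 hi
          refine Finset.disjoint_left.2 fun z hz hz' => ?_
          simp only [Finset.mem_filter, Finset.mem_univ, true_and] at hz'
          exact hz' (Finset.mem_image_of_mem π (hcl.2 x hx hz))
        · split_ifs
          exacts [(Real.exp_pos _).le, le_rfl]
    _ = _ := by
        rw [Finset.sum_comm]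
        refine Finset.sum_congr rfl fun R _ => ?_
        have h1 : ∀ E : ι → Finset X, (∏ i, bernWeight (c i) (E i)) *
            (if ∀ i ∈ R, Disjoint (E i) (Finset.univ.filter fun x => π x ∉ R) then
              Real.exp (-∑ i ∈ R, m i) else 0) =
            Real.exp (-∑ i ∈ R, m i) * ∏ i, bernWeight (c i) (E i) *
              (if i ∈ R → Disjoint (E i) (Finset.univ.filter fun x => π x ∉ R) then 1 else 0) := by
          intro E
          rw [Finset.prod_mul_distrib, Finset.prod_ite_zero]
          simp only [Finset.prod_const_one, Finset.mem_univ, true_implies]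
          split_ifs <;> ring
        simp only [h1]
        rw [← Finset.mul_sum]
        have h3 := Finset.prod_univ_sum (fun _ : ι => (Finset.univ : Finset (Finset X)))
          (fun i e => bernWeight (c i) e *
            (if i ∈ R → Disjoint e (Finset.univ.filter fun x => π x ∉ R) then (1 : ℝ) else 0))
        rw [Fintype.piFinset_univ] at h3
        rw [← h3, Finset.sum_add_distrib, neg_add, Real.exp_add]
        congr 1
        rw [← Finset.sum_neg_distrib, Real.exp_sum, ← Finset.prod_subset (Finset.subset_univ R)]
        · refine Finset.prod_congr rfl fun i hi => ?_
          rw [← sum_bernWeight_disjoint, Finset.sum_filter]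
          exact Finset.sum_congr rfl fun e _ => by simp [hi]
        · intro i _ hi
          simp [hi, sum_bernWeight]

/-- The probability that the mark is not reached, for independent blocks. -/
theorem sum_markUnreached_le_rpow (S0 : Finset X) (π : X → ι)
    {w : ι → (X → Finset X × Bool) → ℝ} (hw : ∀ i y, 0 ≤ w i y) (hw1 : ∀ i, ∑ y, w i y ≤ 1)
    {c : ι → X → ℝ} (hc : ∀ i x, 0 ≤ c i x) {r : ι → ℝ} (hr : ∀ i, 0 ≤ r i)
    {σ s : ℝ} (hσ : 0 ≤ σ) (hs : 0 < s) (hσs : σ ≤ s)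
    (h : ∀ x, ∀ K : Finset X, ∑ y with Disjoint (y x).1 K ∧ (y x).2 = false, w (π x) y ≤
      Real.exp (-(σ * r (π x) + ∑ z ∈ K, c (π x) z))) :
    ∑ Φ : ι → X → Finset X × Bool, (∏ i, w i (Φ i)) *
        (if MarkUnreached S0 (fun x => Φ (π x) x) then 1 else 0) ≤
      (∑ R : Finset ι with S0.image π ⊆ R,
        Real.exp (-∑ i ∈ R, (s * r i + ∑ x with π x ∉ R, c i x))) ^ (σ / s) := by
  refine (sum_markUnreached_le S0 π (v := fun i => markedWeight (c i) (σ * r i)) hw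
    (fun i e => markedWeight_nonneg (hc i) (mul_nonneg hσ (hr i)) e) hw1
    (fun i => sum_markedWeight _ _)
    (fun x K => by rw [sum_markedWeight_avoid]; exact h x K)).trans ?_
  rw [sum_markedWeight_markUnreached]
  have hnn : ∀ E : ι → Finset X, 0 ≤ ∏ i, bernWeight (c i) (E i) := fun E =>
    Finset.prod_nonneg fun i _ => bernWeight_nonneg (hc i) _
  have hle := sum_bernWeight_reached_le S0 π hc fun i => s * r i
  have hθ : 0 ≤ σ / s := div_nonneg hσ hs.le
  refine le_trans ?_ (Real.rpow_le_rpow (Finset.sum_nonneg fun E _ =>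
    mul_nonneg (hnn E) (Real.exp_pos _).le) hle hθ)
  -- Jensen for `t ↦ t ^ (σ / s)`: marks of strength `σ ≤ s` are compared with marks of strength
  -- `s`, and only the latter go through the union bound.
  have hj := (Real.concaveOn_rpow hθ (div_le_one_of_le₀ hσs hs.le)).le_map_sum
    (t := (Finset.univ : Finset (ι → Finset X)))
    (w := fun E => ∏ i, bernWeight (c i) (E i))
    (p := fun E => Real.exp (-∑ i ∈ (reached S0 fun x => E (π x)).image π, s * r i))
    (fun E _ => hnn E) (sum_bernWeight_pi c) (fun E _ => (Real.exp_pos _).le)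
  simp only [smul_eq_mul] at hj
  refine le_trans (le_of_eq ?_) hj
  refine Finset.sum_congr rfl fun E _ => ?_
  rw [← Real.exp_mul]
  congr 2
  rw [← Finset.mul_sum, ← Finset.mul_sum]
  field_simp

end Replacement

/-! ### Where the threshold for `μ` enters -/

section Numeric

/-- Since `2 * (d + 1) * (d - 1) / (2 * d ^ 2) = 1 - 1 / d ^ 2`, the hypothesis says `x < d ^ (-(1 -
1 / d ^ 2))`. This is close to `1 / d`, and `(1 + x) ^ (d - 1)` is at most about `e`; only small `d`
need separate numerics. -/
theorem exp_mul_one_add_pow_lt_one {d : ℕ} (hd : 2 ≤ d) {μ : ℝ}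
    (hμ : 2 * ((d : ℝ) + 1) * Real.log d < μ) :
    Real.exp (-(μ * (((d : ℝ) - 1) / (2 * d ^ 2)))) *
      (1 + Real.exp (-(μ * (((d : ℝ) - 1) / (2 * d ^ 2))))) ^ (d - 1) < 1 := by
  set x := Real.exp (-(μ * (((d : ℝ) - 1) / (2 * d ^ 2)))) with hx
  have hd' : (2 : ℝ) ≤ d := by exact_mod_cast hd
  have hx0 : 0 < x := Real.exp_pos _
  have hlog : (1 - 1 / (d : ℝ) ^ 2) * Real.log d < μ * (((d : ℝ) - 1) / (2 * d ^ 2)) := by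
    have h1 : (1 - 1 / (d : ℝ) ^ 2) * Real.log d =
        2 * ((d : ℝ) + 1) * Real.log d * (((d : ℝ) - 1) / (2 * d ^ 2)) := by
      field_simp
      ring
    rw [h1]
    have : 0 < ((d : ℝ) - 1) / (2 * d ^ 2) := div_pos (by linarith) (by positivity)
    gcongr
  have hxlt : x < Real.exp (-((1 - 1 / (d : ℝ) ^ 2) * Real.log d)) :=
    Real.exp_lt_exp.2 (neg_lt_neg hlog)
  -- Clears the rational exponent: `x ^ 4 * 2 ^ 3 < 1` for `d = 2`, and `x ^ 9 * 3 ^ 8 < 1` for `d =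
  -- 3`.
  have hpow : ∀ m n : ℕ, (1 - 1 / (d : ℝ) ^ 2) * n = m → x ^ n * d ^ m < 1 ∨ n = 0 := by
    intro m n hmn
    rcases Nat.eq_zero_or_pos n with rfl | hn
    · exact Or.inr rfl
    left
    have h1 : x ^ n < Real.exp (-((1 - 1 / (d : ℝ) ^ 2) * Real.log d)) ^ n :=
      pow_lt_pow_left₀ hxlt hx0.le hn.ne'
    have h2 : Real.exp (-((1 - 1 / (d : ℝ) ^ 2) * Real.log d)) ^ n * (d : ℝ) ^ m = 1 := by
      rw [← Real.exp_nat_mul, ← Real.exp_log (show (0 : ℝ) < (d : ℝ) ^ m by positivity),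
        ← Real.exp_add, Real.log_pow, ← hmn]
      ring_nf
      exact Real.exp_zero
    calc x ^ n * (d : ℝ) ^ m < Real.exp (-((1 - 1 / (d : ℝ) ^ 2) * Real.log d)) ^ n * (d : ℝ) ^ m := by
          gcongr
      _ = 1 := h2
  rcases (by omega : d = 2 ∨ d = 3 ∨ 4 ≤ d) with rfl | rfl | h4
  · have h := (hpow 3 4 (by norm_num)).resolve_right (by norm_num)
    have hx6 : x < 0.6 := by
      by_contra hcon
      push Not at hcon
      have := pow_le_pow_left₀ (by norm_num) hcon 4
      norm_num at this h
      linarith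
    norm_num
    nlinarith
  · have h := (hpow 8 9 (by norm_num)).resolve_right (by norm_num)
    have hx6 : x < 0.38 := by
      by_contra hcon
      push Not at hcon
      have := pow_le_pow_left₀ (by norm_num) hcon 9
      norm_num at this h
      linarith
    norm_num
    have h2 : (1 + x) ^ 2 ≤ 1.38 ^ 2 := pow_le_pow_left₀ (by linarith) (by linarith) 2
    nlinarith
  -- For `d ≥ 4`: `x * (d - 1) ≤ 1` gives `(1 + x) ^ (d - 1) ≤ e`, and `e * x < 1` because `(15 /
  -- 16) * log 4 > 1`.
  · have h4' : (4 : ℝ) ≤ d := by exact_mod_cast h4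
    have hd1 : ((d - 1 : ℕ) : ℝ) = d - 1 := by rw [Nat.cast_sub (by omega)]; simp
    have hlog4 : (1.38 : ℝ) < Real.log d := by
      have h1 : Real.log 4 ≤ Real.log d := Real.log_le_log (by norm_num) h4'
      have h2 : Real.log 4 = 2 * Real.log 2 := by
        rw [show (4 : ℝ) = 2 ^ 2 by norm_num, Real.log_pow]; norm_num
      have := Real.log_two_gt_d9
      linarith
    have hsq : 1 / (d : ℝ) ^ 2 ≤ 1 / 16 := by
      refine one_div_le_one_div_of_le (by norm_num) ?_
      nlinarith
    have hxd : x * (d - 1) ≤ 1 := by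
      -- `log d / d ^ 2 ≤ 1 / d ≤ - log (1 - 1 / d)`
      have h1 : Real.log d ≤ d := (Real.log_le_sub_one_of_pos (by linarith)).trans (by linarith)
      have h2 : Real.log (((d : ℝ) - 1) / d) ≤ ((d : ℝ) - 1) / d - 1 :=
        Real.log_le_sub_one_of_pos (div_pos (by linarith) (by linarith))
      rw [Real.log_div (by linarith) (by linarith)] at h2
      have h3 : Real.log d * (1 / (d : ℝ) ^ 2) ≤ 1 / (d : ℝ) := by
        calc Real.log d * (1 / (d : ℝ) ^ 2) ≤ (d : ℝ) * (1 / (d : ℝ) ^ 2) := by gcongr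
          _ = 1 / (d : ℝ) := by field_simp
      have h4 : ((d : ℝ) - 1) / d - 1 = -(1 / (d : ℝ)) := by field_simp; ring
      have h5 : (d : ℝ) - 1 = Real.exp (Real.log (d - 1)) := (Real.exp_log (by linarith)).symm
      calc x * (d - 1) ≤ Real.exp (-((1 - 1 / (d : ℝ) ^ 2) * Real.log d)) * (d - 1) := by
            gcongr
            linarith
        _ = Real.exp (-((1 - 1 / (d : ℝ) ^ 2) * Real.log d) + Real.log (d - 1)) := by
            rw [Real.exp_add, ← h5]
        _ ≤ 1 := by
            rw [Real.exp_le_one_iff]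
            nlinarith
    calc x * (1 + x) ^ (d - 1) ≤ x * Real.exp (((d : ℝ) - 1) * x) := by
          gcongr
          rw [← hd1, Real.exp_nat_mul]
          gcongr
          rw [add_comm]
          exact Real.add_one_le_exp x
      _ ≤ x * Real.exp 1 := by
          gcongr
          linarith
      _ < Real.exp (-((1 - 1 / (d : ℝ) ^ 2) * Real.log d)) * Real.exp 1 := by gcongr
      _ = Real.exp (-((1 - 1 / (d : ℝ) ^ 2) * Real.log d) + 1) := (Real.exp_add _ _).symm
      _ ≤ 1 := by
          rw [Real.exp_le_one_iff]
          nlinarith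

-- The union bound evaluated. Each set `R` is encoded by its `u` unreached branches, a subset of the
-- `d - 1` branches other than `a0`. Its exponent is `μ * κ * (1 + u) + (d - u) * (l * κ) * (1 +
-- u)`, and the binomial theorem sums the resulting powers.
open Classical in
theorem sum_blocks_le {d : ℕ} {X : Type*} [Fintype X] (S0 : Finset X) (π : X → Option (Fin d))
    (a0 : Fin d) (h0 : none ∈ S0.image π) (h1 : some a0 ∈ S0.image π) {κ μ l : ℝ}
    (hκ : 0 ≤ κ) (hl : 0 ≤ l) (k : X → ℝ) (hk : ∀ b, ∑ z with π z = some b, k z = κ)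
    {c : Option (Fin d) → X → ℝ} {r : Option (Fin d) → ℝ}
    (hc0 : ∀ z, c none z = μ * k z) (hc1 : ∀ a z, π z ≠ some a → c (some a) z = l * k z)
    (hr0 : r none = μ / d) (hr1 : ∀ a, r (some a) = l / d) :
    ∑ R : Finset (Option (Fin d)) with S0.image π ⊆ R,
        Real.exp (-∑ i ∈ R, (d * κ * r i + ∑ x with π x ∉ R, c i x)) ≤
      Real.exp (-(l * (d * κ))) * (Real.exp (-(μ * κ)) * (1 + Real.exp (-(μ * κ))) ^ (d - 1)) := by
  have hd : (d : ℝ) ≠ 0 := by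
    have : 0 < d := Fin.pos a0
    positivity
  have hdiv : ∀ t : ℝ, d * κ * (t / d) = t * κ := fun t => by field_simp
  let U : Finset (Option (Fin d)) → Finset (Fin d) := fun R => Finset.univ.filter fun b => some b ∉ R
  have hterm : ∀ R ∈ Finset.univ.filter fun R : Finset (Option (Fin d)) => S0.image π ⊆ R,
      Real.exp (-∑ i ∈ R, (d * κ * r i + ∑ x with π x ∉ R, c i x)) ≤
        Real.exp (-(l * (d * κ))) * Real.exp (-(μ * κ)) * Real.exp (-(μ * κ)) ^ (U R).card := by
    intro R hR
    simp only [Finset.mem_filter, Finset.mem_univ, true_and] at hR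
    have hnone : none ∈ R := hR h0
    have hkU : ∑ x with π x ∉ R, k x = (U R).card * κ := by
      have e : (Finset.univ.filter fun x => π x ∉ R) =
          (U R).biUnion fun b => Finset.univ.filter fun z => π z = some b := by
        ext z
        simp only [U, Finset.mem_filter, Finset.mem_univ, true_and, Finset.mem_biUnion]
        constructor
        · intro hz
          cases hp : π z with
          | none => exact absurd (hp ▸ hnone) hz
          | some b => exact ⟨b, hp ▸ hz, rfl⟩
        · rintro ⟨b, hb, hz⟩
          rwa [hz]
      rw [e, Finset.sum_biUnion]
      · simp [hk]
      · intro b _ b' _ hbb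
        refine Finset.disjoint_left.2 fun z hz hz' => hbb ?_
        simp only [Finset.mem_filter, Finset.mem_univ, true_and] at hz hz'
        exact Option.some.inj (hz.symm.trans hz')
    have hsome : ∀ a, some a ∈ R → d * κ * r (some a) + ∑ x with π x ∉ R, c (some a) x =
        l * κ * (1 + (U R).card) := by
      intro a ha
      rw [hr1, Finset.sum_congr rfl fun z hz => hc1 a z fun h => by
        simp only [Finset.mem_filter, Finset.mem_univ, true_and] at hz
        exact hz (h ▸ ha), ← Finset.mul_sum, hkU, hdiv]
      ring
    have hsum : ∑ i ∈ R, (d * κ * r i + ∑ x with π x ∉ R, c i x) =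
        μ * κ * (1 + (U R).card) + (Finset.univ \ U R).card * (l * κ * (1 + (U R).card)) := by
      have e : R = insert none ((Finset.univ \ U R).map Function.Embedding.some) := by
        ext i
        cases i with
        | none => simp [hnone]
        | some a => simp [U]
      conv_lhs => rw [e, Finset.sum_insert (by simp), Finset.sum_map, ← e]
      congr 1
      · rw [hr0, Finset.sum_congr rfl fun z _ => hc0 z, ← Finset.mul_sum, hkU, hdiv]
        ring
      · refine (Finset.sum_congr rfl fun a ha => hsome a (by simpa [U] using ha)).trans ?_
        rw [Finset.sum_const, nsmul_eq_mul]
    rw [hsum, ← Real.exp_nat_mul, ← Real.exp_add, ← Real.exp_add, Real.exp_le_exp]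
    have hcard : (Finset.univ \ U R).card + (U R).card = d := by
      rw [Finset.card_sdiff_add_card_eq_card (Finset.subset_univ _)]
      simp
    have hpos : 1 ≤ (Finset.univ \ U R).card := Finset.card_pos.2 ⟨a0, by simpa [U] using hR h1⟩
    have hcard' : ((Finset.univ \ U R).card : ℝ) + (U R).card = d := by exact_mod_cast hcard
    have hpos' : (1 : ℝ) ≤ (Finset.univ \ U R).card := by exact_mod_cast hpos
    have hU0 : (0 : ℝ) ≤ (U R).card := Nat.cast_nonneg _
    have hlk : 0 ≤ l * κ := mul_nonneg hl hκ
    -- `(d - u) * (1 + u) - d = u * (d - u - 1) ≥ 0`: missing branches never reduce the exponent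
    -- inherited from the children.
    have : (d : ℝ) ≤ (Finset.univ \ U R).card * (1 + (U R).card) := by nlinarith
    nlinarith [mul_le_mul_of_nonneg_left this hlk]
  refine (Finset.sum_le_sum hterm).trans ?_
  have hinj : Set.InjOn U (Finset.univ.filter fun R : Finset (Option (Fin d)) =>
      S0.image π ⊆ R : Finset _) := by
    intro R hR R' hR' h
    simp only [Finset.coe_filter, Finset.mem_univ, true_and, Set.mem_ofPred_eq] at hR hR'
    ext i
    cases i with
    | none => exact ⟨fun _ => hR' h0, fun _ => hR h0⟩
    | some b =>
      have := Finset.ext_iff.1 h b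
      simp only [U, Finset.mem_filter, Finset.mem_univ, true_and] at this
      exact not_iff_not.1 this
  rw [← Finset.sum_image (f := fun V : Finset (Fin d) =>
    Real.exp (-(l * (d * κ))) * Real.exp (-(μ * κ)) * Real.exp (-(μ * κ)) ^ V.card) hinj]
  have hsub : (Finset.univ.filter fun R : Finset (Option (Fin d)) => S0.image π ⊆ R).image U ⊆
      (Finset.univ.erase a0).powerset := by
    intro V hV
    obtain ⟨R, hR, rfl⟩ := Finset.mem_image.1 hV
    simp only [Finset.mem_filter, Finset.mem_univ, true_and] at hR
    rw [Finset.mem_powerset]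
    intro b hb
    refine Finset.mem_erase.2 ⟨?_, Finset.mem_univ _⟩
    rintro rfl
    simp only [U, Finset.mem_filter, Finset.mem_univ, true_and] at hb
    exact hb (hR h1)
  refine (Finset.sum_le_sum_of_subset_of_nonneg hsub fun _ _ _ => by positivity).trans ?_
  rw [← Finset.mul_sum, mul_assoc]
  have h := Finset.sum_pow_mul_eq_add_pow (Real.exp (-(μ * κ))) 1 (Finset.univ.erase a0)
  simp only [one_pow, mul_one] at h
  rw [h, Finset.card_erase_of_mem (Finset.mem_univ _), Finset.card_univ, Fintype.card_fin,
    add_comm (Real.exp _) 1]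

end Numeric

/-! ### Independence, Poisson thinning and measurability -/

section Independence

variable {Ω : Type*} [MeasurableSpace Ω] {P : Measure Ω}

/-- The joint law is a product measure, and a product over pairs is a product of products. -/
theorem iIndepFun_curry {ι : Type*} {κ : ι → Type*} {𝓧 : (i : ι) → κ i → Type*}
    [∀ i j, MeasurableSpace (𝓧 i j)] {X : (i : ι) → (j : κ i) → Ω → 𝓧 i j}
    (mX : ∀ i j, Measurable (X i j))
    (h : iIndepFun (fun (p : (i : ι) × κ i) ω => X p.1 p.2 ω) P) :
    iIndepFun (fun i ω j => X i j ω) P := by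
  have := h.isProbabilityMeasure
  have : ∀ i j, IsProbabilityMeasure (P.map (X i j)) :=
    fun i j => Measure.isProbabilityMeasure_map (mX i j).aemeasurable
  have h1 := h.map_fun_eq_infinitePi_map (fun p => mX p.1 p.2)
  have h2 : ∀ i, P.map (fun ω j => X i j ω) = Measure.infinitePi fun j => P.map (X i j) := fun i =>
    (h.precomp (g := fun j => (⟨i, j⟩ : (i : ι) × κ i))
      (fun j j' hj => by simpa using hj)).map_fun_eq_infinitePi_map (mX i)
  have hc : (MeasurableEquiv.piCurry 𝓧) ∘ (fun ω p => X p.1 p.2 ω) = fun ω i j => X i j ω := by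
    ext; simp [Sigma.curry]
  have mg : ∀ i, Measurable fun ω j => X i j ω := fun i => measurable_pi_lambda _ (mX i)
  rw [iIndepFun_iff_map_fun_eq_infinitePi_map mg, ← hc, ← Measure.map_map (by fun_prop)
    (measurable_pi_lambda _ fun p => mX p.1 p.2), h1,
    Measure.infinitePi_map_piCurry (fun i j => P.map (X i j))]
  congr 1
  funext i
  exact (h2 i).symm

theorem iIndepFun_prodMk {ι α β : Type*} [MeasurableSpace α] [MeasurableSpace β]
    {X : ι → Ω → α} {Y : ι → Ω → β} (mX : ∀ i, Measurable (X i)) (mY : ∀ i, Measurable (Y i))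
    (hX : iIndepFun X P) (hY : iIndepFun Y P)
    (hXY : IndepFun (fun ω i => X i ω) (fun ω i => Y i ω) P) :
    iIndepFun (fun i ω => (X i ω, Y i ω)) P := by
  have := hX.isProbabilityMeasure
  rw [iIndepFun_iff_iIndep]
  refine iIndepSets.iIndep (fun i => ((mX i).prodMk (mY i)).comap_le)
    (fun i => Set.preimage (fun ω => (X i ω, Y i ω)) '' Set.image2 (· ×ˢ ·)
      {s : Set α | MeasurableSet s} {t : Set β | MeasurableSet t})
    (fun i => isPiSystem_prod.comap _) (fun i => ?_) ?_
  · rw [← generateFrom_prod, MeasurableSpace.comap_generateFrom]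
  · rw [iIndepSets_iff]
    intro s f hf
    have hf' : ∀ i ∈ s, ∃ A B, MeasurableSet A ∧ MeasurableSet B ∧
        f i = X i ⁻¹' A ∩ Y i ⁻¹' B := by
      intro i hi
      obtain ⟨_, ⟨A, hA, B, hB, rfl⟩, h⟩ := hf i hi
      exact ⟨A, B, hA, hB, h.symm⟩
    choose! A B hA hB hfAB using hf'
    have e1 : ⋂ i ∈ s, f i = (⋂ i ∈ s, X i ⁻¹' A i) ∩ ⋂ i ∈ s, Y i ⁻¹' B i := by
      ext ω
      simp only [Set.mem_iInter, Set.mem_inter_iff]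
      constructor
      · intro h
        refine ⟨fun i hi => ?_, fun i hi => ?_⟩ <;> have := h i hi <;> rw [hfAB i hi] at this
        exacts [this.1, this.2]
      · intro h i hi
        rw [hfAB i hi]
        exact ⟨h.1 i hi, h.2 i hi⟩
    have e2 : P ((⋂ i ∈ s, X i ⁻¹' A i) ∩ ⋂ i ∈ s, Y i ⁻¹' B i) =
        P (⋂ i ∈ s, X i ⁻¹' A i) * P (⋂ i ∈ s, Y i ⁻¹' B i) := by
      have h := hXY.measure_inter_preimage_eq_mul (⋂ i ∈ s, (fun f : ι → α => f i) ⁻¹' A i)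
        (⋂ i ∈ s, (fun f : ι → β => f i) ⁻¹' B i)
        (Finset.measurableSet_biInter s fun i hi => measurable_pi_apply i (hA i hi))
        (Finset.measurableSet_biInter s fun i hi => measurable_pi_apply i (hB i hi))
      simpa only [Set.preimage_iInter, Set.preimage_preimage] using h
    rw [e1, e2, hX.measure_inter_preimage_eq_mul s hA, hY.measure_inter_preimage_eq_mul s hB,
      ← Finset.prod_mul_distrib]
    refine Finset.prod_congr rfl fun i hi => ?_
    rw [hfAB i hi]
    have hi' : IndepFun (X i) (Y i) P :=
      hXY.comp (measurable_pi_apply i) (measurable_pi_apply i)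
    exact (hi'.measure_inter_preimage_eq_mul _ _ (hA i hi) (hB i hi)).symm

open Classical in
/-- The probability of an event that depends on finitely many independent discrete variables. -/
theorem measureReal_eq_sum_prod {ι Y : Type*} [Fintype ι] [Fintype Y] [IsProbabilityMeasure P]
    {G : ι → Ω → Y} (hG : ∀ i y, MeasurableSet {ω | G i ω = y})
    (hind : ∀ Φ : ι → Y, P (⋂ i, {ω | G i ω = Φ i}) = ∏ i, P {ω | G i ω = Φ i})
    (F : (ι → Y) → Prop) :
    P.real {ω | F fun i => G i ω} =
      ∑ Φ, (∏ i, P.real {ω | G i ω = Φ i}) * (if F Φ then 1 else 0) := by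
  have hset : {ω | F fun i => G i ω} =
      ⋃ Φ ∈ Finset.univ.filter F, ⋂ i, {ω | G i ω = Φ i} := by
    ext ω
    simp only [Finset.mem_filter, Finset.mem_univ, true_and, Set.mem_iUnion, Set.mem_iInter,
      Set.mem_ofPred_eq, exists_prop]
    constructor
    · exact fun h => ⟨_, h, fun i => rfl⟩
    · rintro ⟨Φ, h, h'⟩
      rwa [show (fun i => G i ω) = Φ from funext h']
  rw [hset, measureReal_biUnion_finset]
  · simp only [mul_ite, mul_one, mul_zero]
    rw [← Finset.sum_filter]
    refine Finset.sum_congr rfl fun Φ _ => ?_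
    rw [measureReal_def, hind, ENNReal.toReal_prod]
    rfl
  · intro Φ _ Ψ _ hne
    refine Set.disjoint_left.2 fun ω h h' => hne (funext fun i => ?_)
    simp only [Set.mem_iInter, Set.mem_ofPred_eq] at h h'
    exact (h i).symm.trans (h' i)
  · exact fun Φ _ => MeasurableSet.iInter fun i => hG i _

/-- Poisson thinning: the probability that none of a Poisson number of independent objects lies
in `C`. -/
theorem poisson_avoid [IsProbabilityMeasure P] {α : Type*} [MeasurableSpace α] {n : Ω → ℕ}
    {X : ℕ → Ω → α} {μ : ℝ≥0} {ν : Measure α} [IsProbabilityMeasure ν] (hn : Measurable n)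
    (mX : ∀ i, Measurable (X i))
    (hμ : P.map n = poissonMeasure μ) (hX : iIndepFun X P) (hν : ∀ i, P.map (X i) = ν)
    (hind : IndepFun n (fun ω i => X i ω) P) {C : Set α} (hC : MeasurableSet C) :
    P.real {ω | ∀ i < n ω, X i ω ∉ C} = Real.exp (-(μ * ν.real C)) := by
  have hset : {ω | ∀ i < n ω, X i ω ∉ C} =
      ⋃ k, n ⁻¹' {k} ∩ (fun ω i => X i ω) ⁻¹' ⋂ i ∈ Finset.range k, (fun f => f i) ⁻¹' Cᶜ := by
    ext ω
    simp
  have hm : ∀ k, MeasurableSet (⋂ i ∈ Finset.range k, (fun f : ℕ → α => f i) ⁻¹' Cᶜ) := fun k =>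
    Finset.measurableSet_biInter _ fun i _ => measurable_pi_apply i hC.compl
  have hXm : Measurable fun ω i => X i ω := measurable_pi_lambda _ mX
  have hterm : ∀ k, P (n ⁻¹' {k} ∩ (fun ω i => X i ω) ⁻¹'
      ⋂ i ∈ Finset.range k, (fun f => f i) ⁻¹' Cᶜ) =
      ENNReal.ofReal (Real.exp (-μ) * ((μ * (1 - ν.real C)) ^ k / k.factorial)) := by
    intro k
    rw [hind.measure_inter_preimage_eq_mul _ _ (measurableSet_singleton k) (hm k),
      ← Measure.map_apply hn (measurableSet_singleton k), hμ, poissonMeasure_singleton]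
    have h1 : P ((fun ω i => X i ω) ⁻¹' ⋂ i ∈ Finset.range k, (fun f => f i) ⁻¹' Cᶜ) =
        ENNReal.ofReal ((1 - ν.real C) ^ k) := by
      have h2 := hX.measure_inter_preimage_eq_mul (Finset.range k) (sets := fun _ => Cᶜ)
        (fun i _ => hC.compl)
      simp only [Set.preimage_iInter, Set.preimage_preimage]
      have h3 : ∀ i, P (X i ⁻¹' Cᶜ) = ENNReal.ofReal (1 - ν.real C) := fun i => by
        rw [← Measure.map_apply (mX i) hC.compl, hν, ← probReal_compl_eq_one_sub hC,
          ofReal_measureReal]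
      simp only [h3, Finset.prod_const, Finset.card_range] at h2
      rw [ENNReal.ofReal_pow (by linarith [measureReal_le_one (μ := ν) (s := C)]), ← h2]
    rw [h1, ← ENNReal.ofReal_mul (by positivity)]
    congr 1
    rw [mul_pow]
    ring
  have h0 : 0 ≤ μ * (1 - ν.real C) :=
    mul_nonneg μ.2 (by linarith [measureReal_le_one (μ := ν) (s := C)])
  have hsum := (NormedSpace.expSeries_div_hasSum_exp (μ * (1 - ν.real C))).mul_left (Real.exp (-μ))
  rw [measureReal_def, hset, measure_iUnion, tsum_congr hterm,
    ← ENNReal.ofReal_tsum_of_nonneg (fun k => by positivity) hsum.summable, hsum.tsum_eq,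
    ← Real.exp_eq_exp_ℝ, ← Real.exp_add, ENNReal.toReal_ofReal (Real.exp_pos _).le]
  · congr 1
    ring
  · intro k l hkl
    refine Set.disjoint_left.2 fun ω h h' => hkl ?_
    exact h.1.symm.trans h'.1
  · exact fun k => (hn (measurableSet_singleton k)).inter (hXm (hm k))

theorem measurableSet_reflTransGen {α : Type*} [Countable α] {r : Ω → α → α → Prop}
    (hr : ∀ a b, MeasurableSet {ω | r ω a b}) (a b : α) :
    MeasurableSet {ω | Relation.ReflTransGen (r ω) a b} := by
  let R : ℕ → α → Set Ω := fun n => Nat.rec (fun b => {_ω | a = b})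
    (fun _ A b => ⋃ c, A c ∩ {ω | r ω c b}) n
  have hR : ∀ n b, MeasurableSet (R n b) := by
    intro n
    induction n with
    | zero => exact fun b => MeasurableSet.const _
    | succ n ih => exact fun b => MeasurableSet.iUnion fun c => (ih c).inter (hr c b)
  have : {ω | Relation.ReflTransGen (r ω) a b} = ⋃ n, R n b := by
    ext ω
    simp only [Set.mem_ofPred_eq, Set.mem_iUnion]
    constructor
    · intro h
      induction h with
      | refl => exact ⟨0, rfl⟩
      | tail _ h ih =>
        obtain ⟨n, hn⟩ := ih
        exact ⟨n + 1, Set.mem_iUnion.2 ⟨_, hn, h⟩⟩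
    · rintro ⟨n, hn⟩
      induction n generalizing b with
      | zero =>
        have : a = b := hn
        rw [this]
      | succ n ih =>
        obtain ⟨c, hc, h⟩ := Set.mem_iUnion.1 hn
        exact (ih c hc).tail h
  rw [this]
  exact MeasurableSet.iUnion fun n => hR n b

end Independence

/-! ### Waking inside a subtree -/

section Config

variable {d : ℕ}

/-- The numbers of frogs and their paths at all vertices. -/
abbrev FrogConfig (d : ℕ) : Type := DaryVertex d → ℕ × (ℕ → ℕ → DaryVertex d)

/-- If `u` in the subtree of `w` has been visited, then so has `v` in this subtree: it is an
ancestor of `u` or of a vertex visited by a frog of `u`. -/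
def Wakes (w : DaryVertex d) (ζ : FrogConfig d) (u v : DaryVertex d) : Prop :=
  IsAncestor w v ∧ (IsAncestor v u ∨ ∃ i < (ζ u).1, ∃ k, IsAncestor v ((ζ u).2 i k))

/-- If the vertices from `w` to `z` have been visited, then some frog of the subtree of `w` wakes
up by means of frogs of this subtree, and follows a path of `A`. -/
def SomeFrog (w z : DaryVertex d) (A : Set (ℕ → DaryVertex d)) (ζ : FrogConfig d) : Prop :=
  ∃ v, Relation.ReflTransGen (Wakes w ζ) z v ∧ ∃ i < (ζ v).1, (ζ v).2 i ∈ A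

theorem measurableSet_exists_frog (v : DaryVertex d) {A : Set (ℕ → DaryVertex d)}
    (hA : MeasurableSet A) : MeasurableSet {ζ : FrogConfig d | ∃ i < (ζ v).1, (ζ v).2 i ∈ A} := by
  have : {ζ : FrogConfig d | ∃ i < (ζ v).1, (ζ v).2 i ∈ A} =
      ⋃ i, ((fun ζ : FrogConfig d => (ζ v).1) ⁻¹' Set.Ioi i ∩
        (fun ζ : FrogConfig d => (ζ v).2 i) ⁻¹' A) := by
    ext ζ; simp
  rw [this]
  refine MeasurableSet.iUnion fun i => MeasurableSet.inter ?_ ?_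
  · exact (measurable_fst.comp (measurable_pi_apply v)) measurableSet_Ioi
  · exact ((measurable_pi_apply i).comp (measurable_snd.comp (measurable_pi_apply v))) hA

theorem measurableSet_visitIn (B : Set (DaryVertex d)) :
    MeasurableSet {x : ℕ → DaryVertex d | ∃ k, x k ∈ B} := by
  have : {x : ℕ → DaryVertex d | ∃ k, x k ∈ B} = ⋃ k, (fun x : ℕ → DaryVertex d => x k) ⁻¹' B := by
    ext x; simp
  rw [this]
  exact MeasurableSet.iUnion fun k => measurable_pi_apply k MeasurableSet.of_discrete

theorem measurableSet_wakes (w u v : DaryVertex d) :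
    MeasurableSet {ζ : FrogConfig d | Wakes w ζ u v} := by
  have : {ζ : FrogConfig d | Wakes w ζ u v} = {_ζ | IsAncestor w v} ∩ ({_ζ | IsAncestor v u} ∪
      {ζ | ∃ i < (ζ u).1, (ζ u).2 i ∈ {x : ℕ → DaryVertex d | ∃ k, x k ∈ {y | IsAncestor v y}}}) :=
    rfl
  rw [this]
  exact (MeasurableSet.const _).inter ((MeasurableSet.const _).union
    (measurableSet_exists_frog u (measurableSet_visitIn _)))

theorem measurableSet_someFrog (w z : DaryVertex d) {A : Set (ℕ → DaryVertex d)}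
    (hA : MeasurableSet A) : MeasurableSet {ζ : FrogConfig d | SomeFrog w z A ζ} := by
  have : {ζ : FrogConfig d | SomeFrog w z A ζ} =
      ⋃ v, {ζ | Relation.ReflTransGen (Wakes w ζ) z v} ∩ {ζ | ∃ i < (ζ v).1, (ζ v).2 i ∈ A} := by
    ext ζ; simp [SomeFrog]
  rw [this]
  exact MeasurableSet.iUnion fun v => (measurableSet_reflTransGen
    (fun a b => measurableSet_wakes w a b) z v).inter (measurableSet_exists_frog v hA)

/-- Locality, the source of independence between branches: the chain of wakings stays in the subtree
of `w`, even though the paths of its frogs may leave it. -/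
theorem SomeFrog.congr {w z : DaryVertex d} {A : Set (ℕ → DaryVertex d)} {ζ ζ' : FrogConfig d}
    (hz : IsAncestor w z) (h : ∀ v, IsAncestor w v → ζ v = ζ' v) (hf : SomeFrog w z A ζ) :
    SomeFrog w z A ζ' := by
  obtain ⟨v, hv, hA⟩ := hf
  have key : IsAncestor w v ∧ Relation.ReflTransGen (Wakes w ζ') z v := by
    clear hA
    induction hv with
    | refl => exact ⟨hz, .refl⟩
    | tail _ hbc ih =>
      refine ⟨hbc.1, ih.2.tail ⟨hbc.1, ?_⟩⟩
      rw [← h _ ih.1]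
      exact hbc.2
  refine ⟨v, key.2, ?_⟩
  rw [← h v key.1]
  exact hA

theorem Wakes.mono {w p u v : DaryVertex d} {ζ : FrogConfig d} (hp : IsAncestor p w)
    (h : Wakes w ζ u v) : Wakes p ζ u v := ⟨hp.trans h.1, h.2⟩

end Config

/-! ### The frogs of distinct vertices as independent data -/

section Model

variable {d : ℕ} {Ω : Type*} [MeasurableSpace Ω] {P : Measure Ω}
  {η : Ω → DaryVertex d → ℕ} {S : Ω → DaryVertex d → ℕ → ℕ → DaryVertex d}

/-- The configuration of frogs of a realization. -/
def frogConfig (η : Ω → DaryVertex d → ℕ) (S : Ω → DaryVertex d → ℕ → ℕ → DaryVertex d) (ω : Ω) :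
    FrogConfig d := fun v => (η ω v, S ω v)

/-- The law of the walks started at `v`. -/
noncomputable def walkLaw (P : Measure Ω) (S : Ω → DaryVertex d → ℕ → ℕ → DaryVertex d)
    (v : DaryVertex d) : Measure (ℕ → DaryVertex d) := P.map fun ω => S ω v 0

variable [IsProbabilityMeasure P] {μ : ℝ≥0}

namespace IsPoissonFrogModel

variable (hm : IsPoissonFrogModel (daryTree d) (root d) μ P η S)
include hm

theorem isWalkLaw : IsWalkLaw (daryTree d) (walkLaw P S) where
  prob v := Measure.isProbabilityMeasure_map (hm.walk_law v 0).measurable.aemeasurable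
  cyl v n x := by
    rw [walkLaw, Measure.map_apply (hm.walk_law v 0).measurable (measurableSet_pathCylinder n x)]
    exact (hm.walk_law v 0).law n x

theorem map_walk (v : DaryVertex d) (i : ℕ) : P.map (fun ω => S ω v i) = walkLaw P S v := by
  have := hm.isWalkLaw.prob v
  have := Measure.isProbabilityMeasure_map (μ := P) (hm.walk_law v i).measurable.aemeasurable
  refine path_measure_ext (fun n x => ?_) (by rw [measure_univ, measure_univ])
  rw [Measure.map_apply (hm.walk_law v i).measurable (measurableSet_pathCylinder n x),
    hm.isWalkLaw.cyl]
  exact (hm.walk_law v i).law n x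

theorem measurable_walks (v : DaryVertex d) : Measurable fun ω => S ω v :=
  measurable_pi_lambda _ fun i => (hm.walk_law v i).measurable

theorem measurable_frogConfig_apply (v : DaryVertex d) :
    Measurable fun ω => frogConfig η S ω v :=
  (hm.count_measurable v).prodMk (hm.measurable_walks v)

theorem measurable_frogConfig : Measurable (frogConfig η S) :=
  measurable_pi_lambda _ fun v => hm.measurable_frogConfig_apply v

theorem iIndepFun_frogConfig : iIndepFun (fun v ω => frogConfig η S ω v) P := by
  have h1 : iIndepFun (fun (f : (_ : DaryVertex d) × ℕ) ω => S ω f.1 f.2) P :=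
    hm.walk_indep.precomp (g := fun f : (_ : DaryVertex d) × ℕ => (f.1, f.2))
      (fun f g h => by
        simp only [Prod.mk.injEq] at h
        exact Sigma.ext h.1 (heq_of_eq h.2))
  have h2 : iIndepFun (fun v ω => S ω v) P :=
    iIndepFun_curry (X := fun v i ω => S ω v i) (fun v i => (hm.walk_law v i).measurable) h1
  exact iIndepFun_prodMk hm.count_measurable hm.measurable_walks hm.count_indep h2
    hm.count_walk_indep

theorem iIndepFun_walks (v : DaryVertex d) : iIndepFun (fun i ω => S ω v i) P :=
  hm.walk_indep.precomp (g := fun i => (v, i)) fun _ _ h => (Prod.mk.inj h).2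

theorem avoid_at_vertex {p : DaryVertex d} (hp : p ≠ root d) {A : Set (ℕ → DaryVertex d)}
    (hA : MeasurableSet A) :
    P.real {ω | ∀ i < η ω p, S ω p i ∉ A} = Real.exp (-(μ * (walkLaw P S p).real A)) := by
  have := hm.isWalkLaw.prob p
  exact poisson_avoid (X := fun i ω => S ω p i) (hm.count_measurable p)
    (fun i => (hm.walk_law p i).measurable) (hm.count_law p hp) (hm.iIndepFun_walks p)
    (hm.map_walk p) (hm.count_walk_indep.comp (measurable_pi_apply p) (measurable_pi_apply p)) hA

/-- Events that depend on the frogs of disjoint sets of vertices are independent. -/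
theorem indep_blocks {ι : Type*} [Fintype ι] {Y : Type*} {B : ι → Set (DaryVertex d)}
    (hB : Pairwise (Function.onFun Disjoint B)) {G : ι → FrogConfig d → Y}
    (hG : ∀ i y, MeasurableSet {ζ | G i ζ = y})
    (hloc : ∀ i ζ ζ', (∀ v ∈ B i, ζ v = ζ' v) → G i ζ = G i ζ') (Φ : ι → Y) :
    P (⋂ i, {ω | G i (frogConfig η S ω) = Φ i}) = ∏ i, P {ω | G i (frogConfig η S ω) = Φ i} := by
  classical
  have h1 : iIndepFun (fun (q : (i : ι) × B i) ω => frogConfig η S ω q.2) P :=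
    hm.iIndepFun_frogConfig.precomp (g := fun q : (i : ι) × B i => (q.2 : DaryVertex d))
      (fun q q' h => by
        obtain ⟨i, v, hv⟩ := q
        obtain ⟨j, v', hv'⟩ := q'
        simp only at h
        subst h
        by_cases hij : i = j
        · subst hij; rfl
        · exact absurd hv' (Set.disjoint_left.1 (hB hij) hv))
  have h2 : iIndepFun (fun i ω (v : B i) => frogConfig η S ω v) P :=
    iIndepFun_curry (X := fun i (v : B i) ω => frogConfig η S ω v)
      (fun i v => hm.measurable_frogConfig_apply v) h1
  refine h2.meas_iInter fun i => ?_
  -- The value outside `B i` is arbitrary, since by `hloc` it does not affect `G i`.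
  let ext : (B i → ℕ × (ℕ → ℕ → DaryVertex d)) → FrogConfig d := fun g v =>
    if h : v ∈ B i then g ⟨v, h⟩ else (0, fun _ _ => root d)
  have hext : Measurable ext := by
    refine measurable_pi_lambda _ fun v => ?_
    by_cases h : v ∈ B i
    · simp only [ext, h, dif_pos]
      exact measurable_pi_apply _
    · simp only [ext, h, dif_neg, not_false_eq_true]
      exact measurable_const
  refine ⟨ext ⁻¹' {ζ | G i ζ = Φ i}, hext (hG i _), ?_⟩
  ext ω
  have : G i (ext fun v : B i => frogConfig η S ω v) = G i (frogConfig η S ω) :=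
    hloc i _ _ fun v hv => by simp [ext, hv]
  simp only [Set.mem_preimage, Set.mem_ofPred_eq, this]

end IsPoissonFrogModel

end Model

/-! ### The exploration at one vertex as a graph of nodes -/

section Nodes

variable {d : ℕ}

instance (p : DaryVertex d) (N : ℕ) : Finite (leaves p N) :=
  ((finite_level (d := d) N).subset fun _ h => h.2).to_subtype

noncomputable instance (p : DaryVertex d) (N : ℕ) : Fintype (leaves p N) := Fintype.ofFinite _

open Classical in
/-- The child of `p` above a leaf `z`. -/
noncomputable def branch (p : DaryVertex d) (z : DaryVertex d) : Option (Fin d) :=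
  if h : ∃ a, IsAncestor (p.child a) z then some h.choose else none

theorem branch_eq_some {p z : DaryVertex d} {a : Fin d} :
    branch p z = some a ↔ IsAncestor (p.child a) z := by
  unfold branch
  constructor
  · intro h
    split_ifs at h with h'
    rw [← Option.some.inj h]
    exact h'.choose_spec
  · intro h
    have h' : ∃ b, IsAncestor (p.child b) z := ⟨a, h⟩
    rw [dif_pos h']
    exact congrArg some (child_eq_of_isAncestor h'.choose_spec h)

theorem exists_branch {p z : DaryVertex d} {N : ℕ} (hN : p.level < N) (hz : z ∈ leaves p N) :
    ∃ a, branch p z = some a := by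
  obtain ⟨a, ha⟩ := hz.1.exists_child (hz.2 ▸ hN)
  exact ⟨a, branch_eq_some.2 ha⟩

/-- The block of a node: `none` for `p` itself, and the child of `p` above it for a leaf. -/
noncomputable def nodeBlock (p : DaryVertex d) (N : ℕ) : Option (leaves p N) → Option (Fin d)
  | none => none
  | some z => branch p z

/-- The vertices of a block. -/
def blockVertices (p : DaryVertex d) : Option (Fin d) → Set (DaryVertex d)
  | none => {p}
  | some a => {v | IsAncestor (p.child a) v}

theorem pairwise_disjoint_blockVertices (p : DaryVertex d) :
    Pairwise (Function.onFun Disjoint (blockVertices p)) := by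
  have h : ∀ a, p ∉ blockVertices p (some a) := fun a h => by
    have := IsAncestor.level_le h
    rw [level_child] at this
    omega
  rintro (_ | a) (_ | b) hab
  · exact absurd rfl hab
  · exact Set.disjoint_singleton_left.2 (h b)
  · exact Set.disjoint_singleton_right.2 (h a)
  · refine Set.disjoint_left.2 fun v hv hv' => hab ?_
    rw [child_eq_of_isAncestor hv hv']

/-- The continuations, from `p` on, of the paths of the frogs that a node wakes up. -/
def launched (p : DaryVertex d) (N : ℕ) (ζ : FrogConfig d) :
    Option (leaves p N) → Set (ℕ → DaryVertex d)
  | none => {q | ∃ i < (ζ p).1, q = (ζ p).2 i}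
  | some z => {q | ∃ a, branch p z = some a ∧ ∃ v, Relation.ReflTransGen (Wakes (p.child a) ζ) z v ∧
      ∃ i < (ζ v).1, ∃ k, (ζ v).2 i k = p ∧ q = pathShift k ((ζ v).2 i)}

/-- The paths that lead to a node. -/
def exitNode (p : DaryVertex d) (N : ℕ) : Option (leaves p N) → Set (ℕ → DaryVertex d)
  | none => ∅
  | some z => exitAt (subtreeBelow p N) z

theorem measurableSet_exitNode (p : DaryVertex d) (N : ℕ) (x : Option (leaves p N)) :
    MeasurableSet (exitNode p N x) := by
  cases x with
  | none => exact MeasurableSet.empty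
  | some z => exact measurableSet_exitAt _ _

theorem exists_launched_some {p : DaryVertex d} {N : ℕ} {ζ : FrogConfig d} {z : leaves p N}
    {a : Fin d} (ha : branch p z = some a) {A : Set (ℕ → DaryVertex d)} :
    (∃ q ∈ launched p N ζ (some z), q ∈ A) ↔ SomeFrog (p.child a) z (visitThen p A) ζ := by
  constructor
  · rintro ⟨q, ⟨b, hb, v, hv, i, hi, k, hk, rfl⟩, hq⟩
    obtain rfl : b = a := Option.some.inj (hb.symm.trans ha)
    exact ⟨v, hv, i, hi, k, hk, hq⟩
  · rintro ⟨v, hv, i, hi, k, hk, hq⟩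
    exact ⟨_, ⟨a, ha, v, hv, i, hi, k, hk, rfl⟩, hq⟩

theorem exists_launched_none {p : DaryVertex d} {N : ℕ} {ζ : FrogConfig d}
    {A : Set (ℕ → DaryVertex d)} :
    (∃ q ∈ launched p N ζ none, q ∈ A) ↔ ∃ i < (ζ p).1, (ζ p).2 i ∈ A := by
  constructor
  · rintro ⟨q, ⟨i, hi, rfl⟩, hq⟩
    exact ⟨i, hi, hq⟩
  · rintro ⟨i, hi, hq⟩
    exact ⟨_, ⟨i, hi, rfl⟩, hq⟩

theorem measurableSet_exists_launched {p : DaryVertex d} {N : ℕ} (hN : p.level < N)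
    (x : Option (leaves p N)) {A : Set (ℕ → DaryVertex d)} (hA : MeasurableSet A) :
    MeasurableSet {ζ : FrogConfig d | ∃ q ∈ launched p N ζ x, q ∈ A} := by
  cases x with
  | none =>
    simp only [exists_launched_none]
    exact measurableSet_exists_frog p hA
  | some z =>
    obtain ⟨a, ha⟩ := exists_branch hN z.2
    simp only [exists_launched_some ha]
    exact measurableSet_someFrog _ _ (measurableSet_visitThen p hA)

theorem launched_congr {p : DaryVertex d} {N : ℕ} (hN : p.level < N) {ζ ζ' : FrogConfig d}
    (x : Option (leaves p N)) (h : ∀ v ∈ blockVertices p (nodeBlock p N x), ζ v = ζ' v)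
    (A : Set (ℕ → DaryVertex d)) :
    (∃ q ∈ launched p N ζ x, q ∈ A) ↔ ∃ q ∈ launched p N ζ' x, q ∈ A := by
  cases x with
  | none =>
    rw [exists_launched_none, exists_launched_none, h p rfl]
  | some z =>
    obtain ⟨a, ha⟩ := exists_branch hN z.2
    rw [exists_launched_some ha, exists_launched_some ha]
    rw [show nodeBlock p N (some z) = some a from ha] at h
    exact ⟨SomeFrog.congr (branch_eq_some.1 ha) h,
      SomeFrog.congr (branch_eq_some.1 ha) fun v hv => (h v hv).symm⟩

open Classical in
/-- The nodes to which the frogs of a node lead, and whether one of them visits the parent of `p`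
and then follows a path of `C`. -/
noncomputable def nodeOutput (p : DaryVertex d) (N : ℕ) (C : Set (ℕ → DaryVertex d))
    (ζ : FrogConfig d) (x : Option (leaves p N)) : Finset (Option (leaves p N)) × Bool :=
  (Finset.univ.filter fun x' => ∃ q ∈ launched p N ζ x, q ∈ exitNode p N x',
    decide (∃ q ∈ launched p N ζ x, q ∈ visitThen p.parent C))

open Classical in
/-- The outputs of the nodes of a block. -/
noncomputable def blockOutput (p : DaryVertex d) (N : ℕ) (C : Set (ℕ → DaryVertex d))
    (o : Option (Fin d)) (ζ : FrogConfig d) (x : Option (leaves p N)) :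
    Finset (Option (leaves p N)) × Bool :=
  if nodeBlock p N x = o then nodeOutput p N C ζ x else (∅, false)

theorem nodeOutput_congr {p : DaryVertex d} {N : ℕ} (hN : p.level < N)
    (C : Set (ℕ → DaryVertex d)) {ζ ζ' : FrogConfig d} (x : Option (leaves p N))
    (h : ∀ v ∈ blockVertices p (nodeBlock p N x), ζ v = ζ' v) :
    nodeOutput p N C ζ x = nodeOutput p N C ζ' x := by
  refine Prod.ext (Finset.ext fun x' => ?_) ?_
  · simp only [nodeOutput, Finset.mem_filter, Finset.mem_univ, true_and]
    exact launched_congr hN x h _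
  · exact decide_eq_decide.2 (launched_congr hN x h _)

theorem blockOutput_congr {p : DaryVertex d} {N : ℕ} (hN : p.level < N)
    (C : Set (ℕ → DaryVertex d)) (o : Option (Fin d)) (ζ ζ' : FrogConfig d)
    (h : ∀ v ∈ blockVertices p o, ζ v = ζ' v) :
    blockOutput p N C o ζ = blockOutput p N C o ζ' := by
  funext x
  unfold blockOutput
  split_ifs with hx
  · exact nodeOutput_congr hN C x (hx ▸ h)
  · rfl

theorem measurableSet_nodeOutput {p : DaryVertex d} {N : ℕ} (hN : p.level < N)
    {C : Set (ℕ → DaryVertex d)} (hC : MeasurableSet C) (x : Option (leaves p N))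
    (e : Finset (Option (leaves p N)) × Bool) :
    MeasurableSet {ζ : FrogConfig d | nodeOutput p N C ζ x = e} := by
  have : {ζ : FrogConfig d | nodeOutput p N C ζ x = e} =
      (⋂ x', {ζ | (∃ q ∈ launched p N ζ x, q ∈ exitNode p N x') ↔ x' ∈ e.1}) ∩
        {ζ | (∃ q ∈ launched p N ζ x, q ∈ visitThen p.parent C) ↔ e.2 = true} := by
    ext ζ
    simp only [Set.mem_ofPred_eq, Set.mem_inter_iff, Set.mem_iInter, nodeOutput, Prod.ext_iff,
      Finset.ext_iff, Finset.mem_filter, Finset.mem_univ, true_and]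
    refine and_congr Iff.rfl ?_
    cases e.2 <;> simp
  rw [this]
  refine MeasurableSet.inter (MeasurableSet.iInter fun x' => ?_) ?_
  · exact (measurableSet_exists_launched hN x (measurableSet_exitNode p N x')).iff
      (MeasurableSet.const _)
  · exact (measurableSet_exists_launched hN x (measurableSet_visitThen _ hC)).iff
      (MeasurableSet.const _)

theorem measurableSet_blockOutput {p : DaryVertex d} {N : ℕ} (hN : p.level < N)
    {C : Set (ℕ → DaryVertex d)} (hC : MeasurableSet C) (o : Option (Fin d))
    (y : Option (leaves p N) → Finset (Option (leaves p N)) × Bool) :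
    MeasurableSet {ζ : FrogConfig d | blockOutput p N C o ζ = y} := by
  have : {ζ : FrogConfig d | blockOutput p N C o ζ = y} =
      ⋂ x, {ζ | blockOutput p N C o ζ x = y x} := by
    ext ζ
    simp [funext_iff]
  rw [this]
  refine MeasurableSet.iInter fun x => ?_
  unfold blockOutput
  split_ifs
  · exact measurableSet_nodeOutput hN hC x _
  · exact MeasurableSet.const _

/-- If no frog visits the parent of `p` and then follows a path of `C`, then the mark is not
reached by the nodes. -/
theorem markUnreached_of_not_someFrog {p : DaryVertex d} {N : ℕ}
    {C : Set (ℕ → DaryVertex d)} {ζ : FrogConfig d} (y : leaves p N)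
    (h : ¬ SomeFrog p y (visitThen p.parent C) ζ) :
    MarkUnreached {none, some y} (fun x => nodeOutput p N C ζ x) := by
  classical
  let vert : Option (leaves p N) → DaryVertex d := fun x => x.elim p fun z => z
  -- every launched path belongs to a frog that wakes up
  have key : ∀ x, Relation.ReflTransGen (Wakes p ζ) y (vert x) → ∀ q ∈ launched p N ζ x,
      ∃ v, Relation.ReflTransGen (Wakes p ζ) y v ∧ ∃ i < (ζ v).1, ∃ k,
        q = pathShift k ((ζ v).2 i) := by
    rintro (_ | z) hx q hq
    · obtain ⟨i, hi, rfl⟩ := hq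
      refine ⟨p, hx, i, hi, 0, ?_⟩
      funext j
      simp [pathShift]
    · obtain ⟨a, -, v, hv, i, hi, k, -, rfl⟩ := hq
      exact ⟨v, hx.trans (Relation.ReflTransGen.mono
        (fun _ _ => Wakes.mono (isAncestor_child p a)) _ _ hv), i, hi, k, rfl⟩
  -- The witness is the set of nodes whose vertex is woken from `y`; the node `none` belongs to it
  -- because `p` is an ancestor of `y`.
  refine ⟨Finset.univ.filter fun x => Relation.ReflTransGen (Wakes p ζ) y (vert x), ?_, ?_⟩
  · intro x hx
    simp only [Finset.mem_insert, Finset.mem_singleton] at hx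
    simp only [Finset.mem_filter, Finset.mem_univ, true_and]
    rcases hx with rfl | rfl
    · exact .single ⟨.refl p, Or.inl y.2.1⟩
    · exact .refl
  · intro x hx
    simp only [Finset.mem_filter, Finset.mem_univ, true_and] at hx
    refine ⟨fun x' hx' => ?_, ?_⟩
    · simp only [nodeOutput, Finset.mem_filter, Finset.mem_univ, true_and] at hx' ⊢
      obtain ⟨q, hq, hq'⟩ := hx'
      cases x' with
      | none => exact absurd hq' (Set.notMem_empty q)
      | some z' =>
        obtain ⟨v, hv, i, hi, k, rfl⟩ := key x hx q hq
        obtain ⟨j, hj, -⟩ := hq'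
        exact hv.tail ⟨z'.2.1, Or.inr ⟨i, hi, k + j, by
          change IsAncestor z'.1 (pathShift k ((ζ v).2 i) j)
          rw [hj]
          exact .refl _⟩⟩
    · simp only [nodeOutput, decide_eq_false_iff_not]
      rintro ⟨q, hq, j, hj, hjC⟩
      obtain ⟨v, hv, i, hi, k, rfl⟩ := key x hx q hq
      refine h ⟨v, hv, i, hi, k + j, hj, ?_⟩
      convert hjC using 1
      funext m
      simp [pathShift, add_assoc]

end Nodes

/-! ### Exit probabilities normalized by branch -/

section Weights

variable {d : ℕ}

/-- The constant `(d - 1) / (2 d ^ 2)`. -/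
noncomputable def branchWeight (d : ℕ) : ℝ := ((d : ℝ) - 1) / (2 * d ^ 2)

theorem branchWeight_pos (hd : 2 ≤ d) : 0 < branchWeight d := by
  have : (2 : ℝ) ≤ d := by exact_mod_cast hd
  exact div_pos (by linarith) (by positivity)

variable {Q : DaryVertex d → Measure (ℕ → DaryVertex d)}

open Classical in
/-- The total exit probability through the leaves of a block. -/
noncomputable def branchExit (Q : DaryVertex d → Measure (ℕ → DaryVertex d)) (p : DaryVertex d)
    (N : ℕ) (o : Option (Fin d)) : ℝ :=
  ∑ x with nodeBlock p N x = o, (Q p).real (exitNode p N x)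

/-- The weight of a node: its exit probability, normalized so that every branch has the same total
weight. -/
noncomputable def nodeWeight (Q : DaryVertex d → Measure (ℕ → DaryVertex d)) (p : DaryVertex d)
    (N : ℕ) (x : Option (leaves p N)) : ℝ :=
  branchWeight d / branchExit Q p N (nodeBlock p N x) * (Q p).real (exitNode p N x)

theorem pairwise_disjoint_exitNode (p : DaryVertex d) (N : ℕ) :
    Pairwise (Function.onFun Disjoint (exitNode p N)) := by
  rintro (_ | z) (_ | z') h
  · exact absurd rfl h
  · exact Set.empty_disjoint _
  · exact Set.disjoint_empty _
  · exact disjoint_exitAt (notMem_subtreeBelow z.2) (notMem_subtreeBelow z'.2)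
      fun e => h (congrArg some (Subtype.ext e))

theorem measureReal_biUnion_exitNode (hQ : IsWalkLaw (daryTree d) Q) (p : DaryVertex d) (N : ℕ)
    (K : Finset (Option (leaves p N))) :
    (Q p).real (⋃ x ∈ K, exitNode p N x) = ∑ x ∈ K, (Q p).real (exitNode p N x) := by
  have := hQ.prob p
  exact measureReal_biUnion_finset (fun x _ y _ h => pairwise_disjoint_exitNode p N h)
    fun x _ => measurableSet_exitNode p N x

theorem le_branchExit (hd : 2 ≤ d) (hQ : IsWalkLaw (daryTree d) Q) {p : DaryVertex d}
    (hp : p ≠ root d) {N : ℕ} (hN : p.level < N) (a : Fin d) :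
    ((d : ℝ) - 1) / (d * (d + 1)) ≤ branchExit Q p N (some a) := by
  classical
  have := hQ.prob p
  refine (le_exit_branch hd hQ p hp N hN a).trans ?_
  rw [branchExit, ← measureReal_biUnion_exitNode hQ]
  refine measureReal_mono ?_ (measure_ne_top _ _)
  simp only [Set.iUnion_subset_iff]
  intro z hz x hx
  have hz' : z ∈ leaves p N := ⟨(isAncestor_child p a).trans hz.1, hz.2⟩
  simp only [Set.mem_iUnion, Finset.mem_filter, Finset.mem_univ, true_and]
  exact ⟨some ⟨z, hz'⟩, branch_eq_some.2 hz.1, hx⟩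

/-- This equation determines the constant `b`: a branch exit probability of `(d - 1) / (d * (d +
1))`, discounted by `1 - σ` at the cap `σ = d * b`, must still be worth `b`. -/
theorem branchWeight_eq (hd : 2 ≤ d) :
    branchWeight d = (1 - d * branchWeight d) * (((d : ℝ) - 1) / (d * (d + 1))) := by
  have : (2 : ℝ) ≤ d := by exact_mod_cast hd
  unfold branchWeight
  field_simp
  ring

theorem branchWeight_mul_lt (hd : 2 ≤ d) : d * branchWeight d < 1 := by
  have : (2 : ℝ) ≤ d := by exact_mod_cast hd
  unfold branchWeight
  rw [mul_div_assoc', div_lt_one (by positivity)]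
  nlinarith

theorem nodeWeight_none (p : DaryVertex d) (N : ℕ) : nodeWeight Q p N none = 0 := by
  simp [nodeWeight, exitNode]

theorem branchExit_nonneg (p : DaryVertex d) (N : ℕ) (o : Option (Fin d)) :
    0 ≤ branchExit Q p N o := Finset.sum_nonneg fun _ _ => measureReal_nonneg

theorem nodeWeight_nonneg (hd : 2 ≤ d) (p : DaryVertex d) (N : ℕ) (x : Option (leaves p N)) :
    0 ≤ nodeWeight Q p N x :=
  mul_nonneg (div_nonneg (branchWeight_pos hd).le (branchExit_nonneg p N _)) measureReal_nonneg

theorem nodeWeight_le (hd : 2 ≤ d) (hQ : IsWalkLaw (daryTree d) Q) {p : DaryVertex d}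
    (hp : p ≠ root d) {N : ℕ} (hN : p.level < N) (x : Option (leaves p N)) :
    nodeWeight Q p N x ≤ (1 - d * branchWeight d) * (Q p).real (exitNode p N x) := by
  have hd' : (2 : ℝ) ≤ d := by exact_mod_cast hd
  have h1 := branchWeight_mul_lt hd
  cases x with
  | none => simp [nodeWeight, exitNode]
  | some z =>
    obtain ⟨a, ha⟩ := exists_branch hN z.2
    refine mul_le_mul_of_nonneg_right ?_ measureReal_nonneg
    rw [show nodeBlock p N (some z) = some a from ha]
    have hβ := le_branchExit hd hQ hp hN a
    have hpos : 0 < ((d : ℝ) - 1) / (d * (d + 1)) := div_pos (by linarith) (by positivity)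
    rw [div_le_iff₀ (hpos.trans_le hβ)]
    calc branchWeight d = (1 - d * branchWeight d) * (((d : ℝ) - 1) / (d * (d + 1))) :=
          branchWeight_eq hd
      _ ≤ _ := by gcongr

open Classical in
theorem sum_nodeWeight (hd : 2 ≤ d) (hQ : IsWalkLaw (daryTree d) Q) {p : DaryVertex d}
    (hp : p ≠ root d) {N : ℕ} (hN : p.level < N) (a : Fin d) :
    ∑ x with nodeBlock p N x = some a, nodeWeight Q p N x = branchWeight d := by
  have hd' : (2 : ℝ) ≤ d := by exact_mod_cast hd
  have hpos : 0 < ((d : ℝ) - 1) / (d * (d + 1)) := div_pos (by linarith) (by positivity)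
  have hb : branchExit Q p N (some a) ≠ 0 := (hpos.trans_le (le_branchExit hd hQ hp hN a)).ne'
  have : ∀ x ∈ Finset.univ.filter (fun x => nodeBlock p N x = some a), nodeWeight Q p N x =
      branchWeight d / branchExit Q p N (some a) * (Q p).real (exitNode p N x) := by
    intro x hx
    simp only [Finset.mem_filter, Finset.mem_univ, true_and] at hx
    rw [nodeWeight, hx]
  rw [Finset.sum_congr rfl this, ← Finset.mul_sum]
  exact div_mul_cancel₀ _ hb

open Classical in
/-- The total weight of the nodes outside of a branch. -/
theorem sum_nodeWeight_ne (hd : 2 ≤ d) (hQ : IsWalkLaw (daryTree d) Q) {p : DaryVertex d}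
    (hp : p ≠ root d) {N : ℕ} (hN : p.level < N) (a : Fin d) :
    ∑ x with nodeBlock p N x ≠ some a, nodeWeight Q p N x = (d - 1) * branchWeight d := by
  have htot : ∑ x, nodeWeight Q p N x = d * branchWeight d := by
    rw [← Finset.sum_fiberwise Finset.univ (nodeBlock p N), Fintype.sum_option,
      Finset.sum_congr rfl fun a _ => sum_nodeWeight hd hQ hp hN a]
    have : ∑ x with nodeBlock p N x = none, nodeWeight Q p N x = 0 := by
      refine Finset.sum_eq_zero fun x hx => ?_
      simp only [Finset.mem_filter, Finset.mem_univ, true_and] at hx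
      cases x with
      | none => exact nodeWeight_none p N
      | some z =>
        obtain ⟨b, hb⟩ := exists_branch hN z.2
        exact absurd (hx.symm.trans hb) (Option.some_ne_none b).symm
    rw [this]
    simp
  have h := Finset.sum_filter_add_sum_filter_not Finset.univ
    (fun x => nodeBlock p N x = some a) (nodeWeight Q p N)
  rw [sum_nodeWeight hd hQ hp hN a, htot] at h
  linarith

/-- A walk from `p` exits through a set of nodes, or visits the parent of `p` and then follows a
path of `C`. -/
theorem le_exitNodes_or_visitThen (hd : 2 ≤ d) (hQ : IsWalkLaw (daryTree d) Q) {p : DaryVertex d}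
    (hp : p ≠ root d) {N : ℕ} (hN : p.level < N) (K : Finset (Option (leaves p N)))
    {C : Set (ℕ → DaryVertex d)} (hC : MeasurableSet C) :
    min ((Q p.parent).real C) (d * branchWeight d) / d + ∑ x ∈ K, nodeWeight Q p N x ≤
      (Q p).real ((⋃ x ∈ K, exitNode p N x) ∪ visitThen p.parent C) := by
  have hb := branchWeight_pos hd
  -- Capping `σ` at `d * b` keeps the discount `1 - σ` at least `1 - d * b`, the factor absorbed by
  -- the node weights.
  have h := le_exit_or_visitThen hd hQ p hp N {z | ∃ h : z ∈ leaves p N, some ⟨z, h⟩ ∈ K} hC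
    (σ := min ((Q p.parent).real C) (d * branchWeight d))
    (le_min measureReal_nonneg (by positivity)) (min_le_left _ _)
  have e : ⋃ z ∈ {z | ∃ h : z ∈ leaves p N, some ⟨z, h⟩ ∈ K}, exitAt (subtreeBelow p N) z =
      ⋃ x ∈ K, exitNode p N x := by
    ext q
    simp only [Set.mem_iUnion, Set.mem_ofPred_eq, exists_prop]
    constructor
    · rintro ⟨z, ⟨hz, hK⟩, hq⟩
      exact ⟨some ⟨z, hz⟩, hK, hq⟩
    · rintro ⟨_ | z, hK, hq⟩
      · exact absurd hq (Set.notMem_empty q)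
      · exact ⟨z, ⟨z.2, hK⟩, hq⟩
  rw [e] at h
  refine le_trans ?_ h
  rw [measureReal_biUnion_exitNode hQ, add_comm, Finset.mul_sum]
  gcongr with x hx
  refine (nodeWeight_le hd hQ hp hN x).trans ?_
  gcongr
  exact min_le_right _ _

end Weights

/-! ### The exponential bound, by induction on levels -/

section Induction

variable {d : ℕ} {Ω : Type*} [MeasurableSpace Ω] {P : Measure Ω}
  {η : Ω → DaryVertex d → ℕ} {S : Ω → DaryVertex d → ℕ → ℕ → DaryVertex d}
  [IsProbabilityMeasure P] {μ : ℝ≥0}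

theorem sum_measureReal_eq {Y : Type*} [Fintype Y] {G : Ω → Y}
    (hG : ∀ y, MeasurableSet {ω | G ω = y}) (F : Y → Prop) [DecidablePred F] :
    ∑ y with F y, P.real {ω | G ω = y} = P.real {ω | F (G ω)} := by
  rw [← measureReal_biUnion_finset]
  · congr 1
    ext ω
    simp
  · intro x _ y _ h
    exact Set.disjoint_left.2 fun ω hx hy => h (hx.symm.trans hy)
  · exact fun y _ => hG y

open Classical in
/-- The probability that the mark is not reached, when the blocks are independent. -/
theorem measureReal_markUnreached_le {X ι : Type*} [Fintype X] [Fintype ι]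
    (S0 : Finset X) (π : X → ι) {G : ι → Ω → X → Finset X × Bool}
    (hG : ∀ i y, MeasurableSet {ω | G i ω = y})
    (hind : ∀ Φ : ι → X → Finset X × Bool,
      P (⋂ i, {ω | G i ω = Φ i}) = ∏ i, P {ω | G i ω = Φ i})
    {c : ι → X → ℝ} (hc : ∀ i x, 0 ≤ c i x) {r : ι → ℝ} (hr : ∀ i, 0 ≤ r i)
    {σ s : ℝ} (hσ : 0 ≤ σ) (hs : 0 < s) (hσs : σ ≤ s)
    (h : ∀ x, ∀ K : Finset X,
      P.real {ω | Disjoint (G (π x) ω x).1 K ∧ (G (π x) ω x).2 = false} ≤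
        Real.exp (-(σ * r (π x) + ∑ z ∈ K, c (π x) z))) :
    P.real {ω | MarkUnreached S0 fun x => G (π x) ω x} ≤
      (∑ R : Finset ι with S0.image π ⊆ R,
        Real.exp (-∑ i ∈ R, (s * r i + ∑ x with π x ∉ R, c i x))) ^ (σ / s) := by
  rw [measureReal_eq_sum_prod hG hind fun Φ => MarkUnreached S0 fun x => Φ (π x) x]
  have hw : ∀ i, ∑ y, P.real {ω | G i ω = y} ≤ 1 := fun o => by
    have := sum_measureReal_eq (P := P) (hG o) fun _ => True
    simp only [Finset.filter_true] at this
    rw [this]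
    exact measureReal_le_one
  have h' : ∀ x, ∀ K : Finset X,
      ∑ y with Disjoint (y x).1 K ∧ (y x).2 = false, P.real {ω | G (π x) ω = y} ≤
        Real.exp (-(σ * r (π x) + ∑ z ∈ K, c (π x) z)) := fun x K => by
    rw [sum_measureReal_eq (hG _) fun y => Disjoint (y x).1 K ∧ (y x).2 = false]
    exact h x K
  have key := sum_markUnreached_le_rpow S0 π (w := fun o y => P.real {ω | G o ω = y})
    (fun o y => measureReal_nonneg) hw hc hr hσ hs hσs h'
  exact key

open Classical in
theorem output_avoid_subset (p : DaryVertex d) (N : ℕ) (C : Set (ℕ → DaryVertex d))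
    (ζ : FrogConfig d) (x : Option (leaves p N)) (K : Finset (Option (leaves p N)))
    (h : Disjoint (nodeOutput p N C ζ x).1 K ∧ (nodeOutput p N C ζ x).2 = false) :
    ¬ ∃ q ∈ launched p N ζ x, q ∈ (⋃ x' ∈ K, exitNode p N x') ∪ visitThen p.parent C := by
  rintro ⟨q, hq, hq' | hq'⟩
  · simp only [Set.mem_iUnion] at hq'
    obtain ⟨x', hx', hqx⟩ := hq'
    refine Finset.disjoint_left.1 h.1 ?_ hx'
    simp only [nodeOutput, Finset.mem_filter, Finset.mem_univ, true_and]
    exact ⟨q, hq, hqx⟩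
  · have h2 := h.2
    simp only [nodeOutput, decide_eq_false_iff_not] at h2
    exact h2 ⟨q, hq, hq'⟩

/-- The gain in the exponent from one level to the next. -/
noncomputable def levelGain (d : ℕ) (μ : ℝ) : ℝ :=
  -Real.log (Real.exp (-(μ * branchWeight d)) *
    (1 + Real.exp (-(μ * branchWeight d))) ^ (d - 1)) / (d * branchWeight d)

theorem levelGain_pos (hd : 2 ≤ d) {μ : ℝ} (hμ : 2 * ((d : ℝ) + 1) * Real.log d < μ) :
    0 < levelGain d μ := by
  have hb := branchWeight_pos hd
  refine div_pos (neg_pos.2 (Real.log_neg (by positivity) ?_)) (by positivity)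
  exact exp_mul_one_add_pow_lt_one hd hμ

variable (hm : IsPoissonFrogModel (daryTree d) (root d) μ P η S)
include hm

open Classical in
/-- The avoidance probabilities of the output of a node. -/
theorem nodeOutput_avoid_le (hd : 2 ≤ d) {p : DaryVertex d} (hp : p ≠ root d) {N : ℕ}
    (hN : p.level < N) {l : ℝ} (hl : 0 ≤ l)
    (ih : ∀ a, ∀ z ∈ leaves (p.child a) N, ∀ A, MeasurableSet A →
      P.real {ω | ¬ SomeFrog (p.child a) z (visitThen p A) (frogConfig η S ω)} ≤
        Real.exp (-(l * min ((walkLaw P S p).real A) (d * branchWeight d))))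
    {C : Set (ℕ → DaryVertex d)} (hC : MeasurableSet C) (x : Option (leaves p N))
    (K : Finset (Option (leaves p N))) :
    P.real {ω | Disjoint (nodeOutput p N C (frogConfig η S ω) x).1 K ∧
        (nodeOutput p N C (frogConfig η S ω) x).2 = false} ≤
      Real.exp (-(min ((walkLaw P S p.parent).real C) (d * branchWeight d) *
        ((nodeBlock p N x).elim (μ : ℝ) (fun _ => l) / d) + ∑ z ∈ K,
          if nodeBlock p N z = nodeBlock p N x ∧ nodeBlock p N x ≠ none then 0 else
            (nodeBlock p N x).elim (μ : ℝ) (fun _ => l) * nodeWeight (walkLaw P S) p N z)) := by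
  have hQ := hm.isWalkLaw
  have hprob := hQ.prob
  have hd' : (2 : ℝ) ≤ d := by exact_mod_cast hd
  have hb := branchWeight_pos hd
  set σ := min ((walkLaw P S p.parent).real C) (d * branchWeight d) with hσ
  have hσ1 : σ ≤ d * branchWeight d := min_le_right _ _
  set A := (⋃ x' ∈ K, exitNode p N x') ∪ visitThen p.parent C with hA
  have hAm : MeasurableSet A := (Finset.measurableSet_biUnion K fun x _ =>
    measurableSet_exitNode p N x).union (measurableSet_visitThen _ hC)
  have hle := le_exitNodes_or_visitThen hd hQ hp hN K hC
  rw [← hσ, ← hA] at hle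
  refine (measureReal_mono (fun ω h => output_avoid_subset p N C _ x K h)
    (measure_ne_top _ _)).trans ?_
  cases x with
  | none =>
    have hset : {ω | ¬ ∃ q ∈ launched p N (frogConfig η S ω) none, q ∈ A} =
        {ω | ∀ i < η ω p, S ω p i ∉ A} := by
      ext ω
      simp only [exists_launched_none, Set.mem_ofPred_eq, frogConfig]
      push Not
      rfl
    change P.real {ω | ¬ ∃ q ∈ launched p N (frogConfig η S ω) none, q ∈ A} ≤ _
    rw [hset, hm.avoid_at_vertex hp hAm, Real.exp_le_exp, neg_le_neg_iff]
    simp only [nodeBlock, Option.elim, ne_eq, not_true_eq_false, and_false, if_false]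
    rw [← Finset.mul_sum]
    calc σ * (μ / d) + μ * ∑ z ∈ K, nodeWeight (walkLaw P S) p N z =
          μ * (σ / d + ∑ z ∈ K, nodeWeight (walkLaw P S) p N z) := by ring
      _ ≤ _ := mul_le_mul_of_nonneg_left hle μ.2
  | some z =>
    obtain ⟨a, ha⟩ := exists_branch hN z.2
    have hblock : nodeBlock p N (some z) = some a := ha
    change P.real {ω | ¬ ∃ q ∈ launched p N (frogConfig η S ω) (some z), q ∈ A} ≤ _
    simp only [exists_launched_some ha, hblock, Option.elim, ne_eq, reduceCtorEq,
      not_false_eq_true, and_true]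
    -- The bound for the child is used with the event `A`: exit through `K`, or visit the parent and
    -- then follow `C`.
    refine (ih a z ⟨branch_eq_some.1 ha, z.2.2⟩ A hAm).trans ?_
    rw [Real.exp_le_exp, neg_le_neg_iff]
    have hsum : ∑ x ∈ K, (if nodeBlock p N x = some a then 0 else
        l * nodeWeight (walkLaw P S) p N x) =
        l * ∑ x ∈ K with nodeBlock p N x ≠ some a, nodeWeight (walkLaw P S) p N x := by
      rw [Finset.sum_filter, Finset.mul_sum]
      refine Finset.sum_congr rfl fun x _ => ?_
      by_cases hx : nodeBlock p N x = some a <;> simp [hx]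
    rw [hsum]
    -- Nodes of the branch itself are given up. The rest then fits under the cap: `σ / d ≤ b`, and
    -- the other `d - 1` branches weigh at most `(d - 1) * b`, in total `d * b`.
    have h1 : ∑ x ∈ K with nodeBlock p N x ≠ some a, nodeWeight (walkLaw P S) p N x ≤
        ∑ x ∈ K, nodeWeight (walkLaw P S) p N x :=
      Finset.sum_le_sum_of_subset_of_nonneg (Finset.filter_subset _ _)
        fun x _ _ => nodeWeight_nonneg hd p N x
    have h2 : ∑ x ∈ K with nodeBlock p N x ≠ some a, nodeWeight (walkLaw P S) p N x ≤
        (d - 1) * branchWeight d := by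
      rw [← sum_nodeWeight_ne hd hQ hp hN a]
      exact Finset.sum_le_sum_of_subset_of_nonneg
        (Finset.filter_subset_filter _ (Finset.subset_univ _))
        fun x _ _ => nodeWeight_nonneg hd p N x
    have h3 : σ / d ≤ branchWeight d := by
      rw [div_le_iff₀ (by positivity), mul_comm]
      exact hσ1
    calc σ * (l / d) + l * ∑ x ∈ K with nodeBlock p N x ≠ some a,
          nodeWeight (walkLaw P S) p N x = l * (σ / d + ∑ x ∈ K with nodeBlock p N x ≠ some a,
          nodeWeight (walkLaw P S) p N x) := by ring
      _ ≤ _ := by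
        refine mul_le_mul_of_nonneg_left (le_min ?_ ?_) hl
        · linarith
        · linarith

/-- The rate increases from `l` to `l + levelGain d μ`: the union bound gives `exp (-(l + levelGain
d μ) * s)` for `s = d * b`, and the power `σ / s` turns `s` into `σ`. -/
theorem avoid_step (hd : 2 ≤ d) {p : DaryVertex d} (hp : p ≠ root d) {N : ℕ}
    (hN : p.level < N) {l : ℝ} (hl : 0 ≤ l)
    (ih : ∀ a, ∀ z ∈ leaves (p.child a) N, ∀ A, MeasurableSet A →
      P.real {ω | ¬ SomeFrog (p.child a) z (visitThen p A) (frogConfig η S ω)} ≤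
        Real.exp (-(l * min ((walkLaw P S p).real A) (d * branchWeight d))))
    {y : DaryVertex d} (hy : y ∈ leaves p N) {C : Set (ℕ → DaryVertex d)}
    (hC : MeasurableSet C) :
    P.real {ω | ¬ SomeFrog p y (visitThen p.parent C) (frogConfig η S ω)} ≤
      Real.exp (-((l + levelGain d μ) *
        min ((walkLaw P S p.parent).real C) (d * branchWeight d))) := by
  classical
  have hQ := hm.isWalkLaw
  have hb := branchWeight_pos hd
  have hd' : (2 : ℝ) ≤ d := by exact_mod_cast hd
  have hs : 0 < d * branchWeight d := by positivity
  set σ := min ((walkLaw P S p.parent).real C) (d * branchWeight d) with hσ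
  have hσ0 : 0 ≤ σ := le_min measureReal_nonneg hs.le
  let G : Option (Fin d) → Ω → Option (leaves p N) → Finset (Option (leaves p N)) × Bool :=
    fun o ω => blockOutput p N C o (frogConfig η S ω)
  have hG : ∀ o y, MeasurableSet {ω | G o ω = y} := fun o y =>
    hm.measurable_frogConfig (measurableSet_blockOutput hN hC o y)
  have hind : ∀ Φ : Option (Fin d) → Option (leaves p N) → Finset (Option (leaves p N)) × Bool,
      P (⋂ o, {ω | G o ω = Φ o}) = ∏ o, P {ω | G o ω = Φ o} := fun Φ =>
    hm.indep_blocks (pairwise_disjoint_blockVertices p) (measurableSet_blockOutput hN hC)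
      (blockOutput_congr hN C) Φ
  let S0 : Finset (Option (leaves p N)) := {none, some ⟨y, hy⟩}
  have h1 : P.real {ω | ¬ SomeFrog p y (visitThen p.parent C) (frogConfig η S ω)} ≤
      P.real {ω | MarkUnreached S0 fun x => G (nodeBlock p N x) ω x} := by
    refine measureReal_mono (fun ω h => ?_) (measure_ne_top _ _)
    have := markUnreached_of_not_someFrog ⟨y, hy⟩ h
    simpa [G, blockOutput, S0] using this
  refine h1.trans ?_
  let c : Option (Fin d) → Option (leaves p N) → ℝ := fun o z =>
    if nodeBlock p N z = o ∧ o ≠ none then 0 else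
      o.elim (μ : ℝ) (fun _ => l) * nodeWeight (walkLaw P S) p N z
  let r : Option (Fin d) → ℝ := fun o => o.elim (μ : ℝ) (fun _ => l) / d
  have helim : ∀ o : Option (Fin d), 0 ≤ o.elim (μ : ℝ) (fun _ => l) := by
    rintro (_ | a)
    exacts [μ.2, hl]
  have h2 := measureReal_markUnreached_le S0 (nodeBlock p N) hG hind
    (c := c) (fun o z => by
      simp only [c]
      split_ifs
      exacts [le_rfl, mul_nonneg (helim o) (nodeWeight_nonneg hd p N z)])
    (r := r) (fun o => div_nonneg (helim o) (by positivity))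
    hσ0 hs (min_le_right _ _)
    (fun x K => by
      simp only [G, blockOutput, if_true]
      exact nodeOutput_avoid_le hm hd hp hN hl ih hC x K)
  refine h2.trans ?_
  obtain ⟨a0, ha0⟩ := exists_branch hN hy
  have h3 := sum_blocks_le S0 (nodeBlock p N) a0
    (Finset.mem_image.2 ⟨none, by simp [S0], rfl⟩)
    (Finset.mem_image.2 ⟨some ⟨y, hy⟩, by simp [S0], ha0⟩)
    (μ := μ) hb.le hl (nodeWeight (walkLaw P S) p N) (sum_nodeWeight hd hQ hp hN)
    (c := c) (r := r) (fun z => by simp [c]) (fun a z hz => by simp [c, hz]) rfl (fun a => rfl)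
  have h5 := Real.rpow_le_rpow (Finset.sum_nonneg fun _ _ => (Real.exp_pos _).le) h3
    (show 0 ≤ σ / (d * branchWeight d) by positivity)
  refine (le_of_eq ?_).trans (h5.trans (le_of_eq ?_))
  · congr!
  have h4 : Real.exp (-(μ * branchWeight d)) * (1 + Real.exp (-(μ * branchWeight d))) ^ (d - 1) =
      Real.exp (-(levelGain d μ * (d * branchWeight d))) := by
    rw [levelGain, div_mul_cancel₀ _ hs.ne', neg_neg, Real.exp_log (by positivity)]
  rw [h4, ← Real.exp_add, ← Real.exp_mul]
  congr 1
  field_simp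
  ring

/-- Exponential decay of the probability that no frog returns and then follows a path of `C`. -/
theorem avoid_le (hd : 2 ≤ d) (hμ : 2 * ((d : ℝ) + 1) * Real.log d < μ) (N n : ℕ)
    (w : DaryVertex d) (hw : w ≠ root d) (hwN : w.level + n = N) {z : DaryVertex d}
    (hz : z ∈ leaves w N) {C : Set (ℕ → DaryVertex d)} (hC : MeasurableSet C) :
    P.real {ω | ¬ SomeFrog w z (visitThen w.parent C) (frogConfig η S ω)} ≤
      Real.exp (-((n * levelGain d μ) *
        min ((walkLaw P S w.parent).real C) (d * branchWeight d))) := by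
  have hg := levelGain_pos hd hμ
  induction n generalizing w z C with
  | zero => simp
  | succ n ih =>
    have h := avoid_step hm hd hw (N := N) (by omega) (l := n * levelGain d μ) (by positivity)
      (fun a z hz A hA => ih (w.child a) (child_ne_root w a) (by rw [level_child]; omega) hz hA)
      hz hC
    convert h using 4
    push_cast
    ring

end Induction

/-! ### The deterministic evolution -/

section WakeState

variable {V : Type*} {o : V} {η : V → ℕ} {S : V → ℕ → ℕ → V}

theorem wakeState_succ_of_some {t s : ℕ} {v : V} (h : wakeState o η S t v = some s) :
    wakeState o η S (t + 1) v = some s := by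
  simp [wakeState, h]

theorem wakeState_mono {t t' s : ℕ} {v : V} (htt : t ≤ t') (h : wakeState o η S t v = some s) :
    wakeState o η S t' v = some s := by
  induction t', htt using Nat.le_induction with
  | base => exact h
  | succ n _ ih => exact wakeState_succ_of_some ih

theorem wakeState_succ_cases {t s : ℕ} {v : V} (h : wakeState o η S (t + 1) v = some s) :
    wakeState o η S t v = some s ∨ (s = t + 1 ∧
      ∃ u s' i, wakeState o η S t u = some s' ∧ i < η u ∧ S u i (t + 1 - s') = v) := by
  rw [wakeState] at h
  split at h
  · exact Or.inl (by simp_all)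
  · split_ifs at h with h'
    exact Or.inr ⟨(Option.some.inj h).symm, h'⟩

theorem wakeState_self {t s : ℕ} {v : V} (h : wakeState o η S t v = some s) :
    s ≤ t ∧ wakeState o η S s v = some s := by
  induction t with
  | zero =>
    have : s = 0 := by
      rw [wakeState] at h
      split_ifs at h
      exact (Option.some.inj h).symm
    subst this
    exact ⟨le_rfl, h⟩
  | succ t ih =>
    rcases wakeState_succ_cases h with h' | ⟨rfl, -⟩
    · exact ⟨(ih h').1.trans t.le_succ, (ih h').2⟩
    · exact ⟨le_rfl, h⟩

/-- The frogs of `v` wake up at some time. -/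
def IsWoken (o : V) (η : V → ℕ) (S : V → ℕ → ℕ → V) (v : V) : Prop :=
  ∃ t s, wakeState o η S t v = some s

theorem isWoken_origin : IsWoken o η S o := ⟨0, 0, by simp [wakeState]⟩

/-- The vertices visited by a woken frog are woken. -/
theorem IsWoken.visit (h0 : ∀ v i, S v i 0 = v) {u : V} (hu : IsWoken o η S u) {i : ℕ}
    (hi : i < η u) (k : ℕ) : IsWoken o η S (S u i k) := by
  cases k with
  | zero => rwa [h0]
  | succ k =>
    obtain ⟨t, s, h⟩ := hu
    have hs : wakeState o η S (s + k) u = some s :=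
      wakeState_mono (Nat.le_add_right s k) (wakeState_self h).2
    cases hv : wakeState o η S (s + k) (S u i (k + 1)) with
    | some s' => exact ⟨_, s', hv⟩
    | none =>
      refine ⟨s + k + 1, s + k + 1, ?_⟩
      rw [wakeState, hv]
      refine if_pos ⟨u, s, i, hs, hi, ?_⟩
      congr 1
      omega

theorem finite_wakeState (o : V) (η : V → ℕ) (S : V → ℕ → ℕ → V) (t : ℕ) :
    {v | ∃ s, wakeState o η S t v = some s}.Finite := by
  induction t with
  | zero =>
    refine (Set.finite_singleton o).subset ?_
    rintro v ⟨s, h⟩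
    rw [wakeState] at h
    split_ifs at h with hv
    exact hv
  | succ t ih =>
    refine (ih.union (ih.biUnion (t := fun u => ⋃ i ∈ Set.Iio (η u), ⋃ k ∈ Set.Iic (t + 1),
      {S u i k}) fun u _ => (Set.finite_Iio _).biUnion fun i _ =>
        (Set.finite_Iic _).biUnion fun k _ => Set.finite_singleton _)).subset ?_
    rintro v ⟨s, h⟩
    rcases wakeState_succ_cases h with h' | ⟨-, u, s', i, hu, hi, hv⟩
    · exact Or.inl ⟨s, h'⟩
    · refine Or.inr ?_
      simp only [Set.mem_iUnion]
      exact ⟨u, ⟨s', hu⟩, i, hi, t + 1 - s', by simp, hv.symm⟩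

/-- In a realization which is not recurrent, woken frogs visit the root finitely many times. -/
theorem finite_visits_of_not_isRecurrent (h : ¬ IsRecurrent o η S) :
    {q : V × ℕ × ℕ | IsWoken o η S q.1 ∧ q.2.1 < η q.1 ∧ S q.1 q.2.1 q.2.2 = o}.Finite := by
  simp only [IsRecurrent, not_frequently, eventually_atTop] at h
  obtain ⟨T, hT⟩ := h
  -- A frog woken at time `s` and at `o` after `k` steps occupies `o` at time `s + k`. This is less
  -- than `T`, which leaves finitely many vertices, frogs and steps.
  refine ((finite_wakeState o η S T).biUnion (t := fun v => ⋃ i ∈ Set.Iio (η v),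
    ⋃ k ∈ Set.Iio T, {(v, i, k)}) fun u _ => (Set.finite_Iio _).biUnion fun i _ =>
      (Set.finite_Iio _).biUnion fun k _ => Set.finite_singleton _).subset ?_
  rintro ⟨v, i, k⟩ ⟨⟨t, s, hw⟩, hi, hk⟩
  dsimp only at hi hk hw
  have hs := (wakeState_self hw).2
  have hlt : s + k < T := by
    by_contra! hle
    refine hT (s + k) hle ⟨v, s, i, wakeState_mono (Nat.le_add_right s k) hs, hi, ?_⟩
    rw [Nat.add_sub_cancel_left]
    exact hk
  simp only [Set.mem_iUnion]
  exact ⟨v, ⟨s, wakeState_mono (by omega) hs⟩, i, hi, k, Set.mem_Iio.2 (by omega), rfl⟩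

end WakeState

/-! ### From chains of wakings to the evolution on the tree -/

section Woken

variable {d : ℕ} {η : DaryVertex d → ℕ} {S : DaryVertex d → ℕ → ℕ → DaryVertex d}

theorem isAncestor_of_adj {u v w : DaryVertex d} (h : (daryTree d).Adj u v)
    (hw : IsAncestor w v) : w = v ∨ IsAncestor w u := by
  rcases h with ⟨a, rfl⟩ | ⟨a, rfl⟩
  · exact isAncestor_child_iff.1 hw
  · exact Or.inr (hw.trans (isAncestor_child v a))

/-- The ancestors of woken vertices are woken. -/
theorem IsWoken.ancestor (h0 : ∀ v i, S v i 0 = v)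
    (hadj : ∀ v i k, (daryTree d).Adj (S v i k) (S v i (k + 1))) {v w : DaryVertex d}
    (hv : IsWoken (root d) η S v) (hw : IsAncestor w v) : IsWoken (root d) η S w := by
  obtain ⟨t, s, h⟩ := hv
  induction t generalizing v w s with
  | zero =>
    rw [wakeState] at h
    split_ifs at h with hr
    subst hr
    rw [show w = root d from List.suffix_nil.1 hw]
    exact isWoken_origin
  | succ t ih =>
    rcases wakeState_succ_cases h with h' | ⟨-, u, s', i, hu, hi, rfl⟩
    · exact ih hw _ h'
    · have key : ∀ k w, IsAncestor w (S u i k) → IsWoken (root d) η S w := by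
        intro k
        induction k with
        | zero =>
          intro w hw
          rw [h0] at hw
          exact ih hw _ hu
        | succ k ihk =>
          intro w hw
          rcases isAncestor_of_adj (hadj u i k) hw with rfl | hw'
          · exact IsWoken.visit h0 ⟨t, s', hu⟩ hi _
          · exact ihk w hw'
      exact key _ _ hw

theorem IsWoken.wakes (h0 : ∀ v i, S v i 0 = v)
    (hadj : ∀ v i k, (daryTree d).Adj (S v i k) (S v i (k + 1))) {z v w : DaryVertex d}
    (hz : IsWoken (root d) η S z)
    (h : Relation.ReflTransGen (Wakes w fun v => (η v, S v)) z v) : IsWoken (root d) η S v := by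
  induction h with
  | refl => exact hz
  | tail _ hbc ih =>
    rcases hbc.2 with h | ⟨i, hi, k, h⟩
    · exact ih.ancestor h0 hadj h
    · exact (ih.visit h0 hi k).ancestor h0 hadj h

end Woken

/-! ### Test events whose probabilities are positive but which each path eventually avoids -/

section Ray

variable {d : ℕ}

/-- The infinite ray from the root all of whose labels are `a`. -/
def ray (a : Fin d) : ℕ → DaryVertex d
  | 0 => root d
  | n + 1 => (ray a n).child a

/-- The paths that follow the ray at least up to level `r`, and then leave it. -/
def leavesRay (a : Fin d) (r : ℕ) : Set (ℕ → DaryVertex d) :=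
  {x | ∃ k ≥ r, (∀ j ≤ k, x j = ray a j) ∧ x (k + 1) ≠ ray a (k + 1)}

theorem measurableSet_leavesRay (a : Fin d) (r : ℕ) : MeasurableSet (leavesRay a r) := by
  have : leavesRay a r =
      ⋃ k, {x | k ≥ r ∧ (∀ j ≤ k, x j = ray a j) ∧ x (k + 1) ≠ ray a (k + 1)} := by
    ext x; simp [leavesRay]
  rw [this]
  refine MeasurableSet.iUnion fun k => DeterminedBy.measurableSet (n := k + 1) ?_
  rintro x x' h ⟨h1, h2, h3⟩
  exact ⟨h1, fun j hj => (h j (by omega)).symm.trans (h2 j hj),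
    fun h4 => h3 ((h (k + 1) le_rfl).trans h4)⟩

theorem eventually_notMem_leavesRay (a : Fin d) (x : ℕ → DaryVertex d) :
    ∀ᶠ r in atTop, x ∉ leavesRay a r := by
  by_cases h : ∃ k, x k ≠ ray a k
  · obtain ⟨k, hk⟩ := h
    filter_upwards [eventually_ge_atTop k] with r hr
    rintro ⟨l, hl, h1, -⟩
    exact hk (h1 k (hr.trans hl))
  · push Not at h
    refine Eventually.of_forall fun r hr => ?_
    obtain ⟨k, -, -, h3⟩ := hr
    exact h3 (h _)

theorem srwStep_child_ne_zero (v : DaryVertex d) (a : Fin d) :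
    srwStep (daryTree d) v (v.child a) ≠ 0 := by
  have : (daryTree d).Adj v (v.child a) := Or.inl ⟨a, rfl⟩
  rw [srwStep, if_pos this]
  exact ENNReal.inv_ne_zero.2 (ENNReal.natCast_ne_top _)

/-- One finite path suffices: follow the ray to level `r`, then step to a child with another label
`b`, available since `d ≥ 2`. -/
theorem leavesRay_pos (hd : 2 ≤ d) {Q : DaryVertex d → Measure (ℕ → DaryVertex d)}
    (hQ : IsWalkLaw (daryTree d) Q) (a : Fin d) (r : ℕ) :
    0 < (Q (root d)).real (leavesRay a r) := by
  have := hQ.prob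
  have : Nontrivial (Fin d) := Fin.nontrivial_iff_two_le.2 hd
  obtain ⟨b, hb⟩ := exists_ne a
  let y : ℕ → DaryVertex d := fun j => if j ≤ r then ray a j else (ray a r).child b
  have hsub : pathCylinder (r + 1) y ⊆ leavesRay a r := by
    intro x hx
    refine ⟨r, le_rfl, fun j hj => ?_, ?_⟩
    · rw [hx j (by omega)]
      exact if_pos hj
    · rw [hx (r + 1) le_rfl]
      simp only [y, if_neg (show ¬ r + 1 ≤ r by omega), ray]
      exact fun h => hb (child_injective _ h)
  rw [measureReal_def, ENNReal.toReal_pos_iff]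
  refine ⟨lt_of_lt_of_le ?_ (measure_mono hsub), measure_lt_top _ _⟩
  rw [hQ.cyl, if_pos (by simp [y, ray])]
  refine pos_iff_ne_zero.2 (Finset.prod_ne_zero_iff.2 fun k hk => ?_)
  have hk' : k < r + 1 := Finset.mem_range.1 hk
  simp only [y, if_pos (show k ≤ r by omega)]
  split_ifs with h
  · exact srwStep_child_ne_zero _ _
  · rw [show k = r by omega]
    exact srwStep_child_ne_zero _ _

end Ray

/-! ### From the exponential bound to recurrence -/

section Recurrence

variable {d : ℕ} {Ω : Type*} [MeasurableSpace Ω] {P : Measure Ω}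
  {η : Ω → DaryVertex d → ℕ} {S : Ω → DaryVertex d → ℕ → ℕ → DaryVertex d}
  [IsProbabilityMeasure P] {μ : ℝ≥0}
  (hm : IsPoissonFrogModel (daryTree d) (root d) μ P η S)
include hm

theorem ae_walks : ∀ᵐ ω ∂P, (∀ v i, S ω v i 0 = v) ∧
    ∀ v i k, (daryTree d).Adj (S ω v i k) (S ω v i (k + 1)) := by
  have h : ∀ v i, ∀ᵐ ω ∂P, S ω v i 0 = v ∧
      ∀ k, (daryTree d).Adj (S ω v i k) (S ω v i (k + 1)) := by
    intro v i
    have := (hm.isWalkLaw.ae_start v).and (hm.isWalkLaw.ae_adj v)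
    rw [← hm.map_walk v i] at this
    exact ae_of_ae_map (hm.walk_law v i).measurable.aemeasurable this
  filter_upwards [ae_all_iff.2 fun v => ae_all_iff.2 (h v)] with ω hω
  exact ⟨fun v i => (hω v i).1, fun v i => (hω v i).2⟩

/-- The exit of the initial frog is independent of the frogs of the subtree it exits from. -/
theorem measure_exit_inter (w z : DaryVertex d) (hw : w ≠ root d) (hz : IsAncestor w z)
    {A C : Set (ℕ → DaryVertex d)} (hA : MeasurableSet A) (hC : MeasurableSet C) :
    P ({ω | S ω (root d) 0 ∈ A} ∩ {ω | ¬ SomeFrog w z C (frogConfig η S ω)}) =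
      P {ω | S ω (root d) 0 ∈ A} * P {ω | ¬ SomeFrog w z C (frogConfig η S ω)} := by
  let B : Bool → Set (DaryVertex d) := fun b => bif b then {root d} else {v | IsAncestor w v}
  let G : Bool → FrogConfig d → Prop := fun b ζ =>
    bif b then (ζ (root d)).2 0 ∈ A else ¬ SomeFrog w z C ζ
  have hr : ∀ v, IsAncestor w v → v ≠ root d := by
    rintro v hv rfl
    exact hw (List.suffix_nil.1 hv)
  have hB : Pairwise (Function.onFun Disjoint B) := by
    have h1 : Disjoint {root d} {v | IsAncestor w v} :=
      Set.disjoint_singleton_left.2 fun h => hr _ h rfl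
    rintro (_ | _) (_ | _) h
    exacts [absurd rfl h, h1.symm, h1, absurd rfl h]
  have hG' : ∀ b, MeasurableSet {ζ | G b ζ} := by
    rintro (_ | _)
    · exact (measurableSet_someFrog w z hC).compl
    · exact ((measurable_pi_apply 0).comp (measurable_snd.comp (measurable_pi_apply (root d)))) hA
  have hG : ∀ b y, MeasurableSet {ζ | G b ζ = y} := by
    intro b y
    by_cases hy : y
    · simpa [hy] using hG' b
    · convert (hG' b).compl using 1
      ext ζ
      simp [hy]
  have hloc : ∀ b ζ ζ', (∀ v ∈ B b, ζ v = ζ' v) → G b ζ = G b ζ' := by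
    rintro (_ | _) ζ ζ' h
    · exact propext (not_congr ⟨fun hf => hf.congr hz h,
        fun hf => hf.congr hz fun v hv => (h v hv).symm⟩)
    · have := h (root d) rfl
      simp only [G, cond_true, this]
  have := hm.indep_blocks hB hG hloc fun _ => True
  rw [Fintype.prod_bool] at this
  simp only [eq_iff_iff, iff_true] at this
  rw [← show (⋂ b, {ω | G b (frogConfig η S ω)}) = {ω | S ω (root d) 0 ∈ A} ∩
    {ω | ¬ SomeFrog w z C (frogConfig η S ω)} by
      ext ω; simp [G, and_comm, frogConfig]]
  exact this

/-- The probability that no woken frog returns to the root and then follows a path of `C`. -/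
theorem measure_no_return_le (hd : 2 ≤ d) (hμ : 2 * ((d : ℝ) + 1) * Real.log d < μ) (n : ℕ)
    {C : Set (ℕ → DaryVertex d)} (hC : MeasurableSet C) :
    P {ω | ∀ v, IsWoken (root d) (η ω) (S ω) v → ∀ i < η ω v, ∀ k, S ω v i k = root d →
      pathShift k (S ω v i) ∉ C} ≤
      ENNReal.ofReal (Real.exp (-((n * levelGain d μ) *
        min ((walkLaw P S (root d)).real C) (d * branchWeight d)))) := by
  set ε := Real.exp (-((n * levelGain d μ) *
        min ((walkLaw P S (root d)).real C) (d * branchWeight d))) with hε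
  have hQ := hm.isWalkLaw
  have := hQ.prob (root d)
  have hl : (root d).level < n + 1 := Nat.succ_pos n
  have hex : ∀ z : leaves (root d) (n + 1), ∃ a, IsAncestor ((root d).child a) z :=
    fun z => (exists_branch hl z.2).imp fun a => branch_eq_some.1
  choose a ha using hex
  let E : leaves (root d) (n + 1) → Set Ω := fun z =>
    {ω | S ω (root d) 0 ∈ exitAt (subtreeBelow (root d) (n + 1)) z}
  have hmS := (hm.walk_law (root d) 0).measurable
  have hexit : ∀ᵐ ω ∂P, S ω (root d) 0 ∈ exitLeaves (root d) (n + 1) := by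
    have h1 : ∀ᵐ x ∂(walkLaw P S (root d)), x ∈ exitLeaves (root d) (n + 1) := by
      refine (mem_ae_iff_prob_eq_one (measurableSet_exitLeaves _ _)).2 ?_
      have := exitLeaves_root hd hQ (n + 1)
      rwa [measureReal_def, ENNReal.toReal_eq_one_iff] at this
    exact ae_of_ae_map hmS.aemeasurable h1
  -- The initial frog exits at some `z` of level `n + 1` and wakes it; if no woken frog returns and
  -- follows `C`, then in particular none of the branch containing `z` does.
  have hcover : ∀ᵐ ω ∂P, ω ∈ {ω | ∀ v, IsWoken (root d) (η ω) (S ω) v → ∀ i < η ω v, ∀ k,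
      S ω v i k = root d → pathShift k (S ω v i) ∉ C} → ω ∈ ⋃ z, E z ∩
      {ω | ¬ SomeFrog ((root d).child (a z)) z (visitThen (root d) C) (frogConfig η S ω)} := by
    filter_upwards [hexit, hm.count_root, ae_walks hm] with ω hω h1 ⟨h2, h3⟩ hB
    simp only [exitLeaves, Set.mem_iUnion] at hω
    obtain ⟨z, hz, hωz⟩ := hω
    refine Set.mem_iUnion.2 ⟨⟨z, hz⟩, hωz, ?_⟩
    rintro ⟨v, hv, i, hi, k, hk, hkC⟩
    have hzw : IsWoken (root d) (η ω) (S ω) z := by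
      obtain ⟨k, hk, -⟩ := hωz
      rw [← hk]
      exact isWoken_origin.visit h2 (by omega) k
    exact hB v (hzw.wakes h2 h3 hv) i hi k hk hkC
  have hEm : ∀ z, MeasurableSet (E z) := fun z => hmS (measurableSet_exitAt _ _)
  have hEd : Pairwise (Function.onFun Disjoint E) := by
    intro z z' hne
    refine Set.disjoint_left.2 fun ω h h' => Set.disjoint_left.1 (disjoint_exitAt
      (fun hz => ?_) (fun hz => ?_) (Subtype.coe_ne_coe.2 hne)) h h'
    · exact hz.2.ne z.2.2
    · exact hz.2.ne z'.2.2
  calc P {ω | ∀ v, IsWoken (root d) (η ω) (S ω) v → ∀ i < η ω v, ∀ k, S ω v i k = root d →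
        pathShift k (S ω v i) ∉ C}
      ≤ P (⋃ z, E z ∩ {ω | ¬ SomeFrog ((root d).child (a z)) z (visitThen (root d) C)
          (frogConfig η S ω)}) := measure_mono_ae hcover
    _ ≤ ∑' z, P (E z ∩ {ω | ¬ SomeFrog ((root d).child (a z)) z (visitThen (root d) C)
          (frogConfig η S ω)}) := measure_iUnion_le _
    _ ≤ ∑' z, P (E z) * ENNReal.ofReal ε := by
        refine ENNReal.tsum_le_tsum fun z => ?_
        rw [measure_exit_inter hm _ _ (child_ne_root _ _) (ha z) (measurableSet_exitAt _ _)
          (measurableSet_visitThen _ hC)]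
        refine mul_le_mul_right ?_ _
        -- A child of the root has level `1`, so `n` levels remain down to level `n + 1`.
        have := avoid_le hm hd hμ (n + 1) n ((root d).child (a z)) (child_ne_root _ _)
          (by rw [level_child]; exact (add_comm _ _).trans (by rfl)) ⟨ha z, z.2.2⟩ hC
        rw [parent_child] at this
        rw [← ofReal_measureReal]
        exact ENNReal.ofReal_le_ofReal this
    _ = P (⋃ z, E z) * ENNReal.ofReal ε := by
        rw [ENNReal.tsum_mul_right, measure_iUnion hEd hEm]
    _ ≤ 1 * ENNReal.ofReal ε := by gcongr; exact prob_le_one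
    _ = ENNReal.ofReal ε := one_mul _

theorem measure_no_return_eq_zero (hd : 2 ≤ d) (hμ : 2 * ((d : ℝ) + 1) * Real.log d < μ)
    {C : Set (ℕ → DaryVertex d)} (hC : MeasurableSet C)
    (hpos : 0 < (walkLaw P S (root d)).real C) :
    P {ω | ∀ v, IsWoken (root d) (η ω) (S ω) v → ∀ i < η ω v, ∀ k, S ω v i k = root d →
      pathShift k (S ω v i) ∉ C} = 0 := by
  have hc : 0 < levelGain d μ * min ((walkLaw P S (root d)).real C) (d * branchWeight d) :=
    mul_pos (levelGain_pos hd hμ)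
      (lt_min hpos (mul_pos (by positivity) (branchWeight_pos hd)))
  have hlim : Tendsto (fun n : ℕ => ENNReal.ofReal (Real.exp (-((n * levelGain d μ) *
      min ((walkLaw P S (root d)).real C) (d * branchWeight d))))) atTop (nhds 0) := by
    rw [← ENNReal.ofReal_zero]
    refine (ENNReal.continuous_ofReal.tendsto 0).comp (Real.tendsto_exp_neg_atTop_nhds_zero.comp ?_)
    simp only [mul_assoc]
    exact tendsto_natCast_atTop_atTop.atTop_mul_const hc
  exact le_antisymm (ge_of_tendsto' hlim fun n => measure_no_return_le hm hd hμ n hC) (zero_le)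

end Recurrence

theorem mainTheorem2 (d : ℕ) (hd : 2 ≤ d) (μ : ℝ≥0)
    (hμ : 2 * ((d : ℝ) + 1) * Real.log d < (μ : ℝ))
    {Ω : Type*} [MeasurableSpace Ω] (P : Measure Ω) [IsProbabilityMeasure P]
    (η : Ω → DaryVertex d → ℕ) (S : Ω → DaryVertex d → ℕ → ℕ → DaryVertex d)
    (hmodel : IsPoissonFrogModel (daryTree d) (DaryVertex.root d) μ P η S) :
    ∀ᵐ ω ∂P, IsRecurrent (DaryVertex.root d) (η ω) (S ω) := by
  let a : Fin d := ⟨0, by omega⟩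
  have h : ∀ r, ∀ᵐ ω ∂P, ¬ ∀ v, IsWoken (root d) (η ω) (S ω) v → ∀ i < η ω v, ∀ k,
      S ω v i k = root d → pathShift k (S ω v i) ∉ leavesRay a r := fun r => by
    rw [ae_iff]
    simp only [not_not]
    exact measure_no_return_eq_zero hmodel hd hμ (measurableSet_leavesRay a r)
      (leavesRay_pos hd hmodel.isWalkLaw a r)
  filter_upwards [ae_all_iff.2 h] with ω hω
  by_contra hrec
  -- Finitely many visits give finitely many continuations from the root, all of which avoid
  -- `leavesRay a r` for some large `r`, contradicting `hω r`.
  have hfin := finite_visits_of_not_isRecurrent hrec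
  have hev := (eventually_all_finite hfin (l := atTop)
    (p := fun q r => pathShift q.2.2 (S ω q.1 q.2.1) ∉ leavesRay a r)).2
    fun q _ => eventually_notMem_leavesRay a _
  obtain ⟨r, hr⟩ := hev.exists
  exact hω r fun v hv i hi k hk => hr (v, i, k) ⟨hv, hi, hk⟩
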